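/- Let $M$ be a smooth manifold without boundary (Hausdorff, $\sigma$-compact), let $\omega$ be a symplectic form on $M$, and suppose that $(M,\omega)$ is exact. A *Liouville vector field* is a smooth vector field $X$ on $M$ such that $d(\iota_X\omega)=\omega$; its (local) flow is denoted by $\mu_t$. Uniform ($C^0$) convergence of maps into $M$ is understood with respect to a fixed distance inducing the topology of $M$. A *symplectic homeomorphism* is a homeomorphism of $M$ which is the $C^0$-limit of a sequence of symplectic diffeomorphisms supported in a common compact set. A *$C^0$-Hamiltonian isotopy* is a path $(\phi^t)_{t\in[0,\delta]}$ of homeomorphisms of $M$ for which there are a compact set $K\subset M$, a sequence of smooth functions $H_n:[0,\delta]\times M\to\mathbb{R}$ vanishing outside $[0,\delta]\times K$ and a continuous function $H:[0,\delta]\times M\to\mathbb{R}$ such that $H_n\to H$ uniformly and the Hamiltonian flows $\phi_{H_n}^t$ (generated by the vector fields $X_{H_n}$ with $\iota_{X_{H_n}(t,\cdot)}\omega=d(H_n(t,\cdot))$) converge to $\phi^t$ in the $C^0$-sense, uniformly in $t\in[0,\delta]$. For a compactly supported homeomorphism $\phi$ of $M$ and $t\geq 0$ so small that $\mu_t$ is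 defined on $\mathrm{Supp}(\phi)$, let $\mu_t\circ\phi\circ\mu_t^{-1}$ denote the homeomorphism defined by this formula on $\mu_t(\mathrm{Supp}(\phi))$ and extended by the identity, and let $[\mu_t,\phi]=\mu_t\circ\phi\circ\mu_t^{-1}\circ\phi^{-1}$. Let $G_3$ be the set of all compactly supported symplectic homeomorphisms $\phi$ for which there is some $\delta>0$ such that $\mu_t$ is defined on $\mathrm{Supp}(\phi)$ for all $t\in[0,\delta]$ and $([\mu_t,\phi])_{t\in[0,\delta]}$ is a $C^0$-Hamiltonian isotopy. Then, for every Liouville vector field $X$, the set $G_3$ is a group under composition (a subgroup of the group of homeomorphisms of $M$). Moreover, if the first compactly supported de Rham cohomology group $H^1_c(M,\mathbb{R})$ vanishes, then any two Liouville vector fields of $(M,\omega)$ define the same set $G_3$. -/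

import Mathlib

open Set Filter Topology
open scoped Manifold ContDiff

/-!
Exact symplectic manifolds, Liouville vector fields, `C⁰`-Hamiltonian isotopies and the set `G₃`.

`M` is a smooth manifold without boundary modelled on a finite-dimensional real normed space `E`.
It carries a distance inducing its topology, which is used to speak of uniform (`C⁰`) convergence.
All sequences of maps whose `C⁰`-convergence is considered are supported in a common compact set, so
that convergence does not depend on the distance.
-/

noncomputable section

namespace CalabiGroups

section Forms

variable (E : Type*) [NormedAddCommGroup E] [NormedSpace ℝ E]
  (M : Type*) [TopologicalSpace M] [ChartedSpace E M]

/-- Differential forms of degree `k` on `M` (no regularity is imposed here). -/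
abbrev DiffForm (k : ℕ) : Type _ :=
  (x : M) → TangentSpace 𝓘(ℝ, E) x [⋀^Fin k]→L[ℝ] ℝ

/-- Vector fields on `M` (no regularity is imposed here). -/
abbrev VField : Type _ := (x : M) → TangentSpace 𝓘(ℝ, E) x

variable {E M}

/-- The expression of a form in the chart around `x₀`: its pullback by the inverse of the chart,
a form on the target of the chart (an open subset of `E`). -/
def chartRep {k : ℕ} (α : DiffForm E M k) (x₀ : M) (y : E) : E [⋀^Fin k]→L[ℝ] ℝ :=
  (α ((extChartAt 𝓘(ℝ, E) x₀).symm y)).compContinuousLinearMap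
    (mfderiv 𝓘(ℝ, E) 𝓘(ℝ, E) (extChartAt 𝓘(ℝ, E) x₀).symm y)

/-- A form is smooth if its expressions in the charts are. -/
def IsSmoothForm {k : ℕ} (α : DiffForm E M k) : Prop :=
  ∀ x₀ : M, ContDiffOn ℝ ∞ (chartRep α x₀) (extChartAt 𝓘(ℝ, E) x₀).target

/-- The exterior derivative of a form on `M`: at `x`, it is computed in the chart around `x` and
pulled back by the chart. -/
def dForm {k : ℕ} (α : DiffForm E M k) : DiffForm E M (k + 1) := fun x =>
  (extDeriv (chartRep α x) (extChartAt 𝓘(ℝ, E) x x)).compContinuousLinearMap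
    (mfderiv 𝓘(ℝ, E) 𝓘(ℝ, E) (extChartAt 𝓘(ℝ, E) x) x)

/-- The differential of a function, as a `1`-form. -/
def dFun (f : M → ℝ) : DiffForm E M 1 := fun x =>
  ContinuousAlternatingMap.ofSubsingleton ℝ (TangentSpace 𝓘(ℝ, E) x) ℝ (0 : Fin 1)
    (mfderiv 𝓘(ℝ, E) 𝓘(ℝ, ℝ) f x)

/-- The contraction `ι_X α`. -/
def contract {k : ℕ} (X : VField E M) (α : DiffForm E M (k + 1)) : DiffForm E M k := fun x =>
  ContinuousAlternatingMap.curryLeft (E := E) (α x) (X x)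

/-- The pullback `f^* α` by a map `f : M → M`. -/
def pullbackForm {k : ℕ} (f : M → M) (α : DiffForm E M k) : DiffForm E M k := fun x =>
  (α (f x)).compContinuousLinearMap (mfderiv 𝓘(ℝ, E) 𝓘(ℝ, E) f x)

/-- The form has compact support. -/
def HasCompactSupportForm {k : ℕ} (α : DiffForm E M k) : Prop :=
  ∃ K : Set M, IsCompact K ∧ ∀ x, x ∉ K → α x = 0

/-! ### The first de Rham cohomology group with compact support -/

lemma chartRep_add {k : ℕ} (α β : DiffForm E M k) (x₀ : M) :
    chartRep (α + β) x₀ = chartRep α x₀ + chartRep β x₀ := rfl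

lemma chartRep_smul {k : ℕ} (c : ℝ) (α : DiffForm E M k) (x₀ : M) :
    chartRep (c • α) x₀ = c • chartRep α x₀ := rfl

lemma IsSmoothForm.differentiableAt {k : ℕ} {α : DiffForm E M k} (h : IsSmoothForm α) (x : M) :
    DifferentiableAt ℝ (chartRep α x) (extChartAt 𝓘(ℝ, E) x x) :=
  ((h x).contDiffAt (extChartAt_target_mem_nhds x)).differentiableAt (by simp)

lemma dForm_add {k : ℕ} {α β : DiffForm E M k} (hα : IsSmoothForm α) (hβ : IsSmoothForm β) :
    dForm (α + β) = dForm α + dForm β := by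
  funext x
  simp only [dForm, chartRep_add, Pi.add_apply,
    extDeriv_add (hα.differentiableAt x) (hβ.differentiableAt x)]
  rfl

lemma dForm_smul {k : ℕ} (c : ℝ) (α : DiffForm E M k) : dForm (c • α) = c • dForm α := by
  funext x
  simp only [dForm, chartRep_smul, extDeriv_smul, Pi.smul_apply]
  rfl

variable (E M)

/-- The smooth closed `1`-forms with compact support. -/
def closedCompact1 : AddSubgroup (DiffForm E M 1) where
  carrier := {α | IsSmoothForm α ∧ HasCompactSupportForm α ∧ dForm α = 0}
  zero_mem' := by
    refine ⟨fun x₀ => ?_, ⟨∅, isCompact_empty, fun _ _ => rfl⟩, ?_⟩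
    · exact contDiffOn_const (c := (0 : E [⋀^Fin 1]→L[ℝ] ℝ))
    · have := dForm_smul (0 : ℝ) (0 : DiffForm E M 1)
      simpa using this
  add_mem' := by
    rintro α β ⟨h1, ⟨K, hK, hK'⟩, h3⟩ ⟨h1', ⟨L, hL, hL'⟩, h3'⟩
    refine ⟨fun x₀ => (h1 x₀).add (h1' x₀), ⟨K ∪ L, hK.union hL, fun x hx => ?_⟩, ?_⟩
    · simp only [mem_union, not_or] at hx
      rw [Pi.add_apply, hK' x hx.1, hL' x hx.2, add_zero]
    · rw [dForm_add h1 h1', h3, h3', add_zero]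
  neg_mem' := by
    rintro α ⟨h1, ⟨K, hK, hK'⟩, h3⟩
    refine ⟨fun x₀ => (h1 x₀).neg, ⟨K, hK, fun x hx => ?_⟩, ?_⟩
    · rw [Pi.neg_apply, hK' x hx, neg_zero]
    · rw [← neg_one_smul ℝ α, dForm_smul, h3, smul_zero]

/-- The differentials of the smooth functions with compact support. -/
def exactCompact1 : AddSubgroup (DiffForm E M 1) where
  carrier := {α | ∃ f : M → ℝ, ContMDiff 𝓘(ℝ, E) 𝓘(ℝ, ℝ) ∞ f ∧
    (∃ K : Set M, IsCompact K ∧ ∀ x, x ∉ K → f x = 0) ∧ α = dFun f}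
  zero_mem' := by
    refine ⟨fun _ => 0, contMDiff_const, ⟨∅, isCompact_empty, fun _ _ => rfl⟩, ?_⟩
    funext x
    simp only [dFun, mfderiv_const]
    rfl
  add_mem' := by
    rintro α β ⟨f, hf, ⟨K, hK, hK'⟩, rfl⟩ ⟨g, hg, ⟨L, hL, hL'⟩, rfl⟩
    refine ⟨f + g, hf.add hg, ⟨K ∪ L, hK.union hL, fun x hx => ?_⟩, ?_⟩
    · simp only [mem_union, not_or] at hx
      rw [Pi.add_apply, hK' x hx.1, hL' x hx.2, add_zero]
    · funext x
      simp only [dFun, Pi.add_apply]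
      rw [mfderiv_add ((hf x).mdifferentiableAt (by simp)) ((hg x).mdifferentiableAt (by simp))]
      rfl
  neg_mem' := by
    rintro α ⟨f, hf, ⟨K, hK, hK'⟩, rfl⟩
    refine ⟨-f, hf.neg, ⟨K, hK, fun x hx => ?_⟩, ?_⟩
    · rw [Pi.neg_apply, hK' x hx, neg_zero]
    · funext x
      simp only [dFun, Pi.neg_apply]
      rw [mfderiv_neg]
      rfl

/-- The first de Rham cohomology group with compact support `H¹_c(M, ℝ)`: smooth closed compactly
supported `1`-forms modulo differentials of smooth compactly supported functions. -/
abbrev H1c : Type _ :=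
  closedCompact1 E M ⧸ (exactCompact1 E M).addSubgroupOf (closedCompact1 E M)

end Forms

section Symplectic

variable {E : Type*} [NormedAddCommGroup E] [NormedSpace ℝ E]
  {M : Type*} [MetricSpace M] [ChartedSpace E M] [IsManifold 𝓘(ℝ, E) ∞ M]

/-- Symplectic forms: smooth, closed, nondegenerate `2`-forms. -/
structure IsSymplecticForm (Ω : DiffForm E M 2) : Prop where
  smooth : IsSmoothForm Ω
  closed : dForm Ω = 0
  nondegenerate : ∀ (x : M) (v : TangentSpace 𝓘(ℝ, E) x),
    (∀ w : TangentSpace 𝓘(ℝ, E) x, Ω x ![v, w] = 0) → v = 0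

/-- Liouville vector fields: smooth vector fields `X` such that `d (ι_X Ω) = Ω`, i.e. such that
`ι_X Ω` is a Liouville form. -/
structure IsLiouvilleField (Ω : DiffForm E M 2) (X : VField E M) : Prop where
  smooth : ContMDiff 𝓘(ℝ, E) 𝓘(ℝ, E).tangent ∞
    (fun x => (⟨x, X x⟩ : TangentBundle 𝓘(ℝ, E) M))
  d_contract : dForm (contract X Ω) = Ω

/-- The (closed) support of a map `φ : M → M`. -/
def homeoSupport (φ : M → M) : Set M := closure {x | φ x ≠ x}

/-- Symplectic diffeomorphisms. -/
def IsSymplecticDiffeo (Ω : DiffForm E M 2) (f : Diffeomorph 𝓘(ℝ, E) 𝓘(ℝ, E) M M ∞) : Prop :=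
  pullbackForm f Ω = Ω

/-- (Compactly supported) symplectic homeomorphisms: homeomorphisms that are `C⁰`-limits of
sequences of symplectic diffeomorphisms supported in a common compact set. -/
def IsSymplecticHomeo (Ω : DiffForm E M 2) (φ : M ≃ₜ M) : Prop :=
  ∃ (K : Set M) (f : ℕ → Diffeomorph 𝓘(ℝ, E) 𝓘(ℝ, E) M M ∞),
    IsCompact K ∧ (∀ n, IsSymplecticDiffeo Ω (f n)) ∧ (∀ n, homeoSupport (f n) ⊆ K) ∧
    TendstoUniformly (fun n => (f n : M → M)) φ atTop

/-- `Φ` is the Hamiltonian flow, on the time interval `[0, δ]`, of the time-dependent Hamiltonian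
function `H` on `[0, δ] × M`: it is a smooth isotopy of diffeomorphisms starting at the
identity whose velocity at time `t` is the vector field `V t` with `ι_{V t} Ω = d (H t)`. -/
structure IsHamiltonianFlow (Ω : DiffForm E M 2) (δ : ℝ) (H : ℝ → M → ℝ)
    (Φ : ℝ → Diffeomorph 𝓘(ℝ, E) 𝓘(ℝ, E) M M ∞) : Prop where
  smooth : ContMDiffOn (𝓘(ℝ, ℝ).prod 𝓘(ℝ, E)) 𝓘(ℝ, E) ∞
    (fun p : ℝ × M => Φ p.1 p.2) (Icc 0 δ ×ˢ univ)
  smooth_symm : ContMDiffOn (𝓘(ℝ, ℝ).prod 𝓘(ℝ, E)) 𝓘(ℝ, E) ∞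
    (fun p : ℝ × M => (Φ p.1).symm p.2) (Icc 0 δ ×ˢ univ)
  init : ∀ x, Φ 0 x = x
  velocity : ∃ V : ℝ → VField E M,
    (∀ t ∈ Icc 0 δ, contract (V t) Ω = dFun (H t)) ∧
    ∀ t ∈ Icc 0 δ, ∀ x, HasMFDerivWithinAt 𝓘(ℝ, ℝ) 𝓘(ℝ, E) (fun s => Φ s x) (Icc 0 δ) t
      ((1 : ℝ →L[ℝ] ℝ).smulRight (V t (Φ t x)))

/-- `C⁰`-Hamiltonian isotopies `(φ t)`, `t ∈ [0, δ]`. -/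
def IsC0HamiltonianIsotopy (Ω : DiffForm E M 2) (δ : ℝ) (φ : ℝ → M → M) : Prop :=
  (∀ t ∈ Icc 0 δ, IsHomeomorph (φ t)) ∧
  ∃ (K : Set M) (Hn : ℕ → ℝ → M → ℝ) (Φ : ℕ → ℝ → Diffeomorph 𝓘(ℝ, E) 𝓘(ℝ, E) M M ∞)
    (H : ℝ → M → ℝ),
    IsCompact K ∧
    (∀ n, ContMDiffOn (𝓘(ℝ, ℝ).prod 𝓘(ℝ, E)) 𝓘(ℝ, ℝ) ∞
      (fun p : ℝ × M => Hn n p.1 p.2) (Icc 0 δ ×ˢ univ)) ∧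
    (∀ n, ∀ t ∈ Icc 0 δ, ∀ x, x ∉ K → Hn n t x = 0) ∧
    (∀ n, IsHamiltonianFlow Ω δ (Hn n) (Φ n)) ∧
    ContinuousOn (fun p : ℝ × M => H p.1 p.2) (Icc 0 δ ×ˢ univ) ∧
    TendstoUniformlyOn (fun n (p : ℝ × M) => Hn n p.1 p.2) (fun p => H p.1 p.2) atTop
      (Icc 0 δ ×ˢ univ) ∧
    TendstoUniformlyOn (fun n (p : ℝ × M) => Φ n p.1 p.2) (fun p => φ p.1 p.2) atTop
      (Icc 0 δ ×ˢ univ)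

/-- `γ` is an integral curve of `X` starting at `x`, on the interval between `0` and `t`. -/
def IsTrajectory (X : VField E M) (t : ℝ) (x : M) (γ : ℝ → M) : Prop :=
  γ 0 = x ∧ IsMIntegralCurveOn γ X (uIcc 0 t)

/-- The flow of `X` is defined at time `t` and point `x`. -/
def FlowDefinedAt (X : VField E M) (t : ℝ) (x : M) : Prop := ∃ γ, IsTrajectory X t x γ

open Classical in
/-- The (local) flow `μ_t(x)` of `X`; the value is junk if it is not defined at `(t, x)`. -/
def flow (X : VField E M) (t : ℝ) (x : M) : M :=
  if h : FlowDefinedAt X t x then h.choose t else x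

open Classical in
/-- The conjugation `μ_t ∘ φ ∘ μ_t⁻¹` by the flow of `X`, defined on the image by `μ_t` of the
support of `φ` and extended by the identity. -/
def flowConj (X : VField E M) (φ : M ≃ₜ M) (t : ℝ) (y : M) : M :=
  if y ∈ flow X t '' homeoSupport φ then flow X t (φ (flow X (-t) y)) else y

/-- The commutator `[μ_t, φ] = μ_t ∘ φ ∘ μ_t⁻¹ ∘ φ⁻¹`. -/
def flowCommutator (X : VField E M) (φ : M ≃ₜ M) (t : ℝ) (x : M) : M :=
  flowConj X φ t (φ.symm x)

/-- The set `G₃`: compactly supported symplectic homeomorphisms `φ` such that for some `δ > 0`,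
so small that `μ_t` is defined on the support of `φ` for `t ∈ [0, δ]`, the isotopy
`([μ_t, φ])`, `t ∈ [0, δ]`, is a `C⁰`-Hamiltonian isotopy. -/
def G3 (Ω : DiffForm E M 2) (X : VField E M) : Set (M ≃ₜ M) :=
  {φ | IsSymplecticHomeo Ω φ ∧ IsCompact (homeoSupport φ) ∧
    ∃ δ : ℝ, 0 < δ ∧ (∀ t ∈ Icc 0 δ, ∀ x ∈ homeoSupport φ, FlowDefinedAt X t x) ∧
      IsC0HamiltonianIsotopy Ω δ (flowCommutator X φ)}

end Symplectic

end CalabiGroups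

end

/-!
# Commutators with the Liouville flow and `C⁰`-Hamiltonian isotopies

An isotopy `f` of `M` is described by its generating one-forms `ι_{∂ₜ fₜ} Ω` (`HasGenerator`); it is
Hamiltonian exactly when they are exact. A composition, an inverse or a conjugate of isotopies has a
generating form which is a sum of pullbacks of the given ones. A `C⁰`-Hamiltonian isotopy is a
uniform limit of smooth Hamiltonian isotopies whose Hamiltonians converge as well
(`HamiltonianApprox`), and the class of these is closed under composition, inversion and conjugation
by symplectic homeomorphisms: all the Hamiltonians involved are composed with maps that converge
uniformly, so they converge uniformly.

**Group property.** With `μ` the Liouville flow,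
`[μₜ, φψ] = [μₜ, φ] ∘ φ [μₜ, ψ] φ⁻¹` and `[μₜ, φ⁻¹] = φ⁻¹ [μₜ, φ]⁻¹ φ`,
so the three closure properties give the result.

**Independence of the Liouville field.** Let `X`, `X'` be Liouville fields with flows `μ`, `μ'`. The
form `α = ι_{X'}Ω - ι_XΩ` is closed, and `σₜ = μ'ₜ ∘ μₜ⁻¹` is a symplectic isotopy near the support
of `φ`, with a generating form built from `α` and the conformal factor `eᵗ`. One has
`[μ'ₜ, φ] = σₜ ∘ [μₜ, φ] ∘ φ σₜ⁻¹ φ⁻¹`.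
If `Φₙ → [μ, φ]` are Hamiltonian isotopies and `fₙ → φ` are symplectic diffeomorphisms, then the left
side is the uniform limit of `σₜ Φₙ fₙ σₜ⁻¹ fₙ⁻¹`, whose generating form is
`eᵗ (p^* α - q^* α) + dK` where `K` comes from the Hamiltonian of `Φₙ`, the map `p` is uniformly
close to the identity for small `t`, and `q` is uniformly close to the fixed diffeomorphism
`g = f_N⁻¹`. A closed form has, on a compact set, increments of primitives between nearby points that
are continuous in both points (`exists_isIncrement`). They supply primitives of `p^* α - α` and of
`q^* α - g^* α` that depend on `p` and `q` only in the `C⁰` sense. The remaining form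
`α - g^* α` is closed with compact support, so it has a compactly supported primitive when the first
compactly supported cohomology vanishes (`exists_compact_primitive`). The Hamiltonians so obtained
converge uniformly.

The fields need not be complete. On a compact set the flow is that of a compactly supported cutoff
(`exists_cutoff_flow`), and the smooth dependence of a flow on its initial point comes from the
implicit function theorem applied to superposition operators on spaces of continuous curves.
-/

open Set Filter Topology
open scoped Manifold ContDiff

noncomputable section

namespace CalabiGroups



/-! ### Exterior derivatives in coordinates -/

lemma two_le_infty : (2 : WithTop ℕ∞) ≤ ∞ := WithTop.coe_le_coe.2 le_top

lemma one_le_infty : (1 : WithTop ℕ∞) ≤ ∞ := WithTop.coe_le_coe.2 le_top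

section Euclid

variable {E F : Type*} [NormedAddCommGroup E] [NormedSpace ℝ E]
  [NormedAddCommGroup F] [NormedSpace ℝ F]

lemma extDeriv_two_form_apply {β : E → E [⋀^Fin 2]→L[ℝ] ℝ} {p : E} (hβ : DifferentiableAt ℝ β p)
    (a b c : E) : extDeriv β p ![a, b, c] =
      fderiv ℝ (fun q => β q ![b, c]) p a - fderiv ℝ (fun q => β q ![a, c]) p b
        + fderiv ℝ (fun q => β q ![a, b]) p c := by
  rw [extDeriv_apply hβ]
  have e0 : (0 : Fin 3).removeNth ![a, b, c] = ![b, c] := by ext i; fin_cases i <;> rfl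
  have e1 : (1 : Fin 3).removeNth ![a, b, c] = ![a, c] := by ext i; fin_cases i <;> rfl
  have e2 : (2 : Fin 3).removeNth ![a, b, c] = ![a, b] := by ext i; fin_cases i <;> rfl
  rw [Fin.sum_univ_three, e0, e1, e2]
  simp
  ring

lemma extDeriv_one_form_apply {β : E → E [⋀^Fin 1]→L[ℝ] ℝ} {p : E} (hβ : DifferentiableAt ℝ β p)
    (a b : E) : extDeriv β p ![a, b] =
      fderiv ℝ (fun q => β q ![b]) p a - fderiv ℝ (fun q => β q ![a]) p b := by
  rw [extDeriv_apply hβ]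
  have e0 : (0 : Fin 2).removeNth ![a, b] = ![b] := by ext i; fin_cases i; rfl
  have e1 : (1 : Fin 2).removeNth ![a, b] = ![a] := by ext i; fin_cases i; rfl
  rw [Fin.sum_univ_two, e0, e1]
  simp
  ring

lemma differentiableAt_pullback {n : ℕ} {f : F → E} {x : F} {β : E → E [⋀^Fin n]→L[ℝ] ℝ}
    (hβ : DifferentiableAt ℝ β (f x)) (hf : ContDiffAt ℝ ∞ f x) :
    DifferentiableAt ℝ (fun y => (β (f y)).compContinuousLinearMap (fderiv ℝ f y)) x := by
  have hf0 : DifferentiableAt ℝ f x := hf.differentiableAt (by simp)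
  have hf1 : DifferentiableAt ℝ (fderiv ℝ f) x :=
    (hf.fderiv_right (m := 1) (by norm_num [two_le_infty])).differentiableAt (by simp)
  exact ((hβ.comp x hf0).hasFDerivAt.continuousAlternatingMapCompContinuousLinearMap
    hf1.hasFDerivAt).differentiableAt

/-- The time derivative of the pullback of a closed `2`-form `Ω` by a family of maps `F (t, ·)` whose
velocity is `Ω`-dual to a `1`-form `θ` with `dθ = c Ω`. This is Cartan's formula, obtained from
`d (F^* Ω) = 0` on space-time: evaluated on the time direction and on two space directions, it
expresses the time derivative by the exterior derivative of the slice of `F^* θ`. -/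
lemma hasDerivAt_pullback_pair {F : ℝ × E → E} {t : ℝ} {z : E} (hF : ContDiffAt ℝ ∞ F (t, z))
    {Ω : E → E [⋀^Fin 2]→L[ℝ] ℝ} (hΩ : DifferentiableAt ℝ Ω (F (t, z)))
    (hclosed : extDeriv Ω (F (t, z)) = 0)
    {θ : E → E [⋀^Fin 1]→L[ℝ] ℝ} (hθ : DifferentiableAt ℝ θ (F (t, z))) {c : ℝ}
    (hd : extDeriv θ (F (t, z)) = c • Ω (F (t, z)))
    (hvel : ∀ᶠ z' in 𝓝 z, ∀ w : E,
      Ω (F (t, z')) ![fderiv ℝ F (t, z') (1, 0), w] = θ (F (t, z')) ![w]) (u w : E) :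
    HasDerivAt (fun s => Ω (F (s, z)) ![fderiv ℝ F (s, z) (0, u), fderiv ℝ F (s, z) (0, w)])
      (c * Ω (F (t, z)) ![fderiv ℝ F (t, z) (0, u), fderiv ℝ F (t, z) (0, w)]) t := by
  set p : ℝ × E := (t, z) with hp
  let β : ℝ × E → (ℝ × E) [⋀^Fin 2]→L[ℝ] ℝ :=
    fun q => (Ω (F q)).compContinuousLinearMap (fderiv ℝ F q)
  have hβv : ∀ q a b, β q ![a, b] = Ω (F q) ![fderiv ℝ F q a, fderiv ℝ F q b] := by
    intro q a b
    simp only [β, ContinuousAlternatingMap.compContinuousLinearMap_apply]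
    congr 1
    ext i; fin_cases i <;> rfl
  have hβ : DifferentiableAt ℝ β p := differentiableAt_pullback hΩ hF
  have hβd : ∀ v, DifferentiableAt ℝ (fun q => β q v) p :=
    fun v => hβ.continuousAlternatingMap_apply_const v
  have h0 : extDeriv β p = 0 := by
    rw [extDeriv_pullback hΩ hF (by simp [two_le_infty]), hclosed]; rfl
  -- `d (F^* Ω) = 0` on the time direction and the two space directions
  have h1 := extDeriv_two_form_apply hβ ((1 : ℝ), (0 : E)) ((0 : ℝ), u) ((0 : ℝ), w)
  rw [h0] at h1
  -- the restriction of `F` to the slice at time `t`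
  let f : E → E := fun z' => F (t, z')
  have hι : ∀ z' : E, HasFDerivAt (fun z' : E => (t, z')) (ContinuousLinearMap.inr ℝ ℝ E) z' :=
    fun z' => hasFDerivAt_prodMk_right t z'
  have hf : ContDiffAt ℝ ∞ f z := hF.comp z (contDiffAt_const.prodMk contDiffAt_id)
  have hfd : ∀ᶠ z' in 𝓝 z, ∀ v, fderiv ℝ f z' v = fderiv ℝ F (t, z') (0, v) := by
    have h2 : ∀ᶠ q in 𝓝 p, DifferentiableAt ℝ F q := by
      have := (hF.of_le one_le_infty).eventually (by simp)
      exact this.mono fun q hq => hq.differentiableAt (by simp)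
    have h3 : Tendsto (fun z' : E => (t, z')) (𝓝 z) (𝓝 p) := (hι z).continuousAt
    filter_upwards [h3.eventually h2] with z' hz' v
    have := (hz'.hasFDerivAt.comp z' (hι z')).fderiv
    have e : f = F ∘ fun z' : E => (t, z') := rfl
    rw [e, this]
    simp
  have hslice : ∀ a b : E, fderiv ℝ (fun q => β q ![(1, 0), (0, b)]) p (0, a) =
      fderiv ℝ (fun z' => (θ (f z')).compContinuousLinearMap (fderiv ℝ f z') ![b]) z a := by
    intro a b
    have e1 := ((hβd ![(1, 0), (0, b)]).hasFDerivAt.comp z (hι z)).fderiv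
    have e2 : fderiv ℝ (fun q => β q ![(1, 0), (0, b)]) p (0, a) =
        fderiv ℝ ((fun q => β q ![(1, 0), (0, b)]) ∘ fun z' : E => (t, z')) z a := by
      rw [e1]; simp
    rw [e2]
    congr 1
    apply Filter.EventuallyEq.fderiv_eq
    filter_upwards [hvel, hfd] with z' h3 h4
    simp only [Function.comp_apply, hβv]
    rw [h3, ← h4, ContinuousAlternatingMap.compContinuousLinearMap_apply]
    congr 1
    ext i; fin_cases i; rfl
  have hθ' := differentiableAt_pullback (f := f) (x := z) hθ hf
  have h5 := extDeriv_one_form_apply hθ' u w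
  have h5' : extDeriv (fun y => (θ (f y)).compContinuousLinearMap (fderiv ℝ f y)) z =
      (extDeriv θ (f z)).compContinuousLinearMap (fderiv ℝ f z) :=
    extDeriv_pullback (f := f) hθ hf (by simp [two_le_infty])
  rw [h5'] at h5
  have h6 : ((extDeriv θ (f z)).compContinuousLinearMap (fderiv ℝ f z)) ![u, w] =
      c * Ω (F p) ![fderiv ℝ F p (0, u), fderiv ℝ F p (0, w)] := by
    rw [ContinuousAlternatingMap.compContinuousLinearMap_apply]
    change extDeriv θ (F p) _ = _
    rw [hd, ← hfd.self_of_nhds u, ← hfd.self_of_nhds w]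
    simp only [ContinuousAlternatingMap.smul_apply, smul_eq_mul]
    congr 2
    ext i; fin_cases i <;> rfl
  rw [hslice, hslice] at h1
  have h7 : fderiv ℝ (fun q => β q ![(0, u), (0, w)]) p (1, 0) =
      c * Ω (F p) ![fderiv ℝ F p (0, u), fderiv ℝ F p (0, w)] := by
    rw [← h6, h5]
    have : (0 : (ℝ × E) [⋀^Fin 3]→L[ℝ] ℝ) ![(1, 0), (0, u), (0, w)] = 0 := rfl
    rw [this] at h1
    linarith
  have h8 := (hβd ![(0, u), (0, w)]).hasFDerivAt.comp_hasDerivAt t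
    ((hasDerivAt_id t).prodMk (hasDerivAt_const t z))
  rw [h7] at h8
  refine h8.congr_of_eventuallyEq (Eventually.of_forall fun s => ?_)
  exact (hβv (s, z) _ _).symm

end Euclid



/-! ### Tangent maps and velocities -/

section TangentMaps

variable {E : Type*} [NormedAddCommGroup E] [NormedSpace ℝ E]
  {E' : Type*} [NormedAddCommGroup E'] [NormedSpace ℝ E']
  {E'' : Type*} [NormedAddCommGroup E''] [NormedSpace ℝ E'']
  {M : Type*} [TopologicalSpace M] [ChartedSpace E M]
  {M' : Type*} [TopologicalSpace M'] [ChartedSpace E' M']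
  {M'' : Type*} [TopologicalSpace M''] [ChartedSpace E'' M'']

/-- The differential of `f` at `x`, as a linear map between the model spaces (to which the tangent
spaces are equal by definition). -/
def tderiv (E E' : Type*) [NormedAddCommGroup E] [NormedSpace ℝ E] [NormedAddCommGroup E']
    [NormedSpace ℝ E'] {M M' : Type*} [TopologicalSpace M] [ChartedSpace E M] [TopologicalSpace M']
    [ChartedSpace E' M'] (f : M → M') (x : M) : E →L[ℝ] E' := mfderiv 𝓘(ℝ, E) 𝓘(ℝ, E') f x

lemma tderiv_comp {g : M' → M''} {f : M → M'} {x : M}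
    (hg : MDifferentiableAt 𝓘(ℝ, E') 𝓘(ℝ, E'') g (f x))
    (hf : MDifferentiableAt 𝓘(ℝ, E) 𝓘(ℝ, E') f x) :
    tderiv E E'' (fun y => g (f y)) x =
      (tderiv E' E'' g (f x)).comp (tderiv E E' f x) :=
  mfderiv_comp x hg hf

lemma tderiv_congr {f g : M → M'} {x : M} (h : f =ᶠ[𝓝 x] g) : tderiv E E' f x = tderiv E E' g x :=
  h.mfderiv_eq

lemma tderiv_id (x : M) : tderiv E E (fun y : M => y) x = ContinuousLinearMap.id ℝ E :=
  mfderiv_id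

lemma tderiv_const (c : M') (x : M) : tderiv E E' (fun _ : M => c) x = 0 :=
  mfderiv_const

lemma tderiv_eq_fderiv (f : E → E') (x : E) : tderiv E E' f x = fderiv ℝ f x :=
  mfderiv_eq_fderiv

/-- The curve `γ` has velocity `v` at time `t`, within the set `s` of times. -/
def HasVelocityWithin (γ : ℝ → M) (s : Set ℝ) (t : ℝ) (v : E) : Prop :=
  HasMFDerivWithinAt 𝓘(ℝ, ℝ) 𝓘(ℝ, E) γ s t
    ((1 : ℝ →L[ℝ] ℝ).smulRight (v : TangentSpace 𝓘(ℝ, E) (γ t)))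

lemma HasVelocityWithin.unique {γ : ℝ → M} {s : Set ℝ} {t : ℝ} {v w : E}
    (hs : UniqueDiffWithinAt ℝ s t) (hv : HasVelocityWithin γ s t v)
    (hw : HasVelocityWithin γ s t w) : v = w := by
  have h := UniqueMDiffWithinAt.eq (uniqueMDiffWithinAt_iff_uniqueDiffWithinAt.2 hs) hv hw
  have h1 := DFunLike.congr_fun h (1 : ℝ)
  change (1 : ℝ) • v = (1 : ℝ) • w at h1
  simpa using h1

lemma HasVelocityWithin.congr {γ γ' : ℝ → M} {s : Set ℝ} {t : ℝ} {v : E}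
    (hv : HasVelocityWithin γ s t v) (h : ∀ r ∈ s, γ' r = γ r) (ht : t ∈ s) :
    HasVelocityWithin γ' s t v := by
  have := HasMFDerivWithinAt.congr_of_eventuallyEq hv
    (eventually_mem_nhdsWithin.mono h) (h t ht)
  exact this

lemma hasVelocityWithin_const (x : M) (s : Set ℝ) (t : ℝ) :
    HasVelocityWithin (fun _ => x) s t (0 : E) := by
  have := (hasMFDerivWithinAt_const (I := 𝓘(ℝ, ℝ)) (I' := 𝓘(ℝ, E)) x s t)
  refine this.congr_mfderiv ?_
  ext
  change (0 : E) = (1 : ℝ) • (0 : E)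
  simp

lemma HasVelocityWithin.comp_mdifferentiableAt {γ : ℝ → M} {s : Set ℝ} {t : ℝ} {v : E}
    (hv : HasVelocityWithin γ s t v) {f : M → M'}
    (hf : MDifferentiableAt 𝓘(ℝ, E) 𝓘(ℝ, E') f (γ t)) :
    HasVelocityWithin (fun r => f (γ r)) s t (tderiv E E' f (γ t) v) := by
  have h := hf.hasMFDerivAt.comp_hasMFDerivWithinAt t hv
  refine h.congr_mfderiv ?_
  ext
  change tderiv E E' f (γ t) ((1 : ℝ) • v) = (1 : ℝ) • _
  simp

lemma HasVelocityWithin.hasDerivWithinAt {γ : ℝ → E} {s : Set ℝ} {t : ℝ} {v : E}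
    (hv : HasVelocityWithin γ s t v) : HasDerivWithinAt γ v s t :=
  (hasMFDerivWithinAt_iff_hasFDerivWithinAt.1 hv).congr_fderiv (by ext; rfl)

/-- A family of maps, smooth in time and space jointly, on the time interval `[0, δ]`. -/
def SmoothFamily (E E' : Type*) [NormedAddCommGroup E] [NormedSpace ℝ E] [NormedAddCommGroup E']
    [NormedSpace ℝ E'] {M M' : Type*} [TopologicalSpace M] [ChartedSpace E M] [TopologicalSpace M']
    [ChartedSpace E' M'] (δ : ℝ) (A : ℝ → M → M') : Prop :=
  ContMDiffOn (𝓘(ℝ, ℝ).prod 𝓘(ℝ, E)) 𝓘(ℝ, E') ∞ (fun p : ℝ × M => A p.1 p.2) (Icc 0 δ ×ˢ univ)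

/-- The velocity at time `t` of the curve `s ↦ A s x`, `s ∈ [0, δ]`. -/
def velocity (E' : Type*) [NormedAddCommGroup E'] [NormedSpace ℝ E']
    {M M' : Type*} [TopologicalSpace M'] [ChartedSpace E' M'] (δ : ℝ) (A : ℝ → M → M') (t : ℝ)
    (x : M) : E' :=
  (mfderivWithin 𝓘(ℝ, ℝ) 𝓘(ℝ, E') (fun s => A s x) (Icc 0 δ) t : ℝ →L[ℝ] E') 1

variable {δ t : ℝ}

lemma SmoothFamily.mdifferentiableWithinAt {A : ℝ → M → M'} (hA : SmoothFamily E E' δ A)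
    (ht : t ∈ Icc 0 δ) (x : M) :
    MDifferentiableWithinAt (𝓘(ℝ, ℝ).prod 𝓘(ℝ, E)) 𝓘(ℝ, E') (fun p : ℝ × M => A p.1 p.2)
      (Icc 0 δ ×ˢ univ) (t, x) :=
  (hA (t, x) ⟨ht, mem_univ _⟩).mdifferentiableWithinAt (by simp)

lemma SmoothFamily.contMDiff {A : ℝ → M → M'} (hA : SmoothFamily E E' δ A)
    (ht : t ∈ Icc 0 δ) : ContMDiff 𝓘(ℝ, E) 𝓘(ℝ, E') ∞ (A t) := by
  have h1 : ContMDiff 𝓘(ℝ, E) (𝓘(ℝ, ℝ).prod 𝓘(ℝ, E)) ∞ (fun x : M => (t, x)) :=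
    contMDiff_const.prodMk contMDiff_id
  exact hA.comp_contMDiff h1 fun x => ⟨ht, mem_univ _⟩

lemma SmoothFamily.mdifferentiableAt {A : ℝ → M → M'} (hA : SmoothFamily E E' δ A)
    (ht : t ∈ Icc 0 δ) (x : M) : MDifferentiableAt 𝓘(ℝ, E) 𝓘(ℝ, E') (A t) x :=
  (hA.contMDiff ht x).mdifferentiableAt (by simp)

lemma SmoothFamily.hasVelocityWithin {A : ℝ → M → M'} (hA : SmoothFamily E E' δ A)
    (ht : t ∈ Icc 0 δ) (x : M) :
    HasVelocityWithin (fun s => A s x) (Icc 0 δ) t (velocity E' δ A t x) := by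
  have h1 : HasMFDerivWithinAt 𝓘(ℝ, ℝ) (𝓘(ℝ, ℝ).prod 𝓘(ℝ, E)) (fun s : ℝ => (s, x)) (Icc 0 δ) t
      _ := (hasMFDerivWithinAt_id (Icc 0 δ) t).prodMk (hasMFDerivWithinAt_const x (Icc 0 δ) t)
  have h2 := HasMFDerivWithinAt.comp (g := fun p : ℝ × M => A p.1 p.2)
    (f := fun s : ℝ => (s, x)) t (hA.mdifferentiableWithinAt ht x).hasMFDerivWithinAt h1
    (fun s hs => ⟨hs, mem_univ _⟩)
  refine h2.mdifferentiableWithinAt.hasMFDerivWithinAt.congr_mfderiv ?_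
  ext
  change _ = (1 : ℝ) • velocity E' δ A t x
  rw [one_smul]
  rfl

/-- The chain rule for a family of maps applied to a moving point. -/
lemma SmoothFamily.hasVelocityWithin_comp {A : ℝ → M → M'} (hA : SmoothFamily E E' δ A)
    (hδ : 0 < δ) (ht : t ∈ Icc 0 δ) {y : ℝ → M} {w : E}
    (hy : HasVelocityWithin y (Icc 0 δ) t w) :
    HasVelocityWithin (fun s => A s (y s)) (Icc 0 δ) t
      (velocity E' δ A t (y t) + tderiv E E' (A t) (y t) w) := by
  have hL := (hA.mdifferentiableWithinAt ht (y t)).hasMFDerivWithinAt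
  set L : ℝ × E →L[ℝ] E' := mfderivWithin (𝓘(ℝ, ℝ).prod 𝓘(ℝ, E)) 𝓘(ℝ, E')
    (fun p : ℝ × M => A p.1 p.2) (Icc 0 δ ×ˢ univ) (t, y t) with hLdef
  -- the derivative along a curve `s ↦ (s, z s)` through `(t, y t)`
  have key : ∀ (z : ℝ → M) (v : E), z t = y t → HasVelocityWithin z (Icc 0 δ) t v →
      HasVelocityWithin (fun s => A s (z s)) (Icc 0 δ) t (L (1, v)) := by
    intro z v hzt hz
    have h1 := (hasMFDerivWithinAt_id (I := 𝓘(ℝ, ℝ)) (Icc 0 δ) t).prodMk hz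
    have hL' := hL
    rw [← hzt] at hL'
    have h2 := HasMFDerivWithinAt.comp (g := fun p : ℝ × M => A p.1 p.2)
      (f := fun s : ℝ => (s, z s)) t hL' h1 (fun s hs => ⟨hs, mem_univ _⟩)
    refine h2.congr_mfderiv ?_
    ext
    change L ((1 : ℝ), (1 : ℝ) • v) = (1 : ℝ) • L (1, v)
    simp
  have e1 : L (1, 0) = velocity E' δ A t (y t) :=
    (key (fun _ => y t) 0 rfl (hasVelocityWithin_const _ _ _)).unique (uniqueDiffOn_Icc hδ t ht)
      (hA.hasVelocityWithin ht (y t))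
  have e2 : L (0, w) = tderiv E E' (A t) (y t) w := by
    have h1 : HasMFDerivAt 𝓘(ℝ, E) (𝓘(ℝ, ℝ).prod 𝓘(ℝ, E)) (fun x : M => (t, x)) (y t) _ :=
      (hasMFDerivAt_const t (y t)).prodMk (hasMFDerivAt_id (y t))
    have h2 := HasMFDerivWithinAt.comp (g := fun p : ℝ × M => A p.1 p.2)
      (f := fun x : M => (t, x)) (s := univ) (y t) hL h1.hasMFDerivWithinAt
      (fun s hs => ⟨ht, mem_univ _⟩)
    have h3 := (hasMFDerivWithinAt_univ.1 h2).mfderiv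
    have h4 : tderiv E E' (A t) (y t) w = L ((0 : ℝ), w) := DFunLike.congr_fun h3 w
    exact h4.symm
  have := key y w rfl hy
  rwa [show ((1 : ℝ), w) = (1, 0) + (0, w) by simp, map_add, e1, e2] at this

lemma SmoothFamily.comp {A : ℝ → M' → M''} {B : ℝ → M → M'} (hA : SmoothFamily E' E'' δ A)
    (hB : SmoothFamily E E' δ B) : SmoothFamily E E'' δ (fun t x => A t (B t x)) := by
  have h1 : ContMDiffOn (𝓘(ℝ, ℝ).prod 𝓘(ℝ, E)) (𝓘(ℝ, ℝ).prod 𝓘(ℝ, E')) ∞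
      (fun p : ℝ × M => (p.1, B p.1 p.2)) (Icc 0 δ ×ˢ univ) := contMDiffOn_fst.prodMk hB
  exact ContMDiffOn.comp hA h1 fun p hp => ⟨hp.1, mem_univ _⟩

lemma SmoothFamily.of_contMDiff {f : M → M'} (hf : ContMDiff 𝓘(ℝ, E) 𝓘(ℝ, E') ∞ f) :
    SmoothFamily E E' δ (fun _ => f) :=
  (hf.comp contMDiff_snd).contMDiffOn

lemma SmoothFamily.mono {A : ℝ → M → M'} (hA : SmoothFamily E E' δ A) {δ' : ℝ} (h : δ' ≤ δ) :
    SmoothFamily E E' δ' A :=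
  ContMDiffOn.mono hA (prod_mono (Icc_subset_Icc_right h) Subset.rfl)

lemma SmoothFamily.velocity_comp {A : ℝ → M' → M''} {B : ℝ → M → M'}
    (hA : SmoothFamily E' E'' δ A) (hB : SmoothFamily E E' δ B) (hδ : 0 < δ) (ht : t ∈ Icc 0 δ)
    (x : M) : velocity E'' δ (fun t x => A t (B t x)) t x =
      velocity E'' δ A t (B t x) + tderiv E' E'' (A t) (B t x) (velocity E' δ B t x) :=
  ((hA.comp hB).hasVelocityWithin ht x).unique (uniqueDiffOn_Icc hδ t ht)
    (hA.hasVelocityWithin_comp hδ ht (hB.hasVelocityWithin ht x))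

lemma velocity_congr {X : Type*} {A B : ℝ → X → M'} {x : X}
    (hB : HasVelocityWithin (fun s => B s x) (Icc 0 δ) t
      (velocity E' δ B t x)) (h : ∀ s ∈ Icc 0 δ, A s x = B s x) (hδ : 0 < δ) (ht : t ∈ Icc 0 δ) :
    velocity E' δ A t x = velocity E' δ B t x := by
  have e : mfderivWithin 𝓘(ℝ, ℝ) 𝓘(ℝ, E') (fun s => A s x) (Icc 0 δ) t = _ :=
    (hB.congr h ht).mfderivWithin
      (uniqueMDiffWithinAt_iff_uniqueDiffWithinAt.2 (uniqueDiffOn_Icc hδ t ht))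
  have := DFunLike.congr_fun e (1 : ℝ)
  change velocity E' δ A t x = (1 : ℝ) • velocity E' δ B t x at this
  simpa using this

end TangentMaps



/-! ### Values of forms on vectors, and charts -/

section Evaluation

variable {E : Type*} [NormedAddCommGroup E] [NormedSpace ℝ E]
  {M : Type*} [TopologicalSpace M] [ChartedSpace E M]

/-- The value of a `2`-form on two vectors of the model space. -/
def ev2 (Ω : DiffForm E M 2) (x : M) (v w : E) : ℝ := (Ω x : E [⋀^Fin 2]→L[ℝ] ℝ) ![v, w]

/-- The value of a `1`-form on a vector of the model space. -/
def ev1 (α : DiffForm E M 1) (x : M) (v : E) : ℝ := (α x : E [⋀^Fin 1]→L[ℝ] ℝ) ![v]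

lemma ev2_add_left (Ω : DiffForm E M 2) (x : M) (v v' w : E) :
    ev2 Ω x (v + v') w = ev2 Ω x v w + ev2 Ω x v' w :=
  ContinuousMultilinearMap.cons_add (Ω x : E [⋀^Fin 2]→L[ℝ] ℝ).toContinuousMultilinearMap ![w] v v'

lemma ev2_smul_left (Ω : DiffForm E M 2) (x : M) (c : ℝ) (v w : E) :
    ev2 Ω x (c • v) w = c * ev2 Ω x v w :=
  ContinuousMultilinearMap.cons_smul (Ω x : E [⋀^Fin 2]→L[ℝ] ℝ).toContinuousMultilinearMap ![w] c v

lemma ev2_neg_left (Ω : DiffForm E M 2) (x : M) (v w : E) :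
    ev2 Ω x (-v) w = - ev2 Ω x v w := by
  have := ev2_smul_left Ω x (-1) v w
  simpa using this

lemma ev2_zero_left (Ω : DiffForm E M 2) (x : M) (w : E) : ev2 Ω x 0 w = 0 := by
  have := ev2_smul_left Ω x 0 0 w
  simpa using this

lemma ev1_dFun (f : M → ℝ) (x : M) (v : E) : ev1 (dFun f) x v = tderiv E ℝ f x v := rfl

lemma form1_ext {ω₁ ω₂ : E [⋀^Fin 1]→L[ℝ] ℝ} (h : ∀ v, ω₁ ![v] = ω₂ ![v]) : ω₁ = ω₂ := by
  ext v
  have : v = ![v 0] := by ext i; fin_cases i; rfl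
  rw [this, h]

lemma diffForm1_ext {α β : DiffForm E M 1} {x : M} (h : ∀ v, ev1 α x v = ev1 β x v) :
    α x = β x :=
  form1_ext (E := E) (ω₁ := α x) (ω₂ := β x) h

lemma form2_ext {ω₁ ω₂ : E [⋀^Fin 2]→L[ℝ] ℝ} (h : ∀ v w, ω₁ ![v, w] = ω₂ ![v, w]) :
    ω₁ = ω₂ := by
  ext v
  have : v = ![v 0, v 1] := by ext i; fin_cases i <;> rfl
  rw [this, h]

lemma chartRep_two_apply (Ω : DiffForm E M 2) (x₀ : M) (y v w : E) :
    chartRep Ω x₀ y ![v, w] = ev2 Ω ((extChartAt 𝓘(ℝ, E) x₀).symm y)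
      (tderiv E E (extChartAt 𝓘(ℝ, E) x₀).symm y v)
      (tderiv E E (extChartAt 𝓘(ℝ, E) x₀).symm y w) := by
  change (Ω ((extChartAt 𝓘(ℝ, E) x₀).symm y) : E [⋀^Fin 2]→L[ℝ] ℝ) _ = _
  unfold ev2
  congr 1
  ext i; fin_cases i <;> rfl

lemma chartRep_one_apply (α : DiffForm E M 1) (x₀ : M) (y v : E) :
    chartRep α x₀ y ![v] = ev1 α ((extChartAt 𝓘(ℝ, E) x₀).symm y)
      (tderiv E E (extChartAt 𝓘(ℝ, E) x₀).symm y v) := by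
  change (α ((extChartAt 𝓘(ℝ, E) x₀).symm y) : E [⋀^Fin 1]→L[ℝ] ℝ) _ = _
  unfold ev1
  congr 1
  ext i; fin_cases i; rfl

lemma chart_source_mem_nhds {x₀ x : M} (hx : x ∈ (extChartAt 𝓘(ℝ, E) x₀).source) :
    (extChartAt 𝓘(ℝ, E) x₀).source ∈ 𝓝 x := (isOpen_extChartAt_source x₀).mem_nhds hx

end Evaluation

section Charts

variable {E : Type*} [NormedAddCommGroup E] [NormedSpace ℝ E]
  {M : Type*} [TopologicalSpace M] [ChartedSpace E M] [IsManifold 𝓘(ℝ, E) ∞ M]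

lemma contMDiffAt_chart_symm {x₀ : M} {y : E} (hy : y ∈ (extChartAt 𝓘(ℝ, E) x₀).target) :
    ContMDiffAt 𝓘(ℝ, E) 𝓘(ℝ, E) ∞ (extChartAt 𝓘(ℝ, E) x₀).symm y :=
  (contMDiffOn_extChartAt_symm x₀).contMDiffAt ((isOpen_extChartAt_target x₀).mem_nhds hy)

lemma contMDiffAt_chart {x₀ x : M} (hx : x ∈ (extChartAt 𝓘(ℝ, E) x₀).source) :
    ContMDiffAt 𝓘(ℝ, E) 𝓘(ℝ, E) ∞ (extChartAt 𝓘(ℝ, E) x₀) x :=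
  contMDiffAt_extChartAt' (by simpa using hx)

lemma mdifferentiableAt_chart_symm {x₀ : M} {y : E} (hy : y ∈ (extChartAt 𝓘(ℝ, E) x₀).target) :
    MDifferentiableAt 𝓘(ℝ, E) 𝓘(ℝ, E) (extChartAt 𝓘(ℝ, E) x₀).symm y :=
  (contMDiffAt_chart_symm hy).mdifferentiableAt (by simp)

lemma mdifferentiableAt_chart {x₀ x : M} (hx : x ∈ (extChartAt 𝓘(ℝ, E) x₀).source) :
    MDifferentiableAt 𝓘(ℝ, E) 𝓘(ℝ, E) (extChartAt 𝓘(ℝ, E) x₀) x :=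
  (contMDiffAt_chart hx).mdifferentiableAt (by simp)

lemma tderiv_chart_symm_chart {x₀ x : M} (hx : x ∈ (extChartAt 𝓘(ℝ, E) x₀).source) (v : E) :
    tderiv E E (extChartAt 𝓘(ℝ, E) x₀).symm (extChartAt 𝓘(ℝ, E) x₀ x)
      (tderiv E E (extChartAt 𝓘(ℝ, E) x₀) x v) = v := by
  have h := tderiv_comp (mdifferentiableAt_chart_symm ((extChartAt 𝓘(ℝ, E) x₀).map_source hx))
    (mdifferentiableAt_chart hx)
  have h2 : tderiv E E (fun y => (extChartAt 𝓘(ℝ, E) x₀).symm (extChartAt 𝓘(ℝ, E) x₀ y)) x =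
      tderiv E E (fun y : M => y) x := tderiv_congr (by
    filter_upwards [chart_source_mem_nhds hx] with y hy
    exact (extChartAt 𝓘(ℝ, E) x₀).left_inv hy)
  rw [h2, tderiv_id] at h
  exact (DFunLike.congr_fun h v).symm

lemma tderiv_chart_chart_symm {x₀ : M} {y : E} (hy : y ∈ (extChartAt 𝓘(ℝ, E) x₀).target) (v : E) :
    tderiv E E (extChartAt 𝓘(ℝ, E) x₀) ((extChartAt 𝓘(ℝ, E) x₀).symm y)
      (tderiv E E (extChartAt 𝓘(ℝ, E) x₀).symm y v) = v := by
  have h := tderiv_comp (mdifferentiableAt_chart ((extChartAt 𝓘(ℝ, E) x₀).map_target hy))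
    (mdifferentiableAt_chart_symm hy)
  have h2 : tderiv E E (fun y => (extChartAt 𝓘(ℝ, E) x₀) ((extChartAt 𝓘(ℝ, E) x₀).symm y)) y =
      tderiv E E (fun y : E => y) y := tderiv_congr (by
    filter_upwards [(isOpen_extChartAt_target x₀).mem_nhds hy] with y hy
    exact (extChartAt 𝓘(ℝ, E) x₀).right_inv hy)
  rw [h2, tderiv_id] at h
  exact (DFunLike.congr_fun h v).symm

/-- In the chart around `x`, at the image of `x`, the exterior derivative of the expression of `α` is
the expression of `dForm α`. -/
lemma extDeriv_chartRep_eq {k : ℕ} {α : DiffForm E M k} {β : DiffForm E M (k + 1)} {x : M}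
    (h : dForm α x = β x) :
    extDeriv (chartRep α x) (extChartAt 𝓘(ℝ, E) x x) = chartRep β x (extChartAt 𝓘(ℝ, E) x x) := by
  have hx := mem_extChartAt_source (I := 𝓘(ℝ, E)) x
  have hy := (extChartAt 𝓘(ℝ, E) x).map_source hx
  have hl : (extChartAt 𝓘(ℝ, E) x).symm (extChartAt 𝓘(ℝ, E) x x) = x :=
    (extChartAt 𝓘(ℝ, E) x).left_inv hx
  ext v
  change _ = (β ((extChartAt 𝓘(ℝ, E) x).symm (extChartAt 𝓘(ℝ, E) x x)) : E [⋀^Fin (k + 1)]→L[ℝ] ℝ)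
    (fun i => tderiv E E (extChartAt 𝓘(ℝ, E) x).symm (extChartAt 𝓘(ℝ, E) x x) (v i))
  rw [hl, ← h]
  change _ = extDeriv (chartRep α x) (extChartAt 𝓘(ℝ, E) x x)
    (fun i => tderiv E E (extChartAt 𝓘(ℝ, E) x) x
      (tderiv E E (extChartAt 𝓘(ℝ, E) x).symm (extChartAt 𝓘(ℝ, E) x x) (v i)))
  congr 1
  ext i
  have := tderiv_chart_chart_symm hy (v i)
  rw [hl] at this
  exact this.symm

end Charts



/-! ### Pullback of a closed `2`-form by an isotopy -/

section Preservation

variable {E : Type*} [NormedAddCommGroup E] [NormedSpace ℝ E]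
  {M : Type*} [TopologicalSpace M] [ChartedSpace E M] {δ : ℝ}

lemma eventually_mem_chart_source {A : ℝ → M → M} (hA : SmoothFamily E E δ A) {s₀ : ℝ}
    (hs₀ : s₀ ∈ Icc 0 δ) (x : M) :
    ∀ᶠ p : ℝ × M in 𝓝[Icc 0 δ ×ˢ univ] (s₀, x),
      A p.1 p.2 ∈ (extChartAt 𝓘(ℝ, E) (A s₀ x)).source := by
  have h2 := (hA (s₀, x) ⟨hs₀, mem_univ _⟩).continuousWithinAt
  exact h2 (chart_source_mem_nhds (mem_extChartAt_source _))

/-- The expression of the family `A` in the charts around `x` and around `y₀`. -/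
def chartFamily (A : ℝ → M → M) (x y₀ : M) (s : ℝ) (z : E) : E :=
  extChartAt 𝓘(ℝ, E) y₀ (A s ((extChartAt 𝓘(ℝ, E) x).symm z))

variable [IsManifold 𝓘(ℝ, E) ∞ M]

lemma contDiffWithinAt_chartFamily {A : ℝ → M → M} (hA : SmoothFamily E E δ A) {s₀ : ℝ}
    (hs₀ : s₀ ∈ Icc 0 δ) (x : M) :
    ContDiffWithinAt ℝ ∞ (fun p : ℝ × E => chartFamily A x (A s₀ x) p.1 p.2) (Icc 0 δ ×ˢ univ)
      (s₀, extChartAt 𝓘(ℝ, E) x x) := by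
  have hx := mem_extChartAt_source (I := 𝓘(ℝ, E)) x
  have hz := (extChartAt 𝓘(ℝ, E) x).map_source hx
  have hl : (extChartAt 𝓘(ℝ, E) x).symm (extChartAt 𝓘(ℝ, E) x x) = x :=
    (extChartAt 𝓘(ℝ, E) x).left_inv hx
  have h1 : ContMDiffWithinAt (𝓘(ℝ, ℝ).prod 𝓘(ℝ, E)) (𝓘(ℝ, ℝ).prod 𝓘(ℝ, E)) ∞
      (fun p : ℝ × E => (p.1, (extChartAt 𝓘(ℝ, E) x).symm p.2)) (Icc 0 δ ×ˢ univ)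
      (s₀, extChartAt 𝓘(ℝ, E) x x) :=
    contMDiffWithinAt_fst.prodMk
      ((contMDiffAt_chart_symm hz).comp_contMDiffWithinAt (s₀, extChartAt 𝓘(ℝ, E) x x)
        contMDiffWithinAt_snd)
  have h2 := hA (s₀, x) ⟨hs₀, mem_univ _⟩
  have h3 : ContMDiffWithinAt (𝓘(ℝ, ℝ).prod 𝓘(ℝ, E)) 𝓘(ℝ, E) ∞
      (fun p : ℝ × E => A p.1 ((extChartAt 𝓘(ℝ, E) x).symm p.2)) (Icc 0 δ ×ˢ univ)
      (s₀, extChartAt 𝓘(ℝ, E) x x) := by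
    rw [← hl] at h2
    exact ContMDiffWithinAt.comp (g := fun p : ℝ × M => A p.1 p.2)
      (f := fun p : ℝ × E => (p.1, (extChartAt 𝓘(ℝ, E) x).symm p.2))
      (s₀, extChartAt 𝓘(ℝ, E) x x) h2 h1 fun p hp => ⟨hp.1, mem_univ _⟩
  have h4 : ContMDiffAt 𝓘(ℝ, E) 𝓘(ℝ, E) ∞ (extChartAt 𝓘(ℝ, E) (A s₀ x))
      (A s₀ ((extChartAt 𝓘(ℝ, E) x).symm (extChartAt 𝓘(ℝ, E) x x))) := by
    rw [hl]; exact contMDiffAt_chart (mem_extChartAt_source _)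
  have h5 := h4.comp_contMDiffWithinAt (s₀, extChartAt 𝓘(ℝ, E) x x) h3
  rw [← modelWithCornersSelf_prod, chartedSpaceSelf_prod] at h5
  exact h5.contDiffWithinAt

/-- The pullback of a `2`-form by `A s`, computed in charts. -/
lemma ev2_pullback_eq {A : ℝ → M → M} (hA : SmoothFamily E E δ A) (Ω : DiffForm E M 2) {s : ℝ}
    (hs : s ∈ Icc 0 δ) {x y₀ : M} (hy : A s x ∈ (extChartAt 𝓘(ℝ, E) y₀).source) (u w : E) :
    ev2 Ω (A s x) (tderiv E E (A s) x u) (tderiv E E (A s) x w) =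
      chartRep Ω y₀ (chartFamily A x y₀ s (extChartAt 𝓘(ℝ, E) x x))
        ![fderiv ℝ (chartFamily A x y₀ s) (extChartAt 𝓘(ℝ, E) x x)
            (tderiv E E (extChartAt 𝓘(ℝ, E) x) x u),
          fderiv ℝ (chartFamily A x y₀ s) (extChartAt 𝓘(ℝ, E) x x)
            (tderiv E E (extChartAt 𝓘(ℝ, E) x) x w)] := by
  have hx := mem_extChartAt_source (I := 𝓘(ℝ, E)) x
  have hz := (extChartAt 𝓘(ℝ, E) x).map_source hx
  have hl : (extChartAt 𝓘(ℝ, E) x).symm (extChartAt 𝓘(ℝ, E) x x) = x :=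
    (extChartAt 𝓘(ℝ, E) x).left_inv hx
  have key : ∀ u, tderiv E E (A s) x u = tderiv E E (extChartAt 𝓘(ℝ, E) y₀).symm
      (chartFamily A x y₀ s (extChartAt 𝓘(ℝ, E) x x))
      (fderiv ℝ (chartFamily A x y₀ s) (extChartAt 𝓘(ℝ, E) x x)
        (tderiv E E (extChartAt 𝓘(ℝ, E) x) x u)) := by
    intro u
    have h1 : MDifferentiableAt 𝓘(ℝ, E) 𝓘(ℝ, E)
        (fun z => A s ((extChartAt 𝓘(ℝ, E) x).symm z)) (extChartAt 𝓘(ℝ, E) x x) :=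
      (hA.mdifferentiableAt hs _).comp _ (mdifferentiableAt_chart_symm hz)
    rw [← tderiv_eq_fderiv]
    have h2 : tderiv E E (chartFamily A x y₀ s) (extChartAt 𝓘(ℝ, E) x x) = _ :=
      tderiv_comp (g := extChartAt 𝓘(ℝ, E) y₀)
        (f := fun z => A s ((extChartAt 𝓘(ℝ, E) x).symm z))
        (mdifferentiableAt_chart (by rwa [hl])) h1
    have h3 := tderiv_comp (g := A s) (hA.mdifferentiableAt hs _) (mdifferentiableAt_chart_symm hz)
    rw [h2, h3, hl]
    simp only [ContinuousLinearMap.comp_apply, chartFamily, hl]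
    rw [tderiv_chart_symm_chart hx, tderiv_chart_symm_chart hy]
  rw [chartRep_two_apply, ← key, ← key]
  simp only [chartFamily, hl]
  rw [(extChartAt 𝓘(ℝ, E) y₀).left_inv hy]

lemma continuousOn_ev2_pullback {A : ℝ → M → M} (hA : SmoothFamily E E δ A) {Ω : DiffForm E M 2}
    (hΩ : IsSmoothForm Ω) (x : M) (u w : E) :
    ContinuousOn (fun s => ev2 Ω (A s x) (tderiv E E (A s) x u) (tderiv E E (A s) x w))
      (Icc 0 δ) := by
  intro s₀ hs₀
  set z := extChartAt 𝓘(ℝ, E) x x with hz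
  have hsrc : ∀ᶠ s in 𝓝[Icc 0 δ] s₀, A s x ∈ (extChartAt 𝓘(ℝ, E) (A s₀ x)).source := by
    have h : Tendsto (fun s => (s, x)) (𝓝[Icc 0 δ] s₀) (𝓝[Icc 0 δ ×ˢ univ] (s₀, x)) := by
      refine tendsto_nhdsWithin_iff.2 ⟨?_, ?_⟩
      · exact ((continuous_id.prodMk continuous_const).tendsto s₀).mono_left nhdsWithin_le_nhds
      · exact eventually_mem_nhdsWithin.mono fun s hs => ⟨hs, mem_univ _⟩
    exact h.eventually (eventually_mem_chart_source hA hs₀ x)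
  have hF := contDiffWithinAt_chartFamily hA hs₀ x
  have hF1 : ContinuousWithinAt (fun s => chartFamily A x (A s₀ x) s z) (Icc 0 δ) s₀ :=
    ContinuousWithinAt.comp (f := fun s => (s, z)) hF.continuousWithinAt
        (continuousWithinAt_id.prodMk continuousWithinAt_const)
      fun s hs => ⟨hs, mem_univ _⟩
  have hF2 : ContinuousWithinAt (fun s => fderiv ℝ (chartFamily A x (A s₀ x) s) z) (Icc 0 δ) s₀ := by
    have := ContDiffWithinAt.fderivWithin (m := 1) (f := chartFamily A x (A s₀ x)) (t := univ)
      (g := fun _ => z) hF contDiffWithinAt_const uniqueDiffOn_univ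
      (by norm_num [two_le_infty]) hs₀ (fun _ _ => mem_univ _)
    simpa [fderivWithin_univ] using this.continuousWithinAt
  have hzs : chartFamily A x (A s₀ x) s₀ z = extChartAt 𝓘(ℝ, E) (A s₀ x) (A s₀ x) := by
    simp [chartFamily, hz]
  have hΩc : ContinuousAt (chartRep Ω (A s₀ x)) (chartFamily A x (A s₀ x) s₀ z) := by
    rw [hzs]; exact (hΩ.differentiableAt _).continuousAt
  have hmain : ContinuousWithinAt (fun s => chartRep Ω (A s₀ x) (chartFamily A x (A s₀ x) s z)
        ![fderiv ℝ (chartFamily A x (A s₀ x) s) z (tderiv E E (extChartAt 𝓘(ℝ, E) x) x u),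
          fderiv ℝ (chartFamily A x (A s₀ x) s) z (tderiv E E (extChartAt 𝓘(ℝ, E) x) x w)])
      (Icc 0 δ) s₀ := by
    have h1 := hΩc.comp_continuousWithinAt (f := fun s => chartFamily A x (A s₀ x) s z) hF1
    have h2 : ContinuousWithinAt (fun s =>
        ![fderiv ℝ (chartFamily A x (A s₀ x) s) z (tderiv E E (extChartAt 𝓘(ℝ, E) x) x u),
          fderiv ℝ (chartFamily A x (A s₀ x) s) z (tderiv E E (extChartAt 𝓘(ℝ, E) x) x w)])
        (Icc 0 δ) s₀ := by
      refine continuousWithinAt_pi.2 fun i => ?_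
      fin_cases i
      · exact hF2.clm_apply continuousWithinAt_const
      · exact hF2.clm_apply continuousWithinAt_const
    exact (ContinuousEval.continuous_eval (F := E [⋀^Fin 2]→L[ℝ]
        ℝ)).continuousAt.comp_continuousWithinAt
      (h1.prodMk h2)
  refine hmain.congr_of_eventuallyEq ?_ ?_
  · filter_upwards [hsrc, eventually_mem_nhdsWithin] with s h1 h2
    exact ev2_pullback_eq hA Ω h2 h1 u w
  · exact ev2_pullback_eq hA Ω hs₀ (mem_extChartAt_source _) u w

/-- The derivative in time of the pullback of a closed `2`-form `Ω` by an isotopy whose velocity is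
`Ω`-dual to a `1`-form `θ` with `dθ = cΩ`. -/
theorem hasDerivAt_ev2_pullback {A : ℝ → M → M} (hA : SmoothFamily E E δ A) {Ω : DiffForm E M 2}
    (hΩ : IsSmoothForm Ω) (hΩd : dForm Ω = 0) {t : ℝ} (ht : t ∈ Ioo 0 δ) (x : M)
    {θ : DiffForm E M 1} (hθ : IsSmoothForm θ) {c : ℝ} (hd : dForm θ (A t x) = c • Ω (A t x))
    (hvel : ∀ᶠ x' in 𝓝 x, ∀ w, ev2 Ω (A t x') (velocity E δ A t x') w = ev1 θ (A t x') w)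
    (u w : E) :
    HasDerivAt (fun s => ev2 Ω (A s x) (tderiv E E (A s) x u) (tderiv E E (A s) x w))
      (c * ev2 Ω (A t x) (tderiv E E (A t) x u) (tderiv E E (A t) x w)) t := by
  set z := extChartAt 𝓘(ℝ, E) x x with hz
  set y₀ := A t x with hy₀
  have htI : t ∈ Icc 0 δ := Ioo_subset_Icc_self ht
  have hIcc : Icc 0 δ ∈ 𝓝 t := Icc_mem_nhds ht.1 ht.2
  have hzt : z ∈ (extChartAt 𝓘(ℝ, E) x).target :=
    (extChartAt 𝓘(ℝ, E) x).map_source (mem_extChartAt_source _)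
  have hl : (extChartAt 𝓘(ℝ, E) x).symm z = x :=
    (extChartAt 𝓘(ℝ, E) x).left_inv (mem_extChartAt_source _)
  have hnhds : (Icc 0 δ ×ˢ univ : Set (ℝ × E)) ∈ 𝓝 (t, z) := prod_mem_nhds hIcc univ_mem
  have hnhds' : (Icc 0 δ ×ˢ univ : Set (ℝ × M)) ∈ 𝓝 (t, x) := prod_mem_nhds hIcc univ_mem
  let F : ℝ × E → E := fun p => chartFamily A x y₀ p.1 p.2
  have hF : ContDiffAt ℝ ∞ F (t, z) := (contDiffWithinAt_chartFamily hA htI x).contDiffAt hnhds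
  have hFz : F (t, z) = extChartAt 𝓘(ℝ, E) y₀ y₀ := by
    change extChartAt 𝓘(ℝ, E) y₀ (A t ((extChartAt 𝓘(ℝ, E) x).symm z)) = _
    rw [hl]
  have hFdiff : ∀ᶠ p in 𝓝 (t, z), DifferentiableAt ℝ F p :=
    ((hF.of_le one_le_infty).eventually (by simp)).mono fun p hp => hp.differentiableAt (by simp)
  have hsrc : ∀ᶠ p : ℝ × M in 𝓝 (t, x), A p.1 p.2 ∈ (extChartAt 𝓘(ℝ, E) y₀).source := by
    have := eventually_mem_chart_source hA htI x
    rwa [nhdsWithin_eq_nhds.2 hnhds'] at this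
  have hsymm : ContinuousAt (extChartAt 𝓘(ℝ, E) x).symm z := continuousAt_extChartAt_symm x
  have hvelF : ∀ᶠ z' in 𝓝 z, ∀ w : E, chartRep Ω y₀ (F (t, z')) ![fderiv ℝ F (t, z') (1, 0), w] =
      chartRep θ y₀ (F (t, z')) ![w] := by
    have h1 : Tendsto (fun z' : E => (t, z')) (𝓝 z) (𝓝 (t, z)) :=
      (Continuous.prodMk_right t).continuousAt
    have h2 : Tendsto (fun z' : E => (t, (extChartAt 𝓘(ℝ, E) x).symm z')) (𝓝 z) (𝓝 (t, x)) := by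
      have := hsymm.tendsto
      rw [hl] at this
      exact tendsto_const_nhds.prodMk_nhds this
    have h3 : Tendsto (extChartAt 𝓘(ℝ, E) x).symm (𝓝 z) (𝓝 x) := by
      have := hsymm.tendsto
      rwa [hl] at this
    filter_upwards [h1.eventually hFdiff, h2.eventually hsrc, h3.eventually hvel]
      with z' hz1 hz2 hz3 v
    set x' := (extChartAt 𝓘(ℝ, E) x).symm z' with hx'
    have e1 : fderiv ℝ F (t, z') (1, 0) =
        tderiv E E (extChartAt 𝓘(ℝ, E) y₀) (A t x') (velocity E δ A t x') := by
      have d1 : HasDerivAt (fun s => F (s, z')) (fderiv ℝ F (t, z') (1, 0)) t :=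
        HasFDerivAt.comp_hasDerivAt (f := fun s => (s, z')) t hz1.hasFDerivAt
            ((hasDerivAt_id t).prodMk (hasDerivAt_const t z'))
      have d2 := ((hA.hasVelocityWithin htI x').comp_mdifferentiableAt
        (mdifferentiableAt_chart hz2)).hasDerivWithinAt.hasDerivAt hIcc
      exact d1.unique d2
    rw [chartRep_two_apply, chartRep_one_apply, e1]
    have e2 : F (t, z') = extChartAt 𝓘(ℝ, E) y₀ (A t x') := rfl
    rw [e2, tderiv_chart_symm_chart hz2, (extChartAt 𝓘(ℝ, E) y₀).left_inv hz2]
    exact hz3 _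
  have hmain := hasDerivAt_pullback_pair hF (Ω := chartRep Ω y₀) (θ := chartRep θ y₀) (c := c)
    (by rw [hFz]; exact hΩ.differentiableAt y₀)
    (by rw [hFz]; exact extDeriv_chartRep_eq (β := 0) (congrFun hΩd y₀))
    (by rw [hFz]; exact hθ.differentiableAt y₀)
    (by rw [hFz]; exact extDeriv_chartRep_eq (β := c • Ω) hd) hvelF
    (tderiv E E (extChartAt 𝓘(ℝ, E) x) x u) (tderiv E E (extChartAt 𝓘(ℝ, E) x) x w)
  have hslice : ∀ᶠ s in 𝓝 t, ∀ v, fderiv ℝ F (s, z) (0, v) = fderiv ℝ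
      (chartFamily A x y₀ s) z v := by
    have h1 : Tendsto (fun s : ℝ => (s, z)) (𝓝 t) (𝓝 (t, z)) :=
      (Continuous.prodMk_left z).continuousAt
    filter_upwards [h1.eventually hFdiff] with s hs v
    have h2 : HasFDerivAt (chartFamily A x y₀ s) _ z :=
      hs.hasFDerivAt.comp z (hasFDerivAt_prodMk_right s z)
    rw [h2.fderiv]; simp
  have hev : ∀ᶠ s in 𝓝 t, ev2 Ω (A s x) (tderiv E E (A s) x u) (tderiv E E (A s) x w) =
      chartRep Ω y₀ (F (s, z)) ![fderiv ℝ F (s, z) (0, tderiv E E (extChartAt 𝓘(ℝ, E) x) x u),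
        fderiv ℝ F (s, z) (0, tderiv E E (extChartAt 𝓘(ℝ, E) x) x w)] := by
    have h1 : Tendsto (fun s : ℝ => (s, x)) (𝓝 t) (𝓝 (t, x)) :=
      (Continuous.prodMk_left x).continuousAt
    filter_upwards [hslice, h1.eventually hsrc, hIcc] with s h2 h3 h4
    rw [h2, h2]
    exact ev2_pullback_eq hA Ω h4 h3 u w
  rw [← hev.self_of_nhds] at hmain
  exact hmain.congr_of_eventuallyEq hev

/-- An isotopy starting at the identity whose velocity is `Ω`-dual to `1`-forms `θ` with `dθ = cΩ`
multiplies the closed form `Ω` by `exp (c τ)` in time `τ`. -/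
theorem ev2_pullback_eq_exp {A : ℝ → M → M} (hA : SmoothFamily E E δ A) {Ω : DiffForm E M 2}
    (hΩ : IsSmoothForm Ω) (hΩd : dForm Ω = 0) (h0 : ∀ x, A 0 x = x) {τ : ℝ} (hτ : τ ∈ Icc 0 δ)
    (x : M) {c : ℝ}
    (h : ∀ t ∈ Ioo 0 τ, ∃ θ : DiffForm E M 1, IsSmoothForm θ ∧ dForm θ (A t x) = c • Ω (A t x) ∧
      ∀ᶠ x' in 𝓝 x, ∀ w, ev2 Ω (A t x') (velocity E δ A t x') w = ev1 θ (A t x') w) (u w : E) :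
    ev2 Ω (A τ x) (tderiv E E (A τ) x u) (tderiv E E (A τ) x w) =
      Real.exp (c * τ) * ev2 Ω x u w := by
  set g : ℝ → ℝ := fun s => ev2 Ω (A s x) (tderiv E E (A s) x u) (tderiv E E (A s) x w) with hg
  have hg0 : g 0 = ev2 Ω x u w := by
    have : A 0 = fun y => y := funext h0
    simp only [hg, this, tderiv_id, ContinuousLinearMap.id_apply]
  rcases hτ.1.eq_or_lt with h1 | h1
  · rw [← h1, mul_zero, Real.exp_zero, one_mul]; exact hg0
  have hcont : ContinuousOn (fun s => Real.exp (-(c * s)) * g s) (Icc 0 τ) := by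
    refine ContinuousOn.mul (by fun_prop) ?_
    exact (continuousOn_ev2_pullback hA hΩ x u w).mono (Icc_subset_Icc_right hτ.2)
  have hderiv : ∀ s ∈ Ioo 0 τ, HasDerivAt (fun s => Real.exp (-(c * s)) * g s) 0 s := by
    intro s hs
    obtain ⟨θ, hθ, hd, hv⟩ := h s hs
    have d1 := hasDerivAt_ev2_pullback hA hΩ hΩd ⟨hs.1, hs.2.trans_le hτ.2⟩ x hθ hd hv u w
    have d2 : HasDerivAt (fun s => Real.exp (-(c * s))) (Real.exp (-(c * s)) * (-(c * 1))) s :=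
      (((hasDerivAt_id s).const_mul c).neg).exp
    refine (d2.mul d1).congr_deriv ?_
    ring
  obtain ⟨s, hs, hs'⟩ := exists_hasDerivAt_eq_slope _ _ h1 hcont hderiv
  have h2 : Real.exp (-(c * τ)) * g τ = g 0 := by
    have : τ - 0 ≠ 0 := by simpa using h1.ne'
    have h3 : Real.exp (-(c * τ)) * g τ - Real.exp (-(c * 0)) * g 0 = 0 := by
      rcases div_eq_zero_iff.1 hs'.symm with h | h
      · exact h
      · exact absurd h this
    simpa [sub_eq_zero] using h3
  change g τ = _
  rw [← hg0, ← h2, ← mul_assoc, ← Real.exp_add]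
  simp

end Preservation



/-! ### Locally exact `1`-forms -/

section ExactForms

variable {E : Type*} [NormedAddCommGroup E] [NormedSpace ℝ E]
  {M : Type*} [TopologicalSpace M] [ChartedSpace E M]

/-- The form `α` is, near `p`, the differential of a smooth function. -/
def IsExactNear (α : DiffForm E M 1) (p : M) : Prop :=
  ∃ f : M → ℝ, ∀ᶠ x in 𝓝 p, ContMDiffAt 𝓘(ℝ, E) 𝓘(ℝ, ℝ) ∞ f x ∧ α x = dFun f x

lemma isExactNear_dFun {f : M → ℝ} (hf : ContMDiff 𝓘(ℝ, E) 𝓘(ℝ, ℝ) ∞ f) (p : M) :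
    IsExactNear (dFun (E := E) f) p := ⟨f, Eventually.of_forall fun x => ⟨hf x, rfl⟩⟩

variable [IsManifold 𝓘(ℝ, E) ∞ M]

lemma IsExactNear.chartRep_eq {α : DiffForm E M 1} {x₀ : M} {y : E}
    (hy : y ∈ (extChartAt 𝓘(ℝ, E) x₀).target)
    (h : IsExactNear α ((extChartAt 𝓘(ℝ, E) x₀).symm y)) :
    ∃ g : E → ℝ, ContDiffAt ℝ ∞ g y ∧ chartRep α x₀ =ᶠ[𝓝 y] fun z =>
      ContinuousAlternatingMap.ofSubsingletonLIE (𝕜 := ℝ) (E := E) (F := ℝ) (0 : Fin 1)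
          (fderiv ℝ g z) := by
  obtain ⟨f, hf⟩ := h
  refine ⟨fun z => f ((extChartAt 𝓘(ℝ, E) x₀).symm z), ?_, ?_⟩
  · exact (hf.self_of_nhds.1.comp y (contMDiffAt_chart_symm hy)).contDiffAt
  · have h1 := (contMDiffAt_chart_symm hy).continuousAt.eventually hf
    filter_upwards [h1, (isOpen_extChartAt_target x₀).mem_nhds hy] with z hz hzt
    refine form1_ext fun v => ?_
    rw [chartRep_one_apply]
    unfold ev1
    rw [hz.2]
    have e := tderiv_comp (E'' := ℝ) (hz.1.mdifferentiableAt (by simp))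
      (mdifferentiableAt_chart_symm hzt)
    rw [tderiv_eq_fderiv] at e
    change tderiv E ℝ f _ (tderiv E E _ z v) = fderiv ℝ _ z v
    rw [e]
    rfl

lemma isSmoothForm_of_isExactNear {α : DiffForm E M 1} (h : ∀ p, IsExactNear α p) :
    IsSmoothForm α := by
  intro x₀ y hy
  obtain ⟨g, hg, he⟩ := (h _).chartRep_eq hy
  refine ContDiffAt.contDiffWithinAt ?_
  refine ContDiffAt.congr_of_eventuallyEq ?_ he
  exact (ContinuousAlternatingMap.ofSubsingletonLIE (𝕜 := ℝ) (E := E) (F := ℝ)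
      (0 : Fin 1)).contDiff.contDiffAt.comp y
    (hg.fderiv_right (m := ∞) (by simp))

lemma dForm_eq_zero_of_isExactNear {α : DiffForm E M 1} {p : M} (h : IsExactNear α p) :
    dForm α p = 0 := by
  have hp := mem_extChartAt_source (I := 𝓘(ℝ, E)) p
  have hl : (extChartAt 𝓘(ℝ, E) p).symm (extChartAt 𝓘(ℝ, E) p p) = p :=
    (extChartAt 𝓘(ℝ, E) p).left_inv hp
  obtain ⟨g, hg, he⟩ := IsExactNear.chartRep_eq (α := α) ((extChartAt 𝓘(ℝ, E) p).map_source hp)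
    (by rwa [hl])
  have hd : DifferentiableAt ℝ (fderiv ℝ g) (extChartAt 𝓘(ℝ, E) p p) :=
    (hg.fderiv_right (m := 1) (by norm_num [two_le_infty])).differentiableAt (by simp)
  have h0 : extDeriv (chartRep α p) (extChartAt 𝓘(ℝ, E) p p) = 0 := by
    rw [he.extDeriv_eq]
    refine form2_ext fun a b => ?_
    rw [extDeriv_one_form_apply]
    · have hs : IsSymmSndFDerivAt ℝ g (extChartAt 𝓘(ℝ, E) p p) :=
        hg.isSymmSndFDerivAt (by simp [two_le_infty])
      have e : ∀ v : E, (fun q => ContinuousAlternatingMap.ofSubsingletonLIE (𝕜 := ℝ) (E := E)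
          (F := ℝ) (0 : Fin 1)
          (fderiv ℝ g q) ![v]) = fun q => fderiv ℝ g q v := fun v => rfl
      rw [e, e, fderiv_clm_apply hd (differentiableAt_const _),
        fderiv_clm_apply hd (differentiableAt_const _)]
      have := hs.eq a b
      simpa [sub_eq_zero] using this
    · exact (ContinuousAlternatingMap.ofSubsingletonLIE (𝕜 := ℝ) (E := E) (F := ℝ)
        (0 : Fin 1)).differentiable.differentiableAt.comp _ hd
  unfold dForm
  rw [h0]
  rfl

end ExactForms

/-! ### Generating forms of isotopies -/

section Generators

variable {E : Type*} [NormedAddCommGroup E] [NormedSpace ℝ E]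
  {M : Type*} [TopologicalSpace M] [ChartedSpace E M] {δ t : ℝ} {Ω : DiffForm E M 2}

/-- The family `A` at time `t` and point `x`: its velocity `V` satisfies
`Ω (V, dA_t u) = η u` for all `u`, i.e. `η` is the value at `x` of the pullback by `A_t` of the
`1`-form `ι_V Ω`, and `A_t` multiplies `Ω` by `c` at `x`. -/
structure HasGenerator (Ω : DiffForm E M 2) (δ : ℝ) (A : ℝ → M → M) (t : ℝ) (x : M) (η : E → ℝ)
    (c : ℝ) : Prop where
  one_form : ∀ u, ev2 Ω (A t x) (velocity E δ A t x) (tderiv E E (A t) x u) = η u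
  conformal : ∀ u w, ev2 Ω (A t x) (tderiv E E (A t) x u) (tderiv E E (A t) x w) = c * ev2 Ω x u w

/-- The generating form of a composition `A ∘ B` is `B^* η + c θ`. -/
lemma HasGenerator.comp {A B : ℝ → M → M} (hA : SmoothFamily E E δ A) (hB : SmoothFamily E E δ B)
    (hδ : 0 < δ) (ht : t ∈ Icc 0 δ) {x : M} {η θ : E → ℝ} {c d : ℝ}
    (h : HasGenerator Ω δ A t (B t x) η c) (h' : HasGenerator Ω δ B t x θ d) :
    HasGenerator Ω δ (fun t y => A t (B t y)) t x
      (fun u => η (tderiv E E (B t) x u) + c * θ u) (c * d) := by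
  have e := tderiv_comp (hA.mdifferentiableAt ht (B t x)) (hB.mdifferentiableAt ht x)
  constructor
  · intro u
    rw [hA.velocity_comp hB hδ ht, e, ev2_add_left]
    simp only [ContinuousLinearMap.comp_apply]
    rw [h.one_form, h.conformal, h'.one_form]
  · intro u w
    rw [e]
    simp only [ContinuousLinearMap.comp_apply]
    rw [h.conformal, h'.conformal, mul_assoc]

/-- The generating form of the inverses: the velocities satisfy
`V_A + dA (V_B) = 0`, because `A_t ∘ B_t` does not depend on `t`. -/
lemma HasGenerator.inv {A B : ℝ → M → M} (hA : SmoothFamily E E δ A) (hB : SmoothFamily E E δ B)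
    (hAB : ∀ t ∈ Icc 0 δ, ∀ x, A t (B t x) = x)
    (hδ : 0 < δ) (ht : t ∈ Icc 0 δ) {x : M} {η : E → ℝ} {c : ℝ} (hc : c ≠ 0)
    (h : HasGenerator Ω δ A t (B t x) η c) :
    HasGenerator Ω δ B t x (fun u => -(c⁻¹ * η (tderiv E E (B t) x u))) c⁻¹ := by
  have e := tderiv_comp (hA.mdifferentiableAt ht (B t x)) (hB.mdifferentiableAt ht x)
  have e0 : (fun y => A t (B t y)) = fun y => y := funext (hAB t ht)
  rw [e0, tderiv_id] at e
  have e1 : ∀ u, tderiv E E (A t) (B t x) (tderiv E E (B t) x u) = u := fun u =>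
    (DFunLike.congr_fun e u).symm
  have ev : velocity E δ A t (B t x) + tderiv E E (A t) (B t x) (velocity E δ B t x) = 0 := by
    rw [← hA.velocity_comp hB hδ ht]
    refine HasVelocityWithin.unique (uniqueDiffOn_Icc hδ t ht)
      ((hA.comp hB).hasVelocityWithin ht x) ?_
    exact (hasVelocityWithin_const x _ t).congr (fun r hr => hAB r hr x) ht
  have hx := hAB t ht x
  have hconf : ∀ u w, ev2 Ω (B t x) u w =
      c⁻¹ * ev2 Ω x (tderiv E E (A t) (B t x) u) (tderiv E E (A t) (B t x) w) := by
    intro u w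
    have := h.conformal u w
    rw [hx] at this
    rw [this, ← mul_assoc, inv_mul_cancel₀ hc, one_mul]
  constructor
  · intro u
    rw [hconf, e1, eq_neg_of_add_eq_zero_right ev, ev2_neg_left, mul_neg]
    have := h.one_form (tderiv E E (B t) x u)
    rw [e1, hx] at this
    rw [this]
  · intro u w
    rw [hconf, e1, e1]

/-- The generating form at `x` depends on the family near `x` only. -/
lemma HasGenerator.congr {A B : ℝ → M → M} (hB : SmoothFamily E E δ B)
    (hδ : 0 < δ) (ht : t ∈ Icc 0 δ) {x : M} {η : E → ℝ} {c : ℝ} (h : HasGenerator Ω δ B t x η c)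
    (hAB : ∀ s ∈ Icc 0 δ, ∀ᶠ y in 𝓝 x, A s y = B s y) : HasGenerator Ω δ A t x η c := by
  have e1 : A t x = B t x := (hAB t ht).self_of_nhds
  have e2 : tderiv E E (A t) x = tderiv E E (B t) x := tderiv_congr (hAB t ht)
  have e3 : velocity E δ A t x = velocity E δ B t x :=
    velocity_congr (hB.hasVelocityWithin ht x) (fun s hs => (hAB s hs).self_of_nhds) hδ ht
  constructor
  · intro u; rw [e1, e2, e3]; exact h.one_form u
  · intro u w; rw [e1, e2]; exact h.conformal u w

/-- A map preserving `Ω`, as a family constant in time, has generating form `0`. -/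
lemma hasGenerator_const {f : M → M} (hf : ContMDiff 𝓘(ℝ, E) 𝓘(ℝ, E) ∞ f)
    (hs : ∀ x u w, ev2 Ω (f x) (tderiv E E f x u) (tderiv E E f x w) = ev2 Ω x u w)
    (hδ : 0 < δ) (ht : t ∈ Icc 0 δ) (x : M) :
    HasGenerator Ω δ (fun _ => f) t x (fun _ => 0) 1 := by
  constructor
  · intro u
    have : velocity E δ (fun _ => f) t x = 0 := HasVelocityWithin.unique (uniqueDiffOn_Icc hδ t ht)
      ((SmoothFamily.of_contMDiff hf).hasVelocityWithin ht x) (hasVelocityWithin_const (f x) _ t)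
    rw [this, ev2_zero_left]
  · intro u w
    rw [hs, one_mul]

lemma HasGenerator.congr_right {A : ℝ → M → M} {x : M} {η η' : E → ℝ} {c c' : ℝ}
    (h : HasGenerator Ω δ A t x η c) (hη : ∀ u, η' u = η u) (hc : c' = c) :
    HasGenerator Ω δ A t x η' c' := by
  have : η' = η := funext hη
  rwa [this, hc]

end Generators

/-! ### Hamiltonian flows -/

section HamiltonianFlows

variable {E : Type*} [NormedAddCommGroup E] [NormedSpace ℝ E]
  {M : Type*} [MetricSpace M] [ChartedSpace E M] {δ t : ℝ}
  {Ω : DiffForm E M 2}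

lemma IsSymplecticDiffeo.ev2_eq {f : Diffeomorph 𝓘(ℝ, E) 𝓘(ℝ, E) M M ∞}
    (h : IsSymplecticDiffeo Ω f) (x : M) (u w : E) :
    ev2 Ω (f x) (tderiv E E f x u) (tderiv E E f x w) = ev2 Ω x u w := by
  have h1 : pullbackForm f Ω x = Ω x := congrFun h x
  unfold ev2
  rw [← h1]
  change (Ω (f x) : E [⋀^Fin 2]→L[ℝ] ℝ) _ = (Ω (f x) : E [⋀^Fin 2]→L[ℝ] ℝ) _
  congr 1
  ext i; fin_cases i <;> rfl

/-- An isotopy of diffeomorphisms is a Hamiltonian flow if its generating forms `η` are the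
differentials of functions `K t`; the Hamiltonian function is then `K t ∘ (Ξ t)⁻¹`. -/
theorem isHamiltonianFlow_of_hasGenerator
    {Ξ : ℝ → Diffeomorph 𝓘(ℝ, E) 𝓘(ℝ, E) M M ∞} (h1 : SmoothFamily E E δ fun t => (Ξ t : M → M))
    (h2 : SmoothFamily E E δ fun t => ((Ξ t).symm : M → M)) (h0 : ∀ x, Ξ 0 x = x) {K : ℝ → M → ℝ}
    (hK : SmoothFamily E ℝ δ K) (hgen : ∀ t ∈ Icc 0 δ, ∀ x,
      HasGenerator Ω δ (fun t => Ξ t) t x (fun u => tderiv E ℝ (K t) x u) 1) :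
    IsHamiltonianFlow Ω δ (fun t x => K t ((Ξ t).symm x)) Ξ := by
  refine ⟨h1, h2, h0, fun t y => velocity E δ (fun t => (Ξ t : M → M)) t ((Ξ t).symm y), ?_, ?_⟩
  · intro t ht
    funext y
    refine diffForm1_ext fun v => ?_
    have hg := (hgen t ht ((Ξ t).symm y)).one_form (tderiv E E (Ξ t).symm y v)
    have e := tderiv_comp (h1.mdifferentiableAt ht ((Ξ t).symm y)) (h2.mdifferentiableAt ht y)
    have e0 : (fun z => Ξ t ((Ξ t).symm z)) = fun z => z := funext (Ξ t).apply_symm_apply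
    simp only [e0, tderiv_id] at e
    have e1 : tderiv E E (Ξ t) ((Ξ t).symm y) (tderiv E E (Ξ t).symm y v) = v :=
      (DFunLike.congr_fun e v).symm
    simp only [e1, Diffeomorph.apply_symm_apply] at hg
    change ev2 Ω y (velocity E δ (fun t => (Ξ t : M → M)) t ((Ξ t).symm y)) v = _
    rw [hg, ev1_dFun]
    exact (DFunLike.congr_fun (tderiv_comp (hK.mdifferentiableAt ht ((Ξ t).symm y))
      (h2.mdifferentiableAt ht y)) v).symm
  · intro t ht x
    have := h1.hasVelocityWithin ht x
    simp only [Diffeomorph.symm_apply_apply]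
    exact this

variable [IsManifold 𝓘(ℝ, E) ∞ M]

/-- A Hamiltonian flow preserves the symplectic form, and `η` is the differential of the Hamiltonian
function read at the starting point. -/
theorem hasGenerator_of_isHamiltonianFlow (hΩ : IsSymplecticForm Ω) (hδ : 0 < δ) {H : ℝ → M → ℝ}
    (hH : SmoothFamily E ℝ δ H) {Φ : ℝ → Diffeomorph 𝓘(ℝ, E) 𝓘(ℝ, E) M M ∞}
    (h : IsHamiltonianFlow Ω δ H Φ) (ht : t ∈ Icc 0 δ) (x : M) :
    HasGenerator Ω δ (fun t => Φ t) t x (fun u => tderiv E ℝ (fun y => H t (Φ t y)) x u) 1 := by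
  have hΦ : SmoothFamily E E δ (fun t => (Φ t : M → M)) := h.smooth
  obtain ⟨V, hV, hv⟩ := h.velocity
  have hvel : ∀ t ∈ Icc 0 δ, ∀ x w, ev2 Ω (Φ t x) (velocity E δ (fun t => (Φ t : M → M)) t x) w =
      ev1 (dFun (H t)) (Φ t x) w := by
    intro t ht x w
    have e : velocity E δ (fun t => (Φ t : M → M)) t x = V t (Φ t x) :=
      HasVelocityWithin.unique (uniqueDiffOn_Icc hδ t ht) (hΦ.hasVelocityWithin ht x) (hv t ht x)
    rw [e, ← hV t ht]
    rfl
  constructor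
  · intro u
    rw [hvel t ht x, ev1_dFun, tderiv_comp (hH.mdifferentiableAt ht _) (hΦ.mdifferentiableAt ht x)]
    rfl
  · intro u w
    have := ev2_pullback_eq_exp hΦ hΩ.smooth hΩ.closed h.init ht x (c := 0) (u := u) (w := w) ?_
    · simpa using this
    · intro s hs
      have hs' : s ∈ Icc 0 δ := ⟨hs.1.le, hs.2.le.trans ht.2⟩
      refine ⟨dFun (H s), isSmoothForm_of_isExactNear (isExactNear_dFun (hH.contMDiff hs')), ?_,
        Eventually.of_forall fun x' w => hvel s hs' x' w⟩
      rw [dForm_eq_zero_of_isExactNear (isExactNear_dFun (hH.contMDiff hs') _), zero_smul]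

end HamiltonianFlows



/-! ### Uniform convergence of time-dependent maps -/

section UniformConvergence

variable {X Y Z : Type*} [MetricSpace X] [MetricSpace Y] [MetricSpace Z] {δ : ℝ}

/-- The sequence `F n` of time-dependent maps converges uniformly on `[0, δ] × X` to the uniformly
continuous time-dependent map `f`. -/
structure UnifConv (δ : ℝ) (F : ℕ → ℝ → X → Y) (f : ℝ → X → Y) : Prop where
  unifCont : UniformContinuousOn (fun p : ℝ × X => f p.1 p.2) (Icc 0 δ ×ˢ univ)
  tendsto : TendstoUniformlyOn (fun n (p : ℝ × X) => F n p.1 p.2) (fun p => f p.1 p.2) atTop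
    (Icc 0 δ ×ˢ univ)

lemma UnifConv.const {f : ℝ → X → Y}
    (h : UniformContinuousOn (fun p : ℝ × X => f p.1 p.2) (Icc 0 δ ×ˢ univ)) :
    UnifConv δ (fun _ => f) f := by
  refine ⟨h, Metric.tendstoUniformlyOn_iff.2 fun ε hε => Eventually.of_forall fun n x _ => ?_⟩
  rwa [dist_self]

/-- Uniform continuity of the limits makes uniform convergence compatible with composition. -/
lemma UnifConv.comp {F : ℕ → ℝ → Y → Z} {f : ℝ → Y → Z} {G : ℕ → ℝ → X → Y} {g : ℝ → X → Y}
    (hF : UnifConv δ F f) (hG : UnifConv δ G g) :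
    UnifConv δ (fun n t x => F n t (G n t x)) (fun t x => f t (g t x)) := by
  have huc := Metric.uniformContinuousOn_iff.1 hF.unifCont
  constructor
  · refine Metric.uniformContinuousOn_iff.2 fun ε hε => ?_
    obtain ⟨η, hη, h1⟩ := huc ε hε
    obtain ⟨θ, hθ, h2⟩ := Metric.uniformContinuousOn_iff.1 hG.unifCont η hη
    refine ⟨min η θ, lt_min hη hθ, fun p hp q hq hpq => ?_⟩
    refine h1 (p.1, g p.1 p.2) ⟨hp.1, mem_univ _⟩ (q.1, g q.1 q.2) ⟨hq.1, mem_univ _⟩ ?_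
    refine max_lt ?_ (h2 p hp q hq (hpq.trans_le (min_le_right _ _)))
    exact (le_max_left _ _).trans_lt (hpq.trans_le (min_le_left _ _))
  · refine Metric.tendstoUniformlyOn_iff.2 fun ε hε => ?_
    obtain ⟨η, hη, h1⟩ := huc (ε / 2) (half_pos hε)
    filter_upwards [Metric.tendstoUniformlyOn_iff.1 hF.tendsto (ε / 2) (half_pos hε),
      Metric.tendstoUniformlyOn_iff.1 hG.tendsto η hη] with n h2 h3 p hp
    have h4 := h1 (p.1, g p.1 p.2) ⟨hp.1, mem_univ _⟩ (p.1, G n p.1 p.2) ⟨hp.1, mem_univ _⟩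
      (max_lt (by rw [dist_self]; exact hη) (h3 p hp))
    have h5 := h2 (p.1, G n p.1 p.2) ⟨hp.1, mem_univ _⟩
    calc _ ≤ _ := dist_triangle _ (f p.1 (G n p.1 p.2)) _
      _ < ε / 2 + ε / 2 := add_lt_add h4 h5
      _ = ε := add_halves ε

lemma UnifConv.add {F G : ℕ → ℝ → X → ℝ} {f g : ℝ → X → ℝ}
    (hF : UnifConv δ F f) (hG : UnifConv δ G g) :
    UnifConv δ (fun n t x => F n t x + G n t x) (fun t x => f t x + g t x) :=
  ⟨uniformContinuousOn_iff_restrict.2 ((uniformContinuousOn_iff_restrict.1 hF.unifCont).add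
    (uniformContinuousOn_iff_restrict.1 hG.unifCont)), hF.tendsto.add hG.tendsto⟩

lemma UnifConv.neg {F : ℕ → ℝ → X → ℝ} {f : ℝ → X → ℝ} (hF : UnifConv δ F f) :
    UnifConv δ (fun n t x => - F n t x) (fun t x => - f t x) :=
  ⟨uniformContinuousOn_iff_restrict.2 (uniformContinuousOn_iff_restrict.1 hF.unifCont).neg,
      hF.tendsto.neg⟩

lemma UnifConv.mono {F : ℕ → ℝ → X → Y} {f : ℝ → X → Y} (hF : UnifConv δ F f) {δ' : ℝ}
    (h : δ' ≤ δ) : UnifConv δ' F f := by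
  have h' : (Icc 0 δ' ×ˢ univ : Set (ℝ × X)) ⊆ Icc 0 δ ×ˢ univ :=
    prod_mono (Icc_subset_Icc_right h) Subset.rfl
  exact ⟨hF.unifCont.mono h', hF.tendsto.mono h'⟩

lemma UnifConv.subseq {F : ℕ → ℝ → X → Y} {f : ℝ → X → Y} (hF : UnifConv δ F f) (N : ℕ) :
    UnifConv δ (fun n => F (n + N)) f := by
  refine ⟨hF.unifCont, Metric.tendstoUniformlyOn_iff.2 fun ε hε => ?_⟩
  exact (tendsto_add_atTop_nat N).eventually (Metric.tendstoUniformlyOn_iff.1 hF.tendsto ε hε)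

lemma UnifConv.eq_of_forall_eq {F : ℕ → ℝ → X → Y} {f : ℝ → X → Y} (hF : UnifConv δ F f) {t : ℝ}
    (ht : t ∈ Icc 0 δ) {x : X} {y : Y} (h : ∀ n, F n t x = y) : f t x = y := by
  have h1 := hF.tendsto.tendsto_at (x := (t, x)) ⟨ht, mem_univ _⟩
  simp only [h] at h1
  exact tendsto_nhds_unique h1 tendsto_const_nhds

lemma UnifConv.continuous {F : ℕ → ℝ → X → Y} {f : ℝ → X → Y} (hF : UnifConv δ F f) {t : ℝ}
    (ht : t ∈ Icc 0 δ) : Continuous (f t) := by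
  have h : Continuous fun x : X => (t, x) := by fun_prop
  exact hF.unifCont.continuousOn.comp_continuous h fun x => ⟨ht, mem_univ _⟩

/-- A continuous time-dependent map that agrees, off a compact set, with a uniformly continuous map
independent of time, is uniformly continuous. -/
lemma uniformContinuousOn_of_eq_off_compact {f : ℝ → X → Y} {g : X → Y} {K : Set X}
    (hf : ContinuousOn (fun p : ℝ × X => f p.1 p.2) (Icc 0 δ ×ˢ univ)) (hg : UniformContinuous g)
    (hK : IsCompact K) (hfg : ∀ t ∈ Icc 0 δ, ∀ x, x ∉ K → f t x = g x) :
    UniformContinuousOn (fun p : ℝ × X => f p.1 p.2) (Icc 0 δ ×ˢ univ) := by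
  rw [uniformContinuousOn_iff_restrict]
  set S : Set (ℝ × X) := Icc 0 δ ×ˢ univ with hS
  set F : S → Y := S.domRestrict (fun p : ℝ × X => f p.1 p.2) with hF
  have hFc : Continuous F := continuousOn_iff_continuous_domRestrict.1 hf
  let L : Set S := {p | p.1.2 ∈ K}
  have hL : IsCompact L := by
    rw [Subtype.isCompact_iff]
    have : ((↑) '' L : Set (ℝ × X)) = Icc 0 δ ×ˢ K := by
      ext p
      constructor
      · rintro ⟨q, hq, rfl⟩
        exact ⟨q.2.1, hq⟩
      · rintro ⟨h1, h2⟩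
        exact ⟨⟨p, h1, mem_univ _⟩, h2, rfl⟩
    rw [this]
    exact isCompact_Icc.prod hK
  refine Metric.uniformContinuous_iff.2 fun ε hε => ?_
  have h1 := hL.uniformContinuousAt_of_continuousAt F (fun a _ => hFc.continuousAt)
    (Metric.dist_mem_uniformity hε)
  obtain ⟨η, hη, h2⟩ := Metric.mem_uniformity_dist.1 h1
  obtain ⟨θ, hθ, h3⟩ := Metric.uniformContinuous_iff.1 hg ε hε
  refine ⟨min η θ, lt_min hη hθ, fun {p q} hpq => ?_⟩
  have hpq1 := hpq.trans_le (min_le_left _ _)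
  by_cases hp : p ∈ L
  · exact h2 hpq1 hp
  by_cases hq : q ∈ L
  · rw [dist_comm] at hpq1 ⊢
    exact h2 hpq1 hq
  · change dist (f p.1.1 p.1.2) (f q.1.1 q.1.2) < ε
    rw [hfg _ p.2.1 _ hp, hfg _ q.2.1 _ hq]
    refine h3 ((le_max_right _ _).trans_lt (hpq.trans_le (min_le_right _ _)))

/-- The inverses of a continuous family of bijections supported in a common compact set form a
continuous family. -/
lemma continuousOn_inverse_family {f g : ℝ → X → X} {K : Set X} (hK : IsCompact K)
    (hf : ContinuousOn (fun p : ℝ × X => f p.1 p.2) (Icc 0 δ ×ˢ univ))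
    (hfK : ∀ t ∈ Icc 0 δ, ∀ x, x ∉ K → f t x = x) (hfg : ∀ t ∈ Icc 0 δ, ∀ x, f t (g t x) = x)
    (hgf : ∀ t ∈ Icc 0 δ, ∀ x, g t (f t x) = x) :
    ContinuousOn (fun p : ℝ × X => g p.1 p.2) (Icc 0 δ ×ˢ univ) := by
  let F : Icc (0 : ℝ) δ × X → Icc (0 : ℝ) δ × X := fun p => (p.1, f p.1 p.2)
  let G : Icc (0 : ℝ) δ × X → Icc (0 : ℝ) δ × X := fun p => (p.1, g p.1 p.2)
  have hF : Continuous F := by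
    refine continuous_fst.prodMk ?_
    exact hf.comp_continuous (f := fun p : Icc (0 : ℝ) δ × X => ((p.1 : ℝ), p.2)) (by fun_prop)
      fun p => ⟨p.1.2, mem_univ _⟩
  have hFG : ∀ p, F (G p) = p := fun p => Prod.ext rfl (hfg _ p.1.2 _)
  have hGF : ∀ p, G (F p) = p := fun p => Prod.ext rfl (hgf _ p.1.2 _)
  let L : Set (Icc (0 : ℝ) δ × X) := univ ×ˢ K
  have hL : IsCompact L := isCompact_univ.prod hK
  have hFL : ∀ p ∈ closure Lᶜ, F p = p := by
    intro p hp
    have h1 : IsClosed {p | F p = p} := isClosed_eq hF continuous_id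
    refine (closure_minimal (fun q hq => ?_) h1) hp
    refine Prod.ext rfl (hfK _ q.1.2 _ fun h => hq ⟨mem_univ _, h⟩)
  have hG : Continuous G := by
    refine continuous_iff_isClosed.2 fun C hC => ?_
    have h1 : G ⁻¹' C = F '' (C ∩ L) ∪ (C ∩ closure Lᶜ) := by
      ext p
      constructor
      · intro hp
        by_cases h : G p ∈ L
        · exact Or.inl ⟨G p, ⟨hp, h⟩, hFG p⟩
        · have h2 : G p ∈ closure Lᶜ := subset_closure h
          have h3 : G p = p := by rw [← hFL _ h2, hFG]
          rw [h3] at h2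
          rw [mem_preimage, h3] at hp
          exact Or.inr ⟨hp, h2⟩
      · rintro (⟨q, ⟨hq, _⟩, rfl⟩ | ⟨h2, h3⟩)
        · rw [mem_preimage, hGF]; exact hq
        · rw [mem_preimage]
          have : G p = p := by conv_lhs => rw [← hFL p h3, hGF]
          rwa [this]
    rw [h1]
    exact ((hL.inter_left hC).image hF).isClosed.union (hC.inter isClosed_closure)
  rw [continuousOn_iff_continuous_domRestrict]
  have h2 : Continuous fun p : (Icc 0 δ ×ˢ univ : Set (ℝ × X)) =>
      ((⟨p.1.1, p.2.1⟩, p.1.2) : Icc (0 : ℝ) δ × X) := by fun_prop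
  exact continuous_snd.comp (hG.comp h2)

/-- Inverses of uniformly convergent bijections supported in a common compact set converge uniformly,
if the limit is bijective. -/
lemma UnifConv.inverse {F G : ℕ → ℝ → X → X} {f g : ℝ → X → X} (hF : UnifConv δ F f)
    {K : Set X} (hK : IsCompact K) (hFK : ∀ n, ∀ t ∈ Icc 0 δ, ∀ x, x ∉ K → F n t x = x)
    (hFG : ∀ n, ∀ t ∈ Icc 0 δ, ∀ x, F n t (G n t x) = x)
    (hfg : ∀ t ∈ Icc 0 δ, ∀ x, f t (g t x) = x) (hgf : ∀ t ∈ Icc 0 δ, ∀ x, g t (f t x) = x) :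
    UnifConv δ G g := by
  have hfK : ∀ t ∈ Icc 0 δ, ∀ x, x ∉ K → f t x = x := fun t ht x hx =>
    hF.eq_of_forall_eq ht fun n => hFK n t ht x hx
  have hgc := continuousOn_inverse_family hK hF.unifCont.continuousOn hfK hfg hgf
  have hgu := uniformContinuousOn_of_eq_off_compact (g := id) hgc uniformContinuous_id hK
    (fun t ht x hx => by
      have := hgf t ht x
      rwa [hfK t ht x hx] at this)
  refine ⟨hgu, Metric.tendstoUniformlyOn_iff.2 fun ε hε => ?_⟩
  obtain ⟨η, hη, h1⟩ := Metric.uniformContinuousOn_iff.1 hgu ε hε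
  filter_upwards [Metric.tendstoUniformlyOn_iff.1 hF.tendsto η hη] with n h2 p hp
  have h3 := h2 (p.1, G n p.1 p.2) ⟨hp.1, mem_univ _⟩
  have h4 := h1 (p.1, F n p.1 (G n p.1 p.2)) ⟨hp.1, mem_univ _⟩
    (p.1, f p.1 (G n p.1 p.2)) ⟨hp.1, mem_univ _⟩
    (max_lt (by rw [dist_self]; exact hη) (by rw [dist_comm]; exact h3))
  simpa only [hFG n p.1 hp.1, hgf p.1 hp.1] using h4

end UniformConvergence



/-! ### Calculus of `C⁰`-Hamiltonian isotopies -/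

section C0Hamiltonian

variable {E : Type*} [NormedAddCommGroup E] [NormedSpace ℝ E]
  {M : Type*} [MetricSpace M] [ChartedSpace E M] {δ t : ℝ} {Ω : DiffForm E M 2}

/-- Smooth Hamiltonian isotopies `Φ n` with inverses, converging together with them to `φ` and `ψ`,
and functions `K n` converging to `k`, all supported in the compact set `S`. Here `K n t` is
the Hamiltonian function composed with `Φ n t`, so that its differential is the generating form. -/
structure HamiltonianApprox (Ω : DiffForm E M 2) (δ : ℝ) (φ ψ : ℝ → M → M) (S : Set M)
    (K : ℕ → ℝ → M → ℝ) (Φ : ℕ → ℝ → Diffeomorph 𝓘(ℝ, E) 𝓘(ℝ, E) M M ∞) (k : ℝ → M → ℝ) :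
    Prop where
  compact : IsCompact S
  smooth_fun : ∀ n, SmoothFamily E ℝ δ (K n)
  supp_fun : ∀ n, ∀ t ∈ Icc 0 δ, ∀ x, x ∉ S → K n t x = 0
  smooth : ∀ n, SmoothFamily E E δ fun t => (Φ n t : M → M)
  smooth_symm : ∀ n, SmoothFamily E E δ fun t => ((Φ n t).symm : M → M)
  init : ∀ n x, Φ n 0 x = x
  supp : ∀ n, ∀ t ∈ Icc 0 δ, ∀ x, x ∉ S → Φ n t x = x
  generator : ∀ n, ∀ t ∈ Icc 0 δ, ∀ x,
    HasGenerator Ω δ (fun t => Φ n t) t x (fun u => tderiv E ℝ (K n t) x u) 1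
  conv_fun : UnifConv δ K k
  conv : UnifConv δ (fun n t x => Φ n t x) φ
  conv_symm : UnifConv δ (fun n t x => (Φ n t).symm x) ψ
  right_inv : ∀ t ∈ Icc 0 δ, ∀ x, φ t (ψ t x) = x
  left_inv : ∀ t ∈ Icc 0 δ, ∀ x, ψ t (φ t x) = x

variable {φ ψ φ' ψ' : ℝ → M → M} {S S' : Set M} {K K' : ℕ → ℝ → M → ℝ}
  {Φ Φ' : ℕ → ℝ → Diffeomorph 𝓘(ℝ, E) 𝓘(ℝ, E) M M ∞} {k k' : ℝ → M → ℝ}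

lemma Diffeomorph.symm_eq_self {f : Diffeomorph 𝓘(ℝ, E) 𝓘(ℝ, E) M M ∞} {x : M} (h : f x = x) :
    f.symm x = x := by
  conv_lhs => rw [← h]
  exact f.symm_apply_apply x

/-- The Hamiltonian functions are the `K n t ∘ (Φ n t)⁻¹`. -/
lemma HamiltonianApprox.isC0HamiltonianIsotopy
    (h : HamiltonianApprox Ω δ φ ψ S K Φ k) : IsC0HamiltonianIsotopy Ω δ φ := by
  have hconv := h.conv_fun.comp h.conv_symm
  refine ⟨fun t ht => ?_, S, fun n t x => K n t ((Φ n t).symm x), Φ, fun t x => k t (ψ t x),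
    h.compact, fun n => ?_, fun n t ht x hx => ?_, fun n => ?_, hconv.unifCont.continuousOn,
    hconv.tendsto, h.conv.tendsto⟩
  · exact isHomeomorph_iff_exists_inverse.2 ⟨h.conv.continuous ht, ψ t, h.left_inv t ht,
      h.right_inv t ht, h.conv_symm.continuous ht⟩
  · exact (h.smooth_fun n).comp (h.smooth_symm n)
  · change K n t ((Φ n t).symm x) = 0
    rw [Diffeomorph.symm_eq_self (h.supp n t ht x hx)]
    exact h.supp_fun n t ht x hx
  · exact isHamiltonianFlow_of_hasGenerator (h.smooth n) (h.smooth_symm n) (h.init n)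
      (h.smooth_fun n) (h.generator n)

lemma HamiltonianApprox.mono (h : HamiltonianApprox Ω δ φ ψ S K Φ k) {δ' : ℝ} (hδ' : 0 < δ')
    (hle : δ' ≤ δ) : HamiltonianApprox Ω δ' φ ψ S K Φ k := by
  have hI : ∀ {t : ℝ}, t ∈ Icc 0 δ' → t ∈ Icc 0 δ := fun ht => ⟨ht.1, ht.2.trans hle⟩
  refine ⟨h.compact, fun n => (h.smooth_fun n).mono hle, fun n t ht => h.supp_fun n t (hI ht),
    fun n => (h.smooth n).mono hle, fun n => (h.smooth_symm n).mono hle, h.init,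
    fun n t ht => h.supp n t (hI ht), fun n t ht x => ?_, h.conv_fun.mono hle, h.conv.mono hle,
    h.conv_symm.mono hle, fun t ht => h.right_inv t (hI ht), fun t ht => h.left_inv t (hI ht)⟩
  have hg := h.generator n t (hI ht) x
  have e : velocity E δ' (fun t => (Φ n t : M → M)) t x =
      velocity E δ (fun t => (Φ n t : M → M)) t x :=
    (((h.smooth n).mono hle).hasVelocityWithin ht x).unique (uniqueDiffOn_Icc hδ' t ht)
      (((h.smooth n).hasVelocityWithin (hI ht) x).mono (Icc_subset_Icc_right hle))
  exact ⟨fun u => by rw [e]; exact hg.one_form u, hg.conformal⟩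

/-- Composition of `C⁰`-Hamiltonian isotopies. -/
lemma HamiltonianApprox.comp (hδ : 0 < δ) (h : HamiltonianApprox Ω δ φ ψ S K Φ k)
    (h' : HamiltonianApprox Ω δ φ' ψ' S' K' Φ' k') :
    HamiltonianApprox Ω δ (fun t x => φ t (φ' t x)) (fun t x => ψ' t (ψ t x)) (S ∪ S')
      (fun n t x => K n t (Φ' n t x) + K' n t x) (fun n t => (Φ' n t).trans (Φ n t))
      (fun t x => k t (φ' t x) + k' t x) := by
  refine ⟨h.compact.union h'.compact, fun n => ?_, fun n t ht x hx => ?_,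
    fun n => (h.smooth n).comp (h'.smooth n), fun n => (h'.smooth_symm n).comp (h.smooth_symm n),
    fun n x => ?_, fun n t ht x hx => ?_, fun n t ht x => ?_,
    (h.conv_fun.comp h'.conv).add h'.conv_fun, h.conv.comp h'.conv,
    h'.conv_symm.comp h.conv_symm, fun t ht x => ?_, fun t ht x => ?_⟩
  · exact ContMDiffOn.add ((h.smooth_fun n).comp (h'.smooth n)) (h'.smooth_fun n)
  · rw [mem_union, not_or] at hx
    rw [h'.supp n t ht x hx.2, h.supp_fun n t ht x hx.1, h'.supp_fun n t ht x hx.2, add_zero]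
  · change Φ n 0 (Φ' n 0 x) = x
    rw [h'.init, h.init]
  · rw [mem_union, not_or] at hx
    change Φ n t (Φ' n t x) = x
    rw [h'.supp n t ht x hx.2, h.supp n t ht x hx.1]
  · refine ((h.generator n t ht _).comp (h.smooth n) (h'.smooth n) hδ ht
      (h'.generator n t ht x)).congr_right (fun u => ?_) (by norm_num)
    have d1 := ((h.smooth_fun n).comp (h'.smooth n)).mdifferentiableAt ht x
    have d2 := (h'.smooth_fun n).mdifferentiableAt ht x
    have e1 : tderiv E ℝ (fun x => K n t (Φ' n t x) + K' n t x) x =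
        tderiv E ℝ (fun x => K n t (Φ' n t x)) x + tderiv E ℝ (K' n t) x := mfderiv_add d1 d2
    rw [e1, tderiv_comp ((h.smooth_fun n).mdifferentiableAt ht _)
      ((h'.smooth n).mdifferentiableAt ht x)]
    simp
  · rw [h'.right_inv t ht, h.right_inv t ht]
  · rw [h.left_inv t ht, h'.left_inv t ht]

/-- Inversion of `C⁰`-Hamiltonian isotopies. -/
lemma HamiltonianApprox.inv (hδ : 0 < δ) (h : HamiltonianApprox Ω δ φ ψ S K Φ k) :
    HamiltonianApprox Ω δ ψ φ S (fun n t x => - K n t ((Φ n t).symm x)) (fun n t => (Φ n t).symm)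
      (fun t x => - k t (ψ t x)) := by
  refine ⟨h.compact, fun n => ?_, fun n t ht x hx => ?_, h.smooth_symm, h.smooth,
    fun n x => Diffeomorph.symm_eq_self (h.init n x),
    fun n t ht x hx => Diffeomorph.symm_eq_self (h.supp n t ht x hx), fun n t ht x => ?_,
    (h.conv_fun.comp h.conv_symm).neg, h.conv_symm, h.conv, h.left_inv, h.right_inv⟩
  · exact ContMDiffOn.neg ((h.smooth_fun n).comp (h.smooth_symm n))
  · rw [Diffeomorph.symm_eq_self (h.supp n t ht x hx), h.supp_fun n t ht x hx, neg_zero]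
  · refine ((h.generator n t ht _).inv (h.smooth n) (h.smooth_symm n)
      (fun t _ x => (Φ n t).apply_symm_apply x) hδ ht one_ne_zero).congr_right (fun u => ?_)
      (by norm_num)
    have e1 : tderiv E ℝ (fun x => - K n t ((Φ n t).symm x)) x =
        - tderiv E ℝ (fun x => K n t ((Φ n t).symm x)) x := mfderiv_neg
    rw [e1, tderiv_comp ((h.smooth_fun n).mdifferentiableAt ht _)
      ((h.smooth_symm n).mdifferentiableAt ht x)]
    simp

lemma IsSymplecticForm.eq_zero_of_ev2 (hΩ : IsSymplecticForm Ω) {x : M} {v : E}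
    (h : ∀ w, ev2 Ω x v w = 0) : v = 0 := hΩ.nondegenerate x v h

variable [IsManifold 𝓘(ℝ, E) ∞ M]

/-- A Hamiltonian flow fixes the points off a closed set outside of which the Hamiltonian function
vanishes. -/
lemma IsHamiltonianFlow.eq_self (hΩ : IsSymplecticForm Ω) {H : ℝ → M → ℝ}
    {Ψ : ℝ → Diffeomorph 𝓘(ℝ, E) 𝓘(ℝ, E) M M ∞} (h : IsHamiltonianFlow Ω δ H Ψ) {C : Set M}
    (hC : IsClosed C) (hH : ∀ t ∈ Icc 0 δ, ∀ x, x ∉ C → H t x = 0) {x : M} (hx : x ∉ C)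
    (ht : t ∈ Icc 0 δ) : Ψ t x = x := by
  have hΨ : SmoothFamily E E δ (fun t => (Ψ t : M → M)) := h.smooth
  obtain ⟨V, hV, hv⟩ := h.velocity
  let W : ℝ → M → E := V
  have hV0 : ∀ s ∈ Icc 0 δ, ∀ y, y ∉ C → W s y = 0 := by
    intro s hs y hy
    refine hΩ.eq_zero_of_ev2 (x := y) fun w => ?_
    change ev1 (contract (V s) Ω) y w = 0
    rw [hV s hs, ev1_dFun]
    have e : H s =ᶠ[𝓝 y] fun _ => 0 := by
      filter_upwards [hC.isOpen_compl.mem_nhds hy] with z hz using hH s hs z hz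
    rw [tderiv_congr e, tderiv_const]
    rfl
  have hcurve : ContinuousOn (fun s => Ψ s x) (Icc 0 δ) := fun s hs =>
    (hΨ.hasVelocityWithin hs x).continuousWithinAt
  have hclosed : IsClosed ({s | Ψ s x = x} ∩ Icc 0 δ) := by
    have := hcurve.preimage_isClosed_of_isClosed isClosed_Icc (isClosed_singleton (x := x))
    rwa [inter_comm]
  refine hclosed.Icc_subset_of_forall_mem_nhdsWithin (h.init x) ?_ ht
  rintro s ⟨hs, hsI⟩
  have hsI' : s ∈ Icc 0 δ := Ico_subset_Icc_self hsI
  -- near time `s` the curve stays in the chart around `x` and off the set `C`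
  have hU : (extChartAt 𝓘(ℝ, E) x).source ∩ Cᶜ ∈ 𝓝 (Ψ s x) := by
    have hs : Ψ s x = x := hs
    rw [hs]
    exact inter_mem (chart_source_mem_nhds (mem_extChartAt_source x)) (hC.isOpen_compl.mem_nhds hx)
  have h1 : ∀ᶠ r in 𝓝[Icc 0 δ] s, Ψ r x ∈ (extChartAt 𝓘(ℝ, E) x).source ∩ Cᶜ :=
    (hcurve s hsI') hU
  have h2 : ∀ᶠ r in 𝓝[Icc s δ] s, Ψ r x ∈ (extChartAt 𝓘(ℝ, E) x).source ∩ Cᶜ :=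
    h1.filter_mono (nhdsWithin_mono _ (Icc_subset_Icc_left hsI.1))
  rw [nhdsWithin_Icc_eq_nhdsGE hsI.2] at h2
  obtain ⟨b, hb, hb'⟩ := mem_nhdsGE_iff_exists_Icc_subset.1 h2
  have hb1 : s < min b δ := lt_min hb hsI.2
  have hsub : Icc s (min b δ) ⊆ Icc 0 δ := Icc_subset_Icc hsI.1 (min_le_right _ _)
  have hd : ∀ r ∈ Icc s (min b δ), HasDerivWithinAt (fun r => extChartAt 𝓘(ℝ, E) x (Ψ r x)) 0
      (Icc s (min b δ)) r := by
    intro r hr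
    have hr' : Ψ r x ∈ (extChartAt 𝓘(ℝ, E) x).source ∩ Cᶜ :=
      hb' ⟨hr.1, hr.2.trans (min_le_left _ _)⟩
    have h3 : HasVelocityWithin (fun r => Ψ r x) (Icc 0 δ) r (W r (Ψ r x)) :=
      hv r (hsub hr) x
    rw [hV0 r (hsub hr) _ hr'.2] at h3
    have h4 := (h3.comp_mdifferentiableAt (mdifferentiableAt_chart hr'.1)).hasDerivWithinAt
    rw [map_zero] at h4
    exact h4.mono hsub
  have h5 := constant_of_derivWithin_zero (fun r hr => (hd r hr).differentiableWithinAt)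
    (fun r hr => (hd r (Ico_subset_Icc_self hr)).derivWithin
      (uniqueDiffOn_Icc hb1 r (Ico_subset_Icc_self hr)))
  refine mem_of_superset (Ioc_mem_nhdsGT hb1) fun r hr => ?_
  have h6 := h5 r (Ioc_subset_Icc_self hr)
  have hs : Ψ s x = x := hs
  rw [hs] at h6
  exact (extChartAt 𝓘(ℝ, E) x).injOn
    (hb' ⟨hr.1.le, hr.2.trans (min_le_left _ _)⟩).1 (mem_extChartAt_source x) h6

/-- A `C⁰`-Hamiltonian isotopy is the limit of Hamiltonian isotopies supported in a common compact
set, whose inverses converge as well. -/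
lemma IsC0HamiltonianIsotopy.exists_approx (hΩ : IsSymplecticForm Ω) (hδ : 0 < δ)
    (h : IsC0HamiltonianIsotopy Ω δ φ) :
    ∃ ψ S K Φ k, HamiltonianApprox Ω δ φ ψ S K Φ k := by
  obtain ⟨hφ, S, H, Φ, k, hS, hHs, hH0, hflow, hkc, hHk, hΦ⟩ := h
  have hinv : ∀ t, ∃ g : M → M, t ∈ Icc 0 δ → (∀ x, φ t (g x) = x) ∧ ∀ x, g (φ t x) = x := by
    intro t
    by_cases ht : t ∈ Icc 0 δ
    · obtain ⟨-, g, h1, h2, -⟩ := isHomeomorph_iff_exists_inverse.1 (hφ t ht)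
      exact ⟨g, fun _ => ⟨h2, h1⟩⟩
    · exact ⟨id, fun h => absurd h ht⟩
  choose ψ hψ using hinv
  have hsupp : ∀ n, ∀ t ∈ Icc 0 δ, ∀ x, x ∉ S → Φ n t x = x := fun n t ht x hx =>
    (hflow n).eq_self hΩ hS.isClosed (hH0 n) hx ht
  have hφc : ContinuousOn (fun p : ℝ × M => φ p.1 p.2) (Icc 0 δ ×ˢ univ) :=
    hΦ.continuousOn (Frequently.of_forall fun n => (hflow n).smooth.continuousOn)
  have hφS : ∀ t ∈ Icc 0 δ, ∀ x, x ∉ S → φ t x = x := by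
    intro t ht x hx
    have h1 := hΦ.tendsto_at (x := (t, x)) ⟨ht, mem_univ _⟩
    simp only [hsupp _ t ht x hx] at h1
    exact tendsto_nhds_unique h1 tendsto_const_nhds
  have hkS : ∀ t ∈ Icc 0 δ, ∀ x, x ∉ S → k t x = 0 := by
    intro t ht x hx
    have h1 := hHk.tendsto_at (x := (t, x)) ⟨ht, mem_univ _⟩
    simp only [hH0 _ t ht x hx] at h1
    exact tendsto_nhds_unique h1 tendsto_const_nhds
  have conv : UnifConv δ (fun n t x => Φ n t x) φ :=
    ⟨uniformContinuousOn_of_eq_off_compact (g := id) hφc uniformContinuous_id hS hφS, hΦ⟩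
  have convH : UnifConv δ H k :=
    ⟨uniformContinuousOn_of_eq_off_compact (g := fun _ => 0) hkc uniformContinuous_const hS hkS,
      hHk⟩
  refine ⟨ψ, S, fun n t x => H n t (Φ n t x), Φ, fun t x => k t (φ t x), hS,
    fun n => SmoothFamily.comp (hHs n) (hflow n).smooth, fun n t ht x hx => ?_,
    fun n => (hflow n).smooth, fun n => (hflow n).smooth_symm, fun n => (hflow n).init, hsupp,
    fun n t ht x => hasGenerator_of_isHamiltonianFlow hΩ hδ (hHs n) (hflow n) ht x,
    convH.comp conv, conv, ?_, fun t ht => (hψ t ht).1, fun t ht => (hψ t ht).2⟩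
  · rw [hsupp n t ht x hx, hH0 n t ht x hx]
  · exact conv.inverse hS hsupp (fun n t _ x => (Φ n t).apply_symm_apply x)
      (fun t ht => (hψ t ht).1) (fun t ht => (hψ t ht).2)

end C0Hamiltonian



/-! ### Symplectic homeomorphisms -/

section SymplecticHomeomorphisms

variable {E : Type*} [NormedAddCommGroup E] [NormedSpace ℝ E]
  {M : Type*} [MetricSpace M] [ChartedSpace E M] {δ : ℝ} {Ω : DiffForm E M 2}

lemma eq_self_of_notMem_homeoSupport {φ : M → M} {x : M} (hx : x ∉ homeoSupport φ) : φ x = x := by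
  by_contra h
  exact hx (subset_closure h)

lemma homeoSupport_subset {φ : M → M} {K : Set M} (hK : IsClosed K)
    (h : ∀ x, x ∉ K → φ x = x) : homeoSupport φ ⊆ K := by
  refine closure_minimal (fun x hx => ?_) hK
  by_contra h'
  exact hx (h x h')

lemma symm_eq_self {φ : M ≃ₜ M} {x : M} (h : φ x = x) : φ.symm x = x := by
  conv_lhs => rw [← h]
  exact φ.symm_apply_apply x

lemma homeoSupport_symm (φ : M ≃ₜ M) : homeoSupport φ.symm = homeoSupport φ := by
  apply Subset.antisymm
  · exact homeoSupport_subset isClosed_closure fun x hx =>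
      symm_eq_self (eq_self_of_notMem_homeoSupport hx)
  · exact homeoSupport_subset isClosed_closure fun x hx =>
      symm_eq_self (φ := φ.symm) (eq_self_of_notMem_homeoSupport hx)

/-- A homeomorphism maps every set containing its support to itself. -/
lemma mapsTo_of_homeoSupport_subset (φ : M ≃ₜ M) {D : Set M} (hD : homeoSupport φ ⊆ D) {x : M}
    (hx : x ∈ D) : φ x ∈ D := by
  by_cases h : φ x = x
  · rwa [h]
  · refine hD (subset_closure fun h' => h ?_)
    exact φ.injective h'

lemma isCompact_homeoSupport_mul {φ ψ : M ≃ₜ M} (hφ : IsCompact (homeoSupport φ))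
    (hψ : IsCompact (homeoSupport ψ)) :
    IsCompact (homeoSupport (φ * ψ : M ≃ₜ M)) ∧
      homeoSupport (φ * ψ : M ≃ₜ M) ⊆ homeoSupport φ ∪ homeoSupport ψ := by
  have h : homeoSupport (φ * ψ : M ≃ₜ M) ⊆ homeoSupport φ ∪ homeoSupport ψ := by
    refine homeoSupport_subset (isClosed_closure.union isClosed_closure) fun x hx => ?_
    rw [mem_union, not_or] at hx
    change φ (ψ x) = x
    rw [eq_self_of_notMem_homeoSupport hx.2, eq_self_of_notMem_homeoSupport hx.1]
  exact ⟨(hφ.union hψ).of_isClosed_subset isClosed_closure h, h⟩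

/-- Symplectic diffeomorphisms `f n` supported in the compact set `K`, converging to `φ` together
with their inverses. -/
structure SymplecticApprox (Ω : DiffForm E M 2) (φ : M ≃ₜ M) (K : Set M)
    (f : ℕ → Diffeomorph 𝓘(ℝ, E) 𝓘(ℝ, E) M M ∞) : Prop where
  compact : IsCompact K
  symplectic : ∀ n, IsSymplecticDiffeo Ω (f n)
  supp : ∀ n x, x ∉ K → f n x = x
  conv : ∀ δ, UnifConv δ (fun n _ x => f n x) (fun _ x => φ x)
  conv_symm : ∀ δ, UnifConv δ (fun n _ x => (f n).symm x) (fun _ x => φ.symm x)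

lemma IsSymplecticHomeo.exists_approx {φ : M ≃ₜ M} (h : IsSymplecticHomeo Ω φ) :
    ∃ K f, SymplecticApprox Ω φ K f := by
  obtain ⟨K, f, hK, hf, hfK, hlim⟩ := h
  have hsupp : ∀ n x, x ∉ K → f n x = x := fun n x hx =>
    eq_self_of_notMem_homeoSupport fun h => hx (hfK n h)
  have hφ : ∀ x, x ∉ K → φ x = x := fun x hx => by
    have h1 := hlim.tendsto_at x
    simp only [hsupp _ x hx] at h1
    exact tendsto_nhds_unique h1 tendsto_const_nhds
  have conv : ∀ δ, UnifConv δ (fun n _ x => f n x) (fun _ x => φ x) := fun δ => by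
    refine ⟨uniformContinuousOn_of_eq_off_compact (g := id)
      (φ.continuous.comp continuous_snd).continuousOn uniformContinuous_id hK fun t _ x hx => hφ
          x hx,
      Metric.tendstoUniformlyOn_iff.2 fun ε hε => ?_⟩
    filter_upwards [Metric.tendstoUniformly_iff.1 hlim ε hε] with n hn p _ using hn p.2
  exact ⟨K, f, hK, hf, hsupp, conv, fun δ => (conv δ).inverse hK (fun n t _ x hx => hsupp n x hx)
    (fun n t _ x => (f n).apply_symm_apply x) (fun t _ x => φ.apply_symm_apply x)
    (fun t _ x => φ.symm_apply_apply x)⟩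

variable {φ φ' : M ≃ₜ M} {S S' : Set M} {f f' : ℕ → Diffeomorph 𝓘(ℝ, E) 𝓘(ℝ, E) M M ∞}

lemma SymplecticApprox.isSymplecticHomeo (h : SymplecticApprox Ω φ S f) :
    IsSymplecticHomeo Ω φ := by
  refine ⟨S, f, h.compact, h.symplectic,
    fun n => homeoSupport_subset h.compact.isClosed (h.supp n), ?_⟩
  refine Metric.tendstoUniformly_iff.2 fun ε hε => ?_
  filter_upwards [Metric.tendstoUniformlyOn_iff.1 (h.conv 0).tendsto ε hε] with n hn x
  exact hn ((0 : ℝ), x) ⟨by simp, mem_univ _⟩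

lemma SymplecticApprox.apply_eq_self (h : SymplecticApprox Ω φ S f) {x : M} (hx : x ∉ S) :
    φ x = x :=
  (h.conv 0).eq_of_forall_eq (t := 0) (by simp) fun n => h.supp n x hx

lemma isSymplecticDiffeo_iff {g : Diffeomorph 𝓘(ℝ, E) 𝓘(ℝ, E) M M ∞} :
    IsSymplecticDiffeo Ω g ↔
      ∀ x u w, ev2 Ω (g x) (tderiv E E g x u) (tderiv E E g x w) = ev2 Ω x u w := by
  refine ⟨fun h x u w => h.ev2_eq x u w, fun h => ?_⟩
  funext x
  refine form2_ext (E := E) (ω₁ := pullbackForm g Ω x) (ω₂ := Ω x) fun u w => ?_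
  refine Eq.trans ?_ (h x u w)
  change (Ω (g x) : E [⋀^Fin 2]→L[ℝ] ℝ) _ = (Ω (g x) : E [⋀^Fin 2]→L[ℝ] ℝ) _
  congr 1
  ext i; fin_cases i <;> rfl

lemma diffeo_mdifferentiableAt (g : Diffeomorph 𝓘(ℝ, E) 𝓘(ℝ, E) M M ∞) (x : M) :
    MDifferentiableAt 𝓘(ℝ, E) 𝓘(ℝ, E) g x :=
  (g.contMDiff x).mdifferentiableAt (by simp)

lemma IsSymplecticDiffeo.trans {g g' : Diffeomorph 𝓘(ℝ, E) 𝓘(ℝ, E) M M ∞}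
    (h : IsSymplecticDiffeo Ω g) (h' : IsSymplecticDiffeo Ω g') :
    IsSymplecticDiffeo Ω (g.trans g') := by
  refine isSymplecticDiffeo_iff.2 fun x u w => ?_
  have e : tderiv E E (g.trans g') x = (tderiv E E g' (g x)).comp (tderiv E E g x) :=
    tderiv_comp (diffeo_mdifferentiableAt g' (g x)) (diffeo_mdifferentiableAt g x)
  rw [e]
  exact (h'.ev2_eq _ _ _).trans (h.ev2_eq _ _ _)

lemma IsSymplecticDiffeo.symm {g : Diffeomorph 𝓘(ℝ, E) 𝓘(ℝ, E) M M ∞}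
    (h : IsSymplecticDiffeo Ω g) : IsSymplecticDiffeo Ω g.symm := by
  refine isSymplecticDiffeo_iff.2 fun x u w => ?_
  have e := tderiv_comp (diffeo_mdifferentiableAt g (g.symm x)) (diffeo_mdifferentiableAt g.symm x)
  have e0 : (fun y => g (g.symm y)) = fun y => y := funext g.apply_symm_apply
  rw [e0, tderiv_id] at e
  have e1 : ∀ u, tderiv E E g (g.symm x) (tderiv E E g.symm x u) = u := fun u =>
    (DFunLike.congr_fun e u).symm
  rw [← h.ev2_eq (g.symm x), e1, e1, g.apply_symm_apply]

lemma SymplecticApprox.mul (h : SymplecticApprox Ω φ S f) (h' : SymplecticApprox Ω φ' S' f') :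
    SymplecticApprox Ω (φ * φ') (S ∪ S') (fun n => (f' n).trans (f n)) := by
  refine ⟨h.compact.union h'.compact, fun n => (h'.symplectic n).trans (h.symplectic n),
    fun n x hx => ?_, fun δ => (h.conv δ).comp (h'.conv δ),
    fun δ => (h'.conv_symm δ).comp (h.conv_symm δ)⟩
  rw [mem_union, not_or] at hx
  change f n (f' n x) = x
  rw [h'.supp n x hx.2, h.supp n x hx.1]

lemma SymplecticApprox.inv (h : SymplecticApprox Ω φ S f) :
    SymplecticApprox Ω φ⁻¹ S (fun n => (f n).symm) :=
  ⟨h.compact, fun n => (h.symplectic n).symm, fun n x hx => Diffeomorph.symm_eq_self (h.supp n x hx),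
    h.conv_symm, h.conv⟩

lemma symplecticApprox_one (Ω : DiffForm E M 2) :
    SymplecticApprox Ω 1 ∅ (fun _ => Diffeomorph.refl 𝓘(ℝ, E) M ∞) := by
  have h : ∀ δ, UnifConv δ (fun (_ : ℕ) (_ : ℝ) (x : M) => x) (fun _ x => x) := fun δ =>
    UnifConv.const uniformContinuous_snd.uniformContinuousOn
  refine ⟨isCompact_empty, fun n => isSymplecticDiffeo_iff.2 fun x u w => ?_, fun _ _ _ => rfl, h, h⟩
  have e : tderiv E E (Diffeomorph.refl 𝓘(ℝ, E) M ∞) x = ContinuousLinearMap.id ℝ E := tderiv_id x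
  rw [e]
  rfl

lemma UnifConv.congr_limit {X Y : Type*} [MetricSpace X] [MetricSpace Y] {F : ℕ → ℝ → X → Y}
    {f g : ℝ → X → Y} (h : UnifConv δ F f) (hfg : ∀ t ∈ Icc 0 δ, ∀ x, g t x = f t x) :
    UnifConv δ F g :=
  ⟨h.unifCont.congr fun p hp => (hfg p.1 hp.1 p.2).symm,
    h.tendsto.congr_right fun p hp => (hfg p.1 hp.1 p.2).symm⟩

section Conjugation

variable {φ ψ : ℝ → M → M} {K : ℕ → ℝ → M → ℝ}
  {Φ : ℕ → ℝ → Diffeomorph 𝓘(ℝ, E) 𝓘(ℝ, E) M M ∞} {k : ℝ → M → ℝ}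

lemma HamiltonianApprox.congr_limit (h : HamiltonianApprox Ω δ φ ψ S K Φ k) {φ' : ℝ → M → M}
    (e : ∀ t ∈ Icc 0 δ, ∀ x, φ' t x = φ t x) : HamiltonianApprox Ω δ φ' ψ S K Φ k :=
  { h with
    conv := h.conv.congr_limit e
    right_inv := fun t ht x => by rw [e t ht, h.right_inv t ht]
    left_inv := fun t ht x => by rw [e t ht, h.left_inv t ht] }

/-- Conjugation by a symplectic homeomorphism preserves `C⁰`-Hamiltonian isotopies. -/
lemma HamiltonianApprox.conj (hδ : 0 < δ) (h : HamiltonianApprox Ω δ φ ψ S K Φ k) {g : M ≃ₜ M}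
    (hg : SymplecticApprox Ω g S' f) :
    HamiltonianApprox Ω δ (fun t x => g (φ t (g.symm x))) (fun t x => g (ψ t (g.symm x)))
      (S ∪ S') (fun n t x => K n t ((f n).symm x))
      (fun n t => ((f n).symm.trans (Φ n t)).trans (f n)) (fun t x => k t (g.symm x)) := by
  have hf : ∀ n, SmoothFamily E E δ fun _ : ℝ => (f n : M → M) := fun n =>
    .of_contMDiff (f n).contMDiff
  have hf' : ∀ n, SmoothFamily E E δ fun _ : ℝ => ((f n).symm : M → M) := fun n =>
    .of_contMDiff (f n).symm.contMDiff
  have hsupp : ∀ n x, x ∉ S ∪ S' → x ∉ S ∧ f n x = x ∧ (f n).symm x = x := fun n x hx => by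
    rw [mem_union, not_or] at hx
    exact ⟨hx.1, hg.supp n x hx.2, Diffeomorph.symm_eq_self (hg.supp n x hx.2)⟩
  refine ⟨h.compact.union hg.compact, fun n => (h.smooth_fun n).comp (hf' n),
    fun n t ht x hx => ?_, fun n => (hf n).comp ((h.smooth n).comp (hf' n)),
    fun n => (hf n).comp ((h.smooth_symm n).comp (hf' n)), fun n x => ?_, fun n t ht x hx => ?_,
    fun n t ht x => ?_, h.conv_fun.comp (hg.conv_symm δ),
    (hg.conv δ).comp (h.conv.comp (hg.conv_symm δ)),
    (hg.conv δ).comp (h.conv_symm.comp (hg.conv_symm δ)), fun t ht x => ?_, fun t ht x => ?_⟩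
  · obtain ⟨h1, -, h3⟩ := hsupp n x hx
    rw [h3, h.supp_fun n t ht x h1]
  · change f n (Φ n 0 ((f n).symm x)) = x
    rw [h.init, (f n).apply_symm_apply]
  · obtain ⟨h1, h2, h3⟩ := hsupp n x hx
    change f n (Φ n t ((f n).symm x)) = x
    rw [h3, h.supp n t ht x h1, h2]
  · have g1 := hasGenerator_const (f n).symm.contMDiff
      (fun x u w => (hg.symplectic n).symm.ev2_eq x u w) hδ ht x
    have g2 := (h.generator n t ht ((f n).symm x)).comp (h.smooth n) (hf' n) hδ ht g1
    have g3 := (hasGenerator_const (f n).contMDiff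
      (fun x u w => (hg.symplectic n).ev2_eq x u w) hδ ht (Φ n t ((f n).symm x))).comp (hf n)
      ((h.smooth n).comp (hf' n)) hδ ht g2
    refine g3.congr_right (fun u => ?_) (by norm_num)
    rw [tderiv_comp ((h.smooth_fun n).mdifferentiableAt ht _)
      (diffeo_mdifferentiableAt (f n).symm x)]
    simp
  · simp [h.right_inv t ht]
  · simp [h.left_inv t ht]

lemma hamiltonianApprox_id (Ω : DiffForm E M 2) (hδ : 0 < δ) :
    HamiltonianApprox Ω δ (fun _ x => x) (fun _ x => x) ∅ (fun _ _ _ => 0)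
      (fun _ _ => Diffeomorph.refl 𝓘(ℝ, E) M ∞) (fun _ _ => 0) := by
  have h : UnifConv δ (fun (_ : ℕ) (_ : ℝ) (x : M) => x) (fun _ x => x) :=
    UnifConv.const uniformContinuous_snd.uniformContinuousOn
  have h1 : SmoothFamily E E δ fun (_ : ℝ) (x : M) => x := .of_contMDiff contMDiff_id
  refine ⟨isCompact_empty, fun n => .of_contMDiff contMDiff_const, fun _ _ _ _ _ => rfl,
    fun n => h1, fun n => h1, fun _ _ => rfl, fun _ _ _ _ _ => rfl, fun n t ht x => ?_,
    UnifConv.const uniformContinuous_const.uniformContinuousOn, h, h, fun _ _ _ => rfl, fun _ _ _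
        => rfl⟩
  refine (hasGenerator_const (Diffeomorph.refl 𝓘(ℝ, E) M ∞).contMDiff (fun x u w =>
    ((symplecticApprox_one Ω).symplectic 0).ev2_eq x u w) hδ ht x).congr_right (fun u => ?_) rfl
  rw [tderiv_const]
  rfl

end Conjugation

end SymplecticHomeomorphisms



/-! ### Local flows and the group `G₃` -/

section LocalFlow

variable {E : Type*} [NormedAddCommGroup E] [NormedSpace ℝ E] [FiniteDimensional ℝ E]
  {M : Type*} [MetricSpace M] [ChartedSpace E M] [IsManifold 𝓘(ℝ, E) ∞ M] {X : VField E M}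

/-- Smoothness of a vector field, as a section of the tangent bundle. -/
def IsSmoothField (X : VField E M) : Prop :=
  ContMDiff 𝓘(ℝ, E) 𝓘(ℝ, E).tangent ∞ (fun x => (⟨x, X x⟩ : TangentBundle 𝓘(ℝ, E) M))

omit [FiniteDimensional ℝ E] in
lemma IsSmoothField.neg (hX : IsSmoothField X) : IsSmoothField (fun x => - X x) :=
  ContMDiff.neg_section hX

/-- Two integral curves on a compact interval that agree at its left end are equal: glue both to a
common local integral curve before that end, and apply uniqueness on open intervals. -/
lemma IsSmoothField.eqOn_Icc_left (hX : IsSmoothField X) {γ γ' : ℝ → M} {a b : ℝ}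
    (hγ : IsMIntegralCurveOn γ X (Icc a b)) (hγ' : IsMIntegralCurveOn γ' X (Icc a b))
    (h : γ a = γ' a) : EqOn γ γ' (Icc a b) := by
  rcases le_or_gt b a with hab | hab
  · rintro t ⟨h1, h2⟩
    obtain rfl : t = a := le_antisymm (h2.trans hab) h1
    exact h
  have : IsManifold 𝓘(ℝ, E) 1 M := IsManifold.of_le (n := ∞) one_le_infty
  have : CompleteSpace E := FiniteDimensional.complete ℝ E
  have hX1 : ContMDiff 𝓘(ℝ, E) 𝓘(ℝ, E).tangent 1
    (fun x => (⟨x, X x⟩ : TangentBundle 𝓘(ℝ, E) M)) := ContMDiff.of_le hX one_le_infty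
  obtain ⟨ζ, hζ0, hζ⟩ := exists_isMIntegralCurveAt_of_contMDiffAt_boundaryless a
    (hX1.contMDiffAt (x := γ a))
  obtain ⟨ε, hε, hζ'⟩ := isMIntegralCurveAt_iff'.1 hζ
  rw [Real.ball_eq_Ioo] at hζ'
  have glue : ∀ η : ℝ → M, IsMIntegralCurveOn η X (Icc a b) → ζ a = η a →
      IsMIntegralCurveOn (fun t => if t ≤ a then ζ t else η t) X (Ioo (a - ε) b) := by
    classical
    intro η hη hζη t ht
    set θ : ℝ → M := fun t => if t ≤ a then ζ t else η t with hθ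
    have e1 : ∀ t, t ≤ a → θ t = ζ t := fun t ht => if_pos ht
    have e2 : ∀ t, a ≤ t → θ t = η t := fun t ht => by
      rcases ht.eq_or_lt with rfl | h
      · rw [e1 _ le_rfl, hζη]
      · exact if_neg h.not_ge
    have d1 : ∀ t ∈ Ioc (a - ε) a, HasMFDerivWithinAt 𝓘(ℝ, ℝ) 𝓘(ℝ, E) θ (Ioc (a - ε) a) t
        ((1 : ℝ →L[ℝ] ℝ).smulRight (X (θ t))) := by
      intro t ht
      have h1 := (hζ' t ⟨ht.1, ht.2.trans_lt (by linarith)⟩).mono (s := Ioc (a - ε) a)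
        fun s hs => ⟨hs.1, hs.2.trans_lt (by linarith)⟩
      have h2 := h1.congr_of_eventuallyEq
        (eventually_mem_nhdsWithin.mono fun s hs => e1 s hs.2) (e1 t ht.2)
      rw [e1 t ht.2]
      exact h2
    have d2 : ∀ t ∈ Ico a b, HasMFDerivWithinAt 𝓘(ℝ, ℝ) 𝓘(ℝ, E) θ (Ico a b) t
        ((1 : ℝ →L[ℝ] ℝ).smulRight (X (θ t))) := by
      intro t ht
      have h1 := (hη t ⟨ht.1, ht.2.le⟩).mono (s := Ico a b) Ico_subset_Icc_self
      have h2 := h1.congr_of_eventuallyEq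
        (eventually_mem_nhdsWithin.mono fun s hs => e2 s hs.1) (e2 t ht.1)
      rw [e2 t ht.1]
      exact h2
    rcases lt_trichotomy t a with hta | rfl | hta
    · exact ((d1 t ⟨ht.1, hta.le⟩).hasMFDerivAt
        (mem_of_superset (Ioo_mem_nhds ht.1 hta) Ioo_subset_Ioc_self)).hasMFDerivWithinAt
    · refine ((d1 t ⟨ht.1, le_rfl⟩).union (d2 t ⟨le_rfl, hab⟩)).mono ?_
      rw [Ioc_union_Ico_eq_Ioo ht.1 ht.2]
    · exact ((d2 t ⟨hta.le, ht.2⟩).hasMFDerivAt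
        (mem_of_superset (Ioo_mem_nhds hta ht.2) Ioo_subset_Ico_self)).hasMFDerivWithinAt
  have key := isMIntegralCurveOn_Ioo_eqOn_of_contMDiff_boundaryless (t₀ := a)
    (⟨by linarith, hab⟩ : a ∈ Ioo (a - ε) b) hX1 (glue γ hγ hζ0) (glue γ' hγ' (hζ0.trans h))
    (by simp)
  have hIco : EqOn γ γ' (Ico a b) := by
    intro t ht
    rcases ht.1.eq_or_lt with rfl | hat
    · exact h
    · have := key (⟨by linarith, ht.2⟩ : t ∈ Ioo (a - ε) b)
      simpa only [if_neg hat.not_ge] using this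
  have := hIco.of_subset_closure hγ.continuousOn hγ'.continuousOn Ico_subset_Icc_self
    (by rw [closure_Ico hab.ne])
  exact this

omit [FiniteDimensional ℝ E] [IsManifold 𝓘(ℝ, E) ∞ M] in
lemma isMIntegralCurveOn_comp_neg {γ : ℝ → M} {a b : ℝ}
    (hγ : IsMIntegralCurveOn γ X (Icc a b)) :
    IsMIntegralCurveOn (fun t => γ (-t)) (fun x => - X x) (Icc (-b) (-a)) := by
  have h := hγ.comp_mul (-1)
  have e : {t | t * (-1 : ℝ) ∈ Icc a b} = Icc (-b) (-a) := by
    ext t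
    simp only [mem_ofPred_eq, mem_Icc]
    constructor <;> rintro ⟨h1, h2⟩ <;> constructor <;> linarith
  rw [e] at h
  have e2 : (γ ∘ fun t => t * (-1 : ℝ)) = fun t => γ (-t) := by
    funext t; simp
  have e3 : ((-1 : ℝ) • X : VField E M) = fun x => - X x := by
    funext x; exact neg_one_smul ℝ (X x)
  rw [e2, e3] at h
  exact h

lemma IsSmoothField.eqOn_Icc_right (hX : IsSmoothField X) {γ γ' : ℝ → M} {a b : ℝ}
    (hγ : IsMIntegralCurveOn γ X (Icc a b)) (hγ' : IsMIntegralCurveOn γ' X (Icc a b))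
    (h : γ b = γ' b) : EqOn γ γ' (Icc a b) := by
  intro t ht
  have := hX.neg.eqOn_Icc_left (isMIntegralCurveOn_comp_neg hγ)
    (isMIntegralCurveOn_comp_neg hγ') (by simpa using h)
    (⟨by linarith [ht.2], by linarith [ht.1]⟩ : -t ∈ Icc (-b) (-a))
  simpa using this

lemma IsTrajectory.unique (hX : IsSmoothField X) {t : ℝ} {x : M} {γ γ' : ℝ → M}
    (h : IsTrajectory X t x γ) (h' : IsTrajectory X t x γ') : γ t = γ' t := by
  obtain ⟨h1, h2⟩ := h
  obtain ⟨h1', h2'⟩ := h'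
  rcases le_total 0 t with ht | ht
  · rw [uIcc_of_le ht] at h2 h2'
    exact hX.eqOn_Icc_left h2 h2' (h1.trans h1'.symm) ⟨ht, le_rfl⟩
  · rw [uIcc_of_ge ht] at h2 h2'
    exact hX.eqOn_Icc_right h2 h2' (h1.trans h1'.symm) ⟨le_rfl, ht⟩

lemma IsTrajectory.flow_eq (hX : IsSmoothField X) {t : ℝ} {x : M} {γ : ℝ → M}
    (h : IsTrajectory X t x γ) : flow X t x = γ t := by
  have hd : FlowDefinedAt X t x := ⟨γ, h⟩
  rw [flow, dif_pos hd]
  exact hd.choose_spec.unique hX h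

omit [FiniteDimensional ℝ E] [IsManifold 𝓘(ℝ, E) ∞ M] in
lemma IsTrajectory.reverse {t : ℝ} {x : M} {γ : ℝ → M}
    (h : IsTrajectory X t x γ) : IsTrajectory X (-t) (γ t) (fun s => γ (s + t)) := by
  refine ⟨by simp, ?_⟩
  have h1 := h.2.comp_add t
  refine h1.mono fun s hs => ?_
  change s + t ∈ uIcc 0 t
  rcases le_total 0 t with ht | ht
  · rw [uIcc_of_ge (by linarith)] at hs
    rw [uIcc_of_le ht]
    exact ⟨by linarith [hs.1], by linarith [hs.2]⟩
  · rw [uIcc_of_le (by linarith)] at hs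
    rw [uIcc_of_ge ht]
    exact ⟨by linarith [hs.1], by linarith [hs.2]⟩

lemma flow_neg_flow (hX : IsSmoothField X) {t : ℝ} {x : M} (h : FlowDefinedAt X t x) :
    flow X (-t) (flow X t x) = x := by
  obtain ⟨γ, hγ⟩ := h
  rw [hγ.flow_eq hX, hγ.reverse.flow_eq hX]
  simpa using hγ.1

/-- The conjugate of `φ` by the flow, read at the endpoint of a trajectory. -/
lemma flowConj_flow (hX : IsSmoothField X) {φ : M ≃ₜ M} {t : ℝ}
    {x : M} (hx : FlowDefinedAt X t x) :
    flowConj X φ t (flow X t x) = flow X t (φ x) := by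
  unfold flowConj
  split_ifs with h
  · rw [flow_neg_flow hX hx]
  · rw [eq_self_of_notMem_homeoSupport (φ := φ) fun h' => h ⟨x, h', rfl⟩]

omit [FiniteDimensional ℝ E] [IsManifold 𝓘(ℝ, E) ∞ M] in
lemma flowConj_eq_self {φ : M ≃ₜ M} {t : ℝ} {D : Set M} (hD : homeoSupport φ ⊆ D) {y : M}
    (hy : y ∉ flow X t '' D) : flowConj X φ t y = y :=
  if_neg fun h => hy (image_mono hD h)

lemma flowConj_mul (hX : IsSmoothField X) {φ ψ : M ≃ₜ M} {t : ℝ}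
    (hφ : ∀ x ∈ homeoSupport φ, FlowDefinedAt X t x)
    (hψ : ∀ x ∈ homeoSupport ψ, FlowDefinedAt X t x)
    (hsub : homeoSupport (φ * ψ : M ≃ₜ M) ⊆ homeoSupport φ ∪ homeoSupport ψ) (y : M) :
    flowConj X (φ * ψ) t y = flowConj X φ t (flowConj X ψ t y) := by
  have hD : ∀ x ∈ homeoSupport φ ∪ homeoSupport ψ, FlowDefinedAt X t x :=
    fun x hx => hx.elim (hφ x) (hψ x)
  by_cases hy : y ∈ flow X t '' (homeoSupport φ ∪ homeoSupport ψ)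
  · obtain ⟨x, hx, rfl⟩ := hy
    have hψx := mapsTo_of_homeoSupport_subset ψ subset_union_right hx
    rw [flowConj_flow hX (hD x hx), flowConj_flow hX (hD x hx),
      flowConj_flow hX (hD _ hψx)]
    rfl
  · rw [flowConj_eq_self hsub hy, flowConj_eq_self subset_union_right hy,
      flowConj_eq_self subset_union_left hy]

omit [FiniteDimensional ℝ E] [IsManifold 𝓘(ℝ, E) ∞ M] in
lemma homeoSupport_one : homeoSupport (1 : M ≃ₜ M) = ∅ :=
  subset_empty_iff.1 (homeoSupport_subset isClosed_empty fun _ _ => rfl)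

omit [FiniteDimensional ℝ E] [IsManifold 𝓘(ℝ, E) ∞ M] in
lemma flowConj_one (t : ℝ) (y : M) : flowConj X (1 : M ≃ₜ M) t y = y :=
  flowConj_eq_self (D := ∅) homeoSupport_one.subset (by simp)

variable {Ω : DiffForm E M 2}

omit [FiniteDimensional ℝ E] [IsManifold 𝓘(ℝ, E) ∞ M] in
lemma one_mem_G3 (Ω : DiffForm E M 2) (X : VField E M) : (1 : M ≃ₜ M) ∈ G3 Ω X := by
  refine ⟨(symplecticApprox_one Ω).isSymplecticHomeo, by rw [homeoSupport_one]; exact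
      isCompact_empty,
    1, one_pos, by simp [homeoSupport_one], ?_⟩
  exact ((hamiltonianApprox_id Ω one_pos).congr_limit fun t _ x =>
    flowConj_one t x).isC0HamiltonianIsotopy

lemma mul_mem_G3 (hΩ : IsSymplecticForm Ω) (hX : IsSmoothField X) {φ ψ : M ≃ₜ M}
    (hφ : φ ∈ G3 Ω X) (hψ : ψ ∈ G3 Ω X) : φ * ψ ∈ G3 Ω X := by
  obtain ⟨h1, h2, δ, hδ, h3, h4⟩ := hφ
  obtain ⟨h1', h2', δ', hδ', h3', h4'⟩ := hψ
  obtain ⟨L, f, hf⟩ := h1.exists_approx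
  obtain ⟨L', f', hf'⟩ := h1'.exists_approx
  obtain ⟨_, S, K, Φ, k, hΦ⟩ := h4.exists_approx hΩ hδ
  obtain ⟨_, S', K', Φ', k', hΦ'⟩ := h4'.exists_approx hΩ hδ'
  obtain ⟨hc, hsub⟩ := isCompact_homeoSupport_mul h2 h2'
  have hη : 0 < min δ δ' := lt_min hδ hδ'
  have hd : ∀ t ∈ Icc 0 (min δ δ'), ∀ x ∈ homeoSupport φ, FlowDefinedAt X t x := fun t ht =>
    h3 t ⟨ht.1, ht.2.trans (min_le_left _ _)⟩
  have hd' : ∀ t ∈ Icc 0 (min δ δ'), ∀ x ∈ homeoSupport ψ, FlowDefinedAt X t x := fun t ht =>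
    h3' t ⟨ht.1, ht.2.trans (min_le_right _ _)⟩
  refine ⟨(hf.mul hf').isSymplecticHomeo, hc, min δ δ', hη,
    fun t ht x hx => (hsub hx).elim (hd t ht x) (hd' t ht x), ?_⟩
  have := (hΦ.mono hη (min_le_left _ _)).comp hη
    ((hΦ'.mono hη (min_le_right _ _)).conj hη hf)
  refine (this.congr_limit fun t ht x => ?_).isC0HamiltonianIsotopy
  -- `[μ_t, φψ] = [μ_t, φ] ∘ φ [μ_t, ψ] φ⁻¹`
  change flowConj X (φ * ψ) t (ψ.symm (φ.symm x)) =
    flowConj X φ t (φ.symm (φ (flowConj X ψ t (ψ.symm (φ.symm x)))))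
  rw [φ.symm_apply_apply, flowConj_mul hX (hd t ht) (hd' t ht) hsub]

lemma inv_mem_G3 (hΩ : IsSymplecticForm Ω) (hX : IsSmoothField X) {φ : M ≃ₜ M}
    (hφ : φ ∈ G3 Ω X) : φ⁻¹ ∈ G3 Ω X := by
  obtain ⟨h1, h2, δ, hδ, h3, h4⟩ := hφ
  obtain ⟨L, f, hf⟩ := h1.exists_approx
  obtain ⟨ψ, S, K, Φ, k, hΦ⟩ := h4.exists_approx hΩ hδ
  have hsupp : homeoSupport (φ⁻¹ : M ≃ₜ M) = homeoSupport φ := homeoSupport_symm φ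
  refine ⟨hf.inv.isSymplecticHomeo, by rwa [hsupp], δ, hδ, by rwa [hsupp], ?_⟩
  refine (((hΦ.inv hδ).conj hδ hf.inv).congr_limit fun t ht x => ?_).isC0HamiltonianIsotopy
  -- `[μ_t, φ⁻¹] = φ⁻¹ [μ_t, φ]⁻¹ φ`
  change flowConj X φ⁻¹ t (φ x) = φ.symm (ψ t (φ x))
  have h := hΦ.right_inv t ht (φ x)
  change flowConj X φ t (φ.symm (ψ t (φ x))) = φ x at h
  conv_lhs => rw [← h]
  rw [← flowConj_mul hX (by rw [hsupp]; exact h3 t ht) (h3 t ht) ?_, inv_mul_cancel, flowConj_one]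
  rw [inv_mul_cancel, homeoSupport_one]
  exact empty_subset _

/-- `G₃` as a subgroup of the group of homeomorphisms. -/
def subgroupG3 (hΩ : IsSymplecticForm Ω) (hX : IsSmoothField X) : Subgroup (M ≃ₜ M) where
  carrier := G3 Ω X
  one_mem' := one_mem_G3 Ω X
  mul_mem' := mul_mem_G3 hΩ hX
  inv_mem' := inv_mem_G3 hΩ hX

end LocalFlow



/-! ### Smooth dependence of solutions on initial values -/

section Superposition

universe u

variable {K : Type*} [TopologicalSpace K] [CompactSpace K]

/-- Pointwise application of linear maps to vectors, as a continuous bilinear map between spaces of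
continuous functions. -/
def pointwiseApply (K : Type*) [TopologicalSpace K] [CompactSpace K] (E F : Type*)
    [NormedAddCommGroup E] [NormedSpace ℝ E] [NormedAddCommGroup F] [NormedSpace ℝ F] :
    C(K, E →L[ℝ] F) →L[ℝ] C(K, E) →L[ℝ] C(K, F) :=
  LinearMap.mkContinuous₂
    (LinearMap.mk₂ ℝ (fun (A : C(K, E →L[ℝ] F)) (v : C(K, E)) =>
        (⟨fun s => A s (v s), A.continuous.clm_apply v.continuous⟩ : C(K, F)))
      (fun A B v => by ext s; rfl) (fun c A v => by ext s; rfl)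
      (fun A v w => by ext s; exact map_add (A s) (v s) (w s))
      (fun c A v => by ext s; exact map_smul (A s) c (v s)))
    1 fun A v => by
      rw [one_mul]
      refine (ContinuousMap.norm_le _ (by positivity)).2 fun s => ?_
      exact ((A s).le_opNorm _).trans (mul_le_mul (A.norm_coe_le_norm s) (v.norm_coe_le_norm s)
        (norm_nonneg (v s)) (norm_nonneg (E := C(K, E →L[ℝ] F)) A))

/-- The superposition operator `γ ↦ f ∘ γ` on spaces of continuous functions. -/
def superposition {E F : Type*} [TopologicalSpace E] [TopologicalSpace F] {f : E → F}
    (hf : Continuous f) (γ : C(K, E)) : C(K, F) := ⟨fun s => f (γ s), hf.comp γ.continuous⟩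

omit [CompactSpace K] in
lemma continuous_superposition {E F : Type*} [TopologicalSpace E] [TopologicalSpace F] {f : E → F}
    (hf : Continuous f) : Continuous (superposition (K := K) hf) :=
  ContinuousMap.continuous_postcomp ⟨f, hf⟩

lemma hasFDerivAt_superposition {E F : Type*} [NormedAddCommGroup E] [NormedSpace ℝ E]
    [NormedAddCommGroup F] [NormedSpace ℝ F] {f : E → F} {f' : E → E →L[ℝ] F}
    (hf : ∀ x, HasFDerivAt f (f' x) x) (hc : Continuous f) (hc' : Continuous f') (γ : C(K, E)) :
    HasFDerivAt (superposition (K := K) hc)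
      (pointwiseApply K E F (superposition hc' γ)) γ := by
  rw [hasFDerivAt_iff_isLittleO_nhds_zero, Asymptotics.isLittleO_iff]
  intro ε hε
  have h0 : ContinuousAt (superposition (K := K) hc') γ :=
    (continuous_superposition hc').continuousAt
  obtain ⟨η, hη, h1⟩ := (Metric.continuousAt_iff (α := C(K, E)) (β := C(K, E →L[ℝ] F))).1 h0 ε hε
  filter_upwards [Metric.ball_mem_nhds (0 : C(K, E)) hη] with h hh
  rw [mem_ball_zero_iff] at hh
  refine (ContinuousMap.norm_le _ (by positivity)).2 fun s => ?_
  change ‖f (γ s + h s) - f (γ s) - f' (γ s) (h s)‖ ≤ _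
  have h2 : ∀ z ∈ segment ℝ (γ s) (γ s + h s), ‖f' z - f' (γ s)‖ ≤ ε := by
    intro z hz
    rw [segment_eq_image'] at hz
    obtain ⟨θ, hθ, rfl⟩ := hz
    have h3 : dist (γ + θ • h) γ < η := by
      rw [dist_eq_norm, add_sub_cancel_left, norm_smul, Real.norm_of_nonneg hθ.1]
      exact (mul_le_of_le_one_left (norm_nonneg _) hθ.2).trans_lt hh
    have h4 := (ContinuousMap.dist_apply_le_dist s).trans_lt (h1 h3)
    rw [dist_eq_norm] at h4
    change ‖f' (γ s + θ • h s) - f' (γ s)‖ < ε at h4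
    simpa using h4.le
  have h5 := (convex_segment (γ s) (γ s + h s)).norm_image_sub_le_of_norm_hasFDerivWithin_le'
    (𝕜 := ℝ) (f := f) (fun z _ => (hf z).hasFDerivWithinAt) h2 (left_mem_segment ℝ _ _)
    (right_mem_segment ℝ _ _)
  rw [add_sub_cancel_left] at h5
  exact h5.trans (mul_le_mul_of_nonneg_left (h.norm_coe_le_norm s) hε.le)

/-- The superposition operator of a smooth map is smooth: its derivative is expressed by the
superposition operator of the derivative. -/
theorem contDiff_superposition {E : Type u} [NormedAddCommGroup E] [NormedSpace ℝ E] (n : ℕ) :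
    ∀ {F : Type u} [NormedAddCommGroup F] [NormedSpace ℝ F] {f : E → F} (hf : ContDiff ℝ ∞ f),
      ContDiff ℝ n (superposition (K := K) hf.continuous) := by
  induction n with
  | zero =>
    intro F _ _ f hf
    exact contDiff_zero.2 (continuous_superposition hf.continuous)
  | succ n ih =>
    intro F _ _ f hf
    have hf' : ContDiff ℝ ∞ (fderiv ℝ f) := (contDiff_infty_iff_fderiv.1 hf).2
    rw [Nat.cast_succ, contDiff_succ_iff_hasFDerivAt]
    refine ⟨_, (pointwiseApply K E F).contDiff.comp (ih hf'), fun γ => ?_⟩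
    exact hasFDerivAt_superposition
      (fun x => ((hf.differentiable (by simp)) x).hasFDerivAt) _ _ γ

end Superposition

section LocalSolution

variable {E : Type*} [NormedAddCommGroup E] [NormedSpace ℝ E] [CompleteSpace E]

/-- The primitive vanishing at `0`, as an operator on continuous functions on `[0, 1]`. -/
def primitive (E : Type*) [NormedAddCommGroup E] [NormedSpace ℝ E] [CompleteSpace E] :
    C(Icc (0 : ℝ) 1, E) →L[ℝ] C(Icc (0 : ℝ) 1, E) :=
  LinearMap.mkContinuous
    { toFun := fun η => ⟨fun s => ∫ r in (0 : ℝ)..s, η (projIcc 0 1 zero_le_one r), by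
        have : Continuous fun s : ℝ => ∫ r in (0 : ℝ)..s, η (projIcc 0 1 zero_le_one r) :=
          intervalIntegral.continuous_primitive (fun a b =>
            (η.continuous.comp continuous_projIcc).intervalIntegrable a b) 0
        exact this.comp continuous_subtype_val⟩
      map_add' := fun η θ => by
        ext s
        exact intervalIntegral.integral_add
          ((η.continuous.comp continuous_projIcc).intervalIntegrable _ _)
          ((θ.continuous.comp continuous_projIcc).intervalIntegrable _ _)
      map_smul' := fun c η => by
        ext s
        exact intervalIntegral.integral_smul c _ }
    1 fun η => by
      rw [one_mul]
      refine (ContinuousMap.norm_le _ (by positivity)).2 fun s => ?_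
      have h1 := intervalIntegral.norm_integral_le_of_norm_le_const (a := 0) (b := (s : ℝ))
        (f := fun r => η (projIcc 0 1 zero_le_one r)) (C := ‖η‖)
        fun r _ => η.norm_coe_le_norm _
      refine h1.trans (mul_le_of_le_one_right (norm_nonneg _) ?_)
      rw [sub_zero, abs_of_nonneg s.2.1]
      exact s.2.2

lemma hasDerivAt_primitive (η : C(Icc (0 : ℝ) 1, E)) (s : ℝ) :
    HasDerivAt (fun s => ∫ r in (0 : ℝ)..s, η (projIcc 0 1 zero_le_one r))
      (η (projIcc 0 1 zero_le_one s)) s := by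
  have h : Continuous fun r : ℝ => η (projIcc 0 1 zero_le_one r) :=
    η.continuous.comp continuous_projIcc
  exact intervalIntegral.integral_hasDerivAt_right (h.intervalIntegrable _ _)
    (h.stronglyMeasurableAtFilter _ _) h.continuousAt

/-- Solutions on `[0, 1]` of `γ' = t f(γ)`, `γ 0 = x`, depending on `(t, x)` near `(0, x₀)` in a `Cⁿ`
way: the implicit function theorem, applied to the integral equation. -/
theorem exists_contDiffAt_solution {f : E → E} (hf : ContDiff ℝ ∞ f) (x₀ : E) {n : ℕ}
    (hn : n ≠ 0) :
    ∃ Γ : ℝ × E → C(Icc (0 : ℝ) 1, E), ContDiffAt ℝ n Γ (0, x₀) ∧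
      Γ (0, x₀) = ContinuousMap.const _ x₀ ∧
      ∀ᶠ p in 𝓝 ((0 : ℝ), x₀), ∀ s, Γ p s =
        p.2 + p.1 • ∫ r in (0 : ℝ)..s, f (Γ p (projIcc 0 1 zero_le_one r)) := by
  let C := C(Icc (0 : ℝ) 1, E)
  let cst : E →L[ℝ] C := ContinuousLinearMap.const ℝ (Icc (0 : ℝ) 1)
  let N : C → C := superposition hf.continuous
  have hN : ContDiff ℝ n N := contDiff_superposition n hf
  let G : (ℝ × E) × C → C := fun q => q.2 - cst q.1.2 - q.1.1 • primitive E (N q.2)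
  have hG : ContDiff ℝ n G :=
    (contDiff_snd.sub (cst.contDiff.comp (contDiff_snd.comp contDiff_fst))).sub
      ((contDiff_fst.comp contDiff_fst).smul ((primitive E).contDiff.comp (hN.comp contDiff_snd)))
  have hn' : ((n : ℕ) : WithTop ℕ∞) ≠ 0 := by exact_mod_cast hn
  let u : (ℝ × E) × C := ((0, x₀), cst x₀)
  have hGd : HasFDerivAt G (fderiv ℝ G u) u :=
    ((hG.differentiable hn') u).hasFDerivAt
  have hpart : fderiv ℝ G u ∘L .inr ℝ (ℝ × E) C = ContinuousLinearMap.id ℝ C := by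
    have h1 : HasFDerivAt (fun c : C => G ((0, x₀), c))
        (fderiv ℝ G u ∘L .inr ℝ (ℝ × E) C) (cst x₀) :=
      HasFDerivAt.comp (cst x₀) hGd (hasFDerivAt_prodMk_right _ _)
    have h2 : (fun c : C => G ((0, x₀), c)) = fun c => c - cst x₀ := by
      funext c
      simp [G]
    rw [h2] at h1
    exact h1.unique ((hasFDerivAt_id _).sub_const _)
  have hinv : (fderiv ℝ G u ∘L .inr ℝ (ℝ × E) C).IsInvertible := by
    rw [hpart]
    exact ⟨ContinuousLinearEquiv.refl ℝ C, rfl⟩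
  have hGu : G u = 0 := by simp [G, u]
  refine ⟨hG.contDiffAt.implicitFunction hn' hinv,
    hG.contDiffAt.contDiffAt_implicitFunction hn' hinv,
    hG.contDiffAt.implicitFunction_apply_self hn' hinv, ?_⟩
  filter_upwards [hG.contDiffAt.eventually_apply_implicitFunction hn' hinv] with p hp s
  rw [hGu] at hp
  have h3 := DFunLike.congr_fun hp s
  have h4 : (hG.contDiffAt.implicitFunction hn' hinv p) s - p.2 -
    p.1 • ∫ r in (0 : ℝ)..s, f (hG.contDiffAt.implicitFunction hn' hinv p
      (projIcc 0 1 zero_le_one r)) = 0 := h3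
  rw [sub_sub, sub_eq_zero] at h4
  exact h4

end LocalSolution



/-! ### Flows of compactly supported vector fields -/

section SmoothFlow

variable {E : Type*} [NormedAddCommGroup E] [NormedSpace ℝ E] [FiniteDimensional ℝ E]
  {M : Type*} [MetricSpace M] [ChartedSpace E M] [IsManifold 𝓘(ℝ, E) ∞ M] {X : VField E M}

omit [FiniteDimensional ℝ E] in
lemma IsSmoothField.contDiffOn_chart (hX : IsSmoothField X) (x₀ : M) :
    ContDiffOn ℝ ∞ (fun y => tderiv E E (extChartAt 𝓘(ℝ, E) x₀) ((extChartAt 𝓘(ℝ, E) x₀).symm y)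
      (X ((extChartAt 𝓘(ℝ, E) x₀).symm y))) (extChartAt 𝓘(ℝ, E) x₀).target := by
  have h1 : ContMDiffOn 𝓘(ℝ, E) 𝓘(ℝ, E) ∞ (extChartAt 𝓘(ℝ, E) x₀)
      (extChartAt 𝓘(ℝ, E) x₀).source := fun x hx => (contMDiffAt_chart hx).contMDiffWithinAt
  have hopen := isOpen_extChartAt_source (I := 𝓘(ℝ, E)) x₀
  have h2 := h1.contMDiffOn_tangentMapWithin (m := ∞) (by simp) hopen.uniqueMDiffOn
  have h3 := (contMDiff_snd_tangentBundle_modelSpace (n := ∞) E 𝓘(ℝ, E)).comp_contMDiffOn h2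
  have h4 : ContMDiffOn 𝓘(ℝ, E) 𝓘(ℝ, E).tangent ∞
      (fun y => (⟨(extChartAt 𝓘(ℝ, E) x₀).symm y, X ((extChartAt 𝓘(ℝ, E) x₀).symm y)⟩ :
        TangentBundle 𝓘(ℝ, E) M)) (extChartAt 𝓘(ℝ, E) x₀).target :=
    ContMDiff.comp_contMDiffOn hX (contMDiffOn_extChartAt_symm x₀)
  have h5 := (h3.comp h4 fun y hy => (extChartAt 𝓘(ℝ, E) x₀).map_target hy).contDiffOn
  refine h5.congr fun y hy => ?_
  have hy' := (extChartAt 𝓘(ℝ, E) x₀).map_target hy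
  change tderiv E E (extChartAt 𝓘(ℝ, E) x₀) ((extChartAt 𝓘(ℝ, E) x₀).symm y)
      (X ((extChartAt 𝓘(ℝ, E) x₀).symm y)) = mfderivWithin 𝓘(ℝ, E) 𝓘(ℝ, E) _
      (extChartAt 𝓘(ℝ, E) x₀).source ((extChartAt 𝓘(ℝ, E) x₀).symm y)
      (X ((extChartAt 𝓘(ℝ, E) x₀).symm y))
  rw [mfderivWithin_of_isOpen hopen hy']
  rfl

/-- Near the center of a chart, a smooth vector field is represented by a bounded smooth vector
field on the whole model space. -/
lemma IsSmoothField.exists_chart_field (hX : IsSmoothField X) (x₀ : M) :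
    ∃ (f : E → E) (r C : ℝ), 0 < r ∧ ContDiff ℝ ∞ f ∧ (∀ y, ‖f y‖ ≤ C) ∧
      Metric.ball (extChartAt 𝓘(ℝ, E) x₀ x₀) r ⊆ (extChartAt 𝓘(ℝ, E) x₀).target ∧
      ∀ y ∈ Metric.ball (extChartAt 𝓘(ℝ, E) x₀ x₀) r,
        f y = tderiv E E (extChartAt 𝓘(ℝ, E) x₀) ((extChartAt 𝓘(ℝ, E) x₀).symm y)
          (X ((extChartAt 𝓘(ℝ, E) x₀).symm y)) := by
  set ψ := extChartAt 𝓘(ℝ, E) x₀ with hψ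
  have ht : ψ.target ∈ 𝓝 (ψ x₀) := extChartAt_target_mem_nhds (I := 𝓘(ℝ, E)) x₀
  obtain ⟨R, hR, hRt⟩ := Metric.nhds_basis_closedBall.mem_iff.1 ht
  let χ : ContDiffBump (ψ x₀) := ⟨R / 2, R, half_pos hR, half_lt_self hR⟩
  let g : E → E := fun y => tderiv E E ψ (ψ.symm y) (X (ψ.symm y))
  have hg : ContDiffOn ℝ ∞ g ψ.target := hX.contDiffOn_chart x₀
  have hf : ContDiff ℝ ∞ fun y => χ y • g y := by
    refine contDiff_iff_contDiffAt.2 fun y => ?_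
    by_cases hy : y ∈ ψ.target
    · exact χ.contDiffAt.smul (hg.contDiffAt ((isOpen_extChartAt_target x₀).mem_nhds hy))
    · have h0 : (fun y => χ y • g y) =ᶠ[𝓝 y] fun _ => 0 := by
        have hy' : y ∈ (Metric.closedBall (ψ x₀) R)ᶜ := fun h => hy (hRt h)
        filter_upwards [Metric.isClosed_closedBall.isOpen_compl.mem_nhds hy'] with z hz
        rw [χ.zero_of_le_dist (not_le.1 fun h => hz h).le, zero_smul]
      exact contDiffAt_const.congr_of_eventuallyEq h0
  have hcs : HasCompactSupport fun y => χ y • g y := χ.hasCompactSupport.smul_right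
  obtain ⟨C, hC⟩ := hcs.exists_bound_of_continuous hf.continuous
  refine ⟨_, R / 2, C, half_pos hR, hf, hC,
    (Metric.ball_subset_closedBall.trans (Metric.closedBall_subset_closedBall
        (half_le_self hR.le))).trans hRt,
    fun y hy => ?_⟩
  rw [χ.one_of_mem_closedBall (Metric.ball_subset_closedBall hy), one_smul]

omit [FiniteDimensional ℝ E] in
lemma hasVelocityWithin_chart_symm {x₀ : M} {c : ℝ → E} {s : Set ℝ} {τ a : ℝ} {v : E}
    (hc : HasDerivWithinAt c (a • tderiv E E (extChartAt 𝓘(ℝ, E) x₀)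
      ((extChartAt 𝓘(ℝ, E) x₀).symm (c τ)) v) s τ)
    (h : c τ ∈ (extChartAt 𝓘(ℝ, E) x₀).target) :
    HasVelocityWithin (fun τ => (extChartAt 𝓘(ℝ, E) x₀).symm (c τ)) s τ (a • v) := by
  have h1 : HasVelocityWithin c s τ (a • tderiv E E (extChartAt 𝓘(ℝ, E) x₀)
      ((extChartAt 𝓘(ℝ, E) x₀).symm (c τ)) v) := by
    exact hc.hasFDerivWithinAt.hasMFDerivWithinAt
  have h2 := h1.comp_mdifferentiableAt (mdifferentiableAt_chart_symm h)
  have h3 := tderiv_chart_symm_chart ((extChartAt 𝓘(ℝ, E) x₀).map_target h) v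
  rw [(extChartAt 𝓘(ℝ, E) x₀).right_inv h] at h3
  rw [map_smul, h3] at h2
  exact h2

/-- Integral curves exist near `x₀` for a common time. -/
lemma IsSmoothField.exists_uniform_time (hX : IsSmoothField X) (x₀ : M) :
    ∃ ε > 0, ∀ᶠ x in 𝓝 x₀, ∃ γ : ℝ → M, γ 0 = x ∧ IsMIntegralCurveOn γ X (Ioo (-ε) ε) := by
  have : CompleteSpace E := FiniteDimensional.complete ℝ E
  obtain ⟨f, r, C, hr, hf, hC, hball, hfX⟩ := hX.exists_chart_field x₀
  set ψ := extChartAt 𝓘(ℝ, E) x₀ with hψ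
  obtain ⟨ρ, hρ, ε, hε, h⟩ :=
      ContDiffAt.exists_forall_mem_closedBall_exists_eq_forall_mem_Ioo_hasDerivAt
    ((hf.of_le one_le_infty).contDiffAt (x := ψ x₀)) 0
  have hC0 : 0 ≤ C := (norm_nonneg _).trans (hC 0)
  have hη : 0 < min ε (r / 2 / (C + 1)) := lt_min hε (by positivity)
  refine ⟨min ε (r / 2 / (C + 1)), hη, ?_⟩
  have hcont : ContinuousAt ψ x₀ := continuousAt_extChartAt x₀
  filter_upwards [hcont (Metric.closedBall_mem_nhds _ hρ), hcont (Metric.ball_mem_nhds _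
      (half_pos hr)),
    extChartAt_source_mem_nhds (I := 𝓘(ℝ, E)) x₀] with x h1 h2 h3
  obtain ⟨c, hc0, hc⟩ := h (ψ x) h1
  refine ⟨fun τ => ψ.symm (c τ), by simp only [hc0]; exact ψ.left_inv h3, fun τ hτ => ?_⟩
  have hsub : Ioo (-(min ε (r / 2 / (C + 1)))) (min ε (r / 2 / (C + 1))) ⊆ Ioo (0 - ε) (0 + ε) := by
    rw [zero_sub, zero_add]
    exact Ioo_subset_Ioo (neg_le_neg (min_le_left _ _)) (min_le_left _ _)
  have hbound : ‖c τ - c 0‖ ≤ C * ‖τ - 0‖ :=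
    (convex_Ioo _ _).norm_image_sub_le_of_norm_hasDerivWithin_le
      (fun s hs => (hc s (hsub hs)).hasDerivWithinAt) (fun s _ => hC _)
      (by simpa using hη) hτ
  have hmem : c τ ∈ Metric.ball (ψ x₀) r := by
    have h4 : |τ| < r / 2 / (C + 1) := (abs_lt.2 hτ).trans_le (min_le_right _ _)
    rw [lt_div_iff₀ (by positivity)] at h4
    rw [sub_zero, Real.norm_eq_abs, hc0] at hbound
    have h5 : dist (c τ) (ψ x) < r / 2 := by
      rw [dist_eq_norm]
      nlinarith [abs_nonneg τ]
    have h6 := dist_triangle (c τ) (ψ x) (ψ x₀)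
    have h7 : dist (ψ x) (ψ x₀) < r / 2 := h2
    rw [Metric.mem_ball]
    linarith
  have h8 := (hc τ (hsub hτ)).hasDerivWithinAt
    (s := Ioo (-(min ε (r / 2 / (C + 1)))) (min ε (r / 2 / (C + 1))))
  rw [hfX _ hmem] at h8
  let W : M → E := X
  have h9 : HasVelocityWithin (fun τ => ψ.symm (c τ))
      (Ioo (-(min ε (r / 2 / (C + 1)))) (min ε (r / 2 / (C + 1)))) τ
      ((1 : ℝ) • W (ψ.symm (c τ))) :=
    hasVelocityWithin_chart_symm (h8.congr_deriv (one_smul ℝ _).symm) (hball hmem)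
  rw [one_smul] at h9
  exact h9

/-- A smooth vector field with compact support has global integral curves. -/
lemma IsSmoothField.exists_isMIntegralCurve (hX : IsSmoothField X) {S : Set M} (hS : IsCompact S)
    (hXS : ∀ x, x ∉ S → X x = 0) (x : M) : ∃ γ : ℝ → M, γ 0 = x ∧ IsMIntegralCurve γ X := by
  have : IsManifold 𝓘(ℝ, E) 1 M := IsManifold.of_le (n := ∞) one_le_infty
  have hX1 : ContMDiff 𝓘(ℝ, E) 𝓘(ℝ, E).tangent 1
    (fun x => (⟨x, X x⟩ : TangentBundle 𝓘(ℝ, E) M)) := ContMDiff.of_le hX one_le_infty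
  obtain ⟨ε, hε, h⟩ : ∃ ε > 0, ∀ x ∈ S, ∃ γ : ℝ → M, γ 0 = x ∧
      IsMIntegralCurveOn γ X (Ioo (-ε) ε) := by
    refine hS.induction_on (p := fun U => ∃ ε > 0, ∀ x ∈ U, ∃ γ : ℝ → M, γ 0 = x ∧
      IsMIntegralCurveOn γ X (Ioo (-ε) ε)) ⟨1, one_pos, by simp⟩ ?_ ?_ ?_
    · rintro U V hUV ⟨ε, hε, h⟩
      exact ⟨ε, hε, fun x hx => h x (hUV hx)⟩
    · rintro U V ⟨ε, hε, h⟩ ⟨ε', hε', h'⟩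
      refine ⟨min ε ε', lt_min hε hε', fun x hx => ?_⟩
      rcases hx with hx | hx
      · obtain ⟨γ, h0, h1⟩ := h x hx
        exact ⟨γ, h0, h1.mono (Ioo_subset_Ioo (neg_le_neg (min_le_left _ _)) (min_le_left _ _))⟩
      · obtain ⟨γ, h0, h1⟩ := h' x hx
        exact ⟨γ, h0, h1.mono (Ioo_subset_Ioo (neg_le_neg (min_le_right _ _)) (min_le_right _ _))⟩
    · intro x _
      obtain ⟨ε, hε, h⟩ := hX.exists_uniform_time x
      exact ⟨_, mem_nhdsWithin_of_mem_nhds h, ε, hε, fun y hy => hy⟩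
  refine exists_isMIntegralCurve_of_isMIntegralCurveOn hX1 hε (fun y => ?_) x
  by_cases hy : y ∈ S
  · exact h y hy
  · refine ⟨fun _ => y, rfl, fun t _ => ?_⟩
    have := hasVelocityWithin_const (E := E) y (Ioo (-ε) ε) t
    have e : X y = (0 : E) := hXS y hy
    rw [e]
    exact this

/-- The solutions provided by the implicit function theorem are integral curves: the flow is of class
`Cⁿ` near time `0`. -/
lemma IsSmoothField.contMDiffAt_flow (hX : IsSmoothField X) {A : ℝ → M → M}
    (hA0 : ∀ x, A 0 x = x) (hA : ∀ x, IsMIntegralCurve (fun t => A t x) X) (x₀ : M) {n : ℕ}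
    (hn : n ≠ 0) :
    ContMDiffAt (𝓘(ℝ, ℝ).prod 𝓘(ℝ, E)) 𝓘(ℝ, E) n (fun p : ℝ × M => A p.1 p.2) (0, x₀) := by
  have : CompleteSpace E := FiniteDimensional.complete ℝ E
  have : IsManifold 𝓘(ℝ, E) n M := IsManifold.of_le (n := ∞) (by exact_mod_cast le_top)
  obtain ⟨f, r, C, hr, hf, hC, hball, hfX⟩ := hX.exists_chart_field x₀
  set ψ := extChartAt 𝓘(ℝ, E) x₀ with hψ
  obtain ⟨Γ, hΓ, hΓ0, hΓs⟩ := exists_contDiffAt_solution hf (ψ x₀) hn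
  let P : ℝ × M → ℝ × E := fun p => (p.1, ψ p.2)
  have hP : ContMDiffAt (𝓘(ℝ, ℝ).prod 𝓘(ℝ, E)) 𝓘(ℝ, ℝ × E) n P (0, x₀) := by
    have h1 : ContMDiffAt (𝓘(ℝ, ℝ).prod 𝓘(ℝ, E)) 𝓘(ℝ, E) n (fun p : ℝ × M => ψ p.2) (0, x₀) :=
      ContMDiffAt.comp (0, x₀) (I' := 𝓘(ℝ, E))
        ((contMDiffAt_chart (mem_extChartAt_source x₀)).of_le (by exact_mod_cast le_top))
        contMDiffAt_snd
    exact contMDiffAt_fst.prodMk_space h1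
  have hΓP : ContMDiffAt (𝓘(ℝ, ℝ).prod 𝓘(ℝ, E)) 𝓘(ℝ, C(Icc (0 : ℝ) 1, E)) n
      (fun p => Γ (P p)) (0, x₀) :=
    ContMDiffAt.comp (0, x₀) (I' := 𝓘(ℝ, ℝ × E)) hΓ.contMDiffAt hP
  let ev : C(Icc (0 : ℝ) 1, E) →L[ℝ] E := ContinuousMap.evalCLM ℝ (1 : Icc (0 : ℝ) 1)
  have hev : ContMDiffAt (𝓘(ℝ, ℝ).prod 𝓘(ℝ, E)) 𝓘(ℝ, E) n (fun p => ev (Γ (P p))) (0, x₀) :=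
    ContMDiffAt.comp (0, x₀) (I' := 𝓘(ℝ, C(Icc (0 : ℝ) 1, E))) ev.contMDiff.contMDiffAt hΓP
  have hev0 : ev (Γ (P (0, x₀))) = ψ x₀ := by
    change Γ (0, ψ x₀) 1 = _
    rw [hΓ0]
    rfl
  have hres : ContMDiffAt (𝓘(ℝ, ℝ).prod 𝓘(ℝ, E)) 𝓘(ℝ, E) n
      (fun p => ψ.symm (ev (Γ (P p)))) (0, x₀) := by
    refine ContMDiffAt.comp (0, x₀) (I' := 𝓘(ℝ, E)) ?_ hev
    rw [hev0]
    exact (contMDiffAt_chart_symm (mem_extChartAt_target x₀)).of_le (by exact_mod_cast le_top)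
  refine hres.congr_of_eventuallyEq ?_
  have e1 : ∀ᶠ p in 𝓝 ((0 : ℝ), x₀), ∀ s, Γ (P p) s =
      (P p).2 + (P p).1 • ∫ r in (0 : ℝ)..s, f (Γ (P p) (projIcc 0 1 zero_le_one r)) :=
    hP.continuousAt.eventually hΓs
  have e2 : ∀ᶠ p in 𝓝 ((0 : ℝ), x₀), dist (Γ (P p)) (Γ (P (0, x₀))) < r :=
    hΓP.continuousAt.eventually (Metric.ball_mem_nhds _ hr)
  have e3 : ∀ᶠ p in 𝓝 ((0 : ℝ), x₀), p.2 ∈ ψ.source :=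
    continuousAt_snd.eventually (extChartAt_source_mem_nhds (I := 𝓘(ℝ, E)) x₀)
  filter_upwards [e1, e2, e3] with p h1 h2 h3
  have hmem : ∀ s, Γ (P p) s ∈ Metric.ball (ψ x₀) r := fun s => by
    have h4 := (ContinuousMap.dist_apply_le_dist (f := Γ (P p)) (g := Γ (P (0, x₀))) s).trans_lt h2
    have h5 : Γ (P (0, x₀)) s = ψ x₀ := by
      change Γ (0, ψ x₀) s = _
      rw [hΓ0]
      rfl
    rwa [h5] at h4
  -- `c` solves the rescaled equation `c' = t f(c)` on `[0, 1]`, so it is an integral curve of `t X`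
  let c : ℝ → E := fun τ => Γ (P p) (projIcc 0 1 zero_le_one τ)
  have hc : ∀ τ ∈ Icc (0 : ℝ) 1, c τ =
      (P p).2 + (P p).1 • ∫ r in (0 : ℝ)..τ, f (Γ (P p) (projIcc 0 1 zero_le_one r)) := by
    intro τ hτ
    change Γ (P p) (projIcc 0 1 zero_le_one τ) = _
    rw [h1, projIcc_of_mem zero_le_one hτ]
  have hcd : ∀ τ ∈ Icc (0 : ℝ) 1, HasDerivWithinAt c (p.1 • f (c τ)) (Icc 0 1) τ := by
    intro τ hτ
    have h5 := ((hasDerivAt_primitive (superposition hf.continuous (Γ (P p))) τ).const_smul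
      (P p).1).const_add (P p).2
    exact h5.hasDerivWithinAt.congr hc (hc τ hτ)
  have hc0 : c 0 = ψ p.2 := by
    rw [hc 0 (by simp)]
    simp [P]
  have hcurve : IsMIntegralCurveOn (fun τ => ψ.symm (c τ)) (p.1 • X) (Icc 0 1) := by
    intro τ hτ
    have h6 := hcd τ hτ
    rw [hfX _ (hmem _)] at h6
    exact hasVelocityWithin_chart_symm h6 (hball (hmem _))
  have hcurve' : IsMIntegralCurveOn (fun τ => A (τ * p.1) p.2) (p.1 • X) (Icc 0 1) :=
    ((hA p.2).comp_mul p.1).isMIntegralCurveOn _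
  have hXp : IsSmoothField (p.1 • X) := ContMDiff.const_smul_section hX
  have h7 := hXp.eqOn_Icc_left hcurve' hcurve (by
    simp only [zero_mul, hA0, hc0]
    exact (ψ.left_inv h3).symm) (right_mem_Icc.2 zero_le_one)
  simp only [one_mul] at h7
  rw [h7]
  change ψ.symm (Γ (P p) (projIcc 0 1 zero_le_one 1)) = ψ.symm (Γ (P p) 1)
  rw [projIcc_right]
  rfl

/-- The flow of a smooth vector field supported in the compact set `S`: a smooth one-parameter group
of diffeomorphisms. -/
structure IsGlobalFlow (X : VField E M) (S : Set M)
    (A : ℝ → Diffeomorph 𝓘(ℝ, E) 𝓘(ℝ, E) M M ∞) : Prop where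
  compact : IsCompact S
  smooth : ContMDiff (𝓘(ℝ, ℝ).prod 𝓘(ℝ, E)) 𝓘(ℝ, E) ∞ (fun p : ℝ × M => A p.1 p.2)
  eq_self : ∀ t x, x ∉ S → A t x = x
  zero : ∀ x, A 0 x = x
  add : ∀ s t x, A (s + t) x = A s (A t x)
  symm : ∀ t x, (A t).symm x = A (-t) x
  integralCurve : ∀ x, IsMIntegralCurve (fun t => A t x) X

/-- A smooth vector field with compact support has a global smooth flow. -/
theorem IsSmoothField.exists_isGlobalFlow (hX : IsSmoothField X) {S : Set M} (hS : IsCompact S)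
    (hXS : ∀ x, x ∉ S → X x = 0) :
    ∃ A : ℝ → Diffeomorph 𝓘(ℝ, E) 𝓘(ℝ, E) M M ∞, IsGlobalFlow X S A := by
  have : IsManifold 𝓘(ℝ, E) 1 M := IsManifold.of_le (n := ∞) one_le_infty
  have hX1 : ContMDiff 𝓘(ℝ, E) 𝓘(ℝ, E).tangent 1
    (fun x => (⟨x, X x⟩ : TangentBundle 𝓘(ℝ, E) M)) := ContMDiff.of_le hX one_le_infty
  choose γ hγ0 hγ using hX.exists_isMIntegralCurve hS hXS
  let B : ℝ → M → M := fun t x => γ x t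
  have hadd : ∀ s t x, B (s + t) x = B s (B t x) := by
    intro s t x
    have := isMIntegralCurve_Ioo_eq_of_contMDiff_boundaryless (t₀ := 0) hX1
      ((hγ x).comp_add t) (hγ (γ x t)) (by simp [hγ0])
    exact congrFun this s
  have hfix : ∀ t x, x ∉ S → B t x = x := by
    intro t x hx
    have hconst : IsMIntegralCurve (fun _ : ℝ => x) X := fun t => by
      have := hasVelocityWithin_const (E := E) x univ t
      have e : X x = (0 : E) := hXS x hx
      rw [e]
      exact HasMFDerivWithinAt.hasMFDerivAt this univ_mem
    have := isMIntegralCurve_Ioo_eq_of_contMDiff_boundaryless (t₀ := 0) hX1 (hγ x) hconst (hγ0 x)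
    exact congrFun this t
  -- finite regularity propagates from small times to all times by the group law
  have hsmooth : ∀ n : ℕ, ContMDiff (𝓘(ℝ, ℝ).prod 𝓘(ℝ, E)) 𝓘(ℝ, E) (n + 1 : ℕ)
      (fun p : ℝ × M => B p.1 p.2) := by
    intro n
    have : IsManifold 𝓘(ℝ, E) (n + 1 : ℕ) M :=
      IsManifold.of_le (n := ∞) (by exact_mod_cast le_top)
    have hloc : ∀ x₀, ContMDiffAt (𝓘(ℝ, ℝ).prod 𝓘(ℝ, E)) 𝓘(ℝ, E) (n + 1 : ℕ)
        (fun p : ℝ × M => B p.1 p.2) (0, x₀) := fun x₀ =>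
      hX.contMDiffAt_flow hγ0 hγ x₀ n.succ_ne_zero
    have hev := hS.eventually_forall_of_forall_eventually (x₀ := (0 : ℝ))
      (P := fun t x => ContMDiffAt (𝓘(ℝ, ℝ).prod 𝓘(ℝ, E)) 𝓘(ℝ, E) (n + 1 : ℕ)
        (fun p : ℝ × M => B p.1 p.2) (t, x))
      fun x _ => (contMDiffAt_iff_contMDiffAt_nhds (by exact_mod_cast ENat.natCast_ne_top _)).1
          (hloc x)
    obtain ⟨ε, hε, h⟩ := Metric.eventually_nhds_iff.1 hev
    have hsmall : ∀ t : ℝ, |t| < ε → ContMDiff 𝓘(ℝ, E) 𝓘(ℝ, E) (n + 1 : ℕ) (B t) := by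
      intro t ht x
      by_cases hx : x ∈ S
      · have h1 := h (by simpa using ht) x hx
        exact ContMDiffAt.comp x (I' := 𝓘(ℝ, ℝ).prod 𝓘(ℝ, E)) (f := fun x => (t, x)) h1
          (contMDiffAt_const.prodMk contMDiffAt_id)
      · refine contMDiffAt_id.congr_of_eventuallyEq ?_
        filter_upwards [hS.isClosed.isOpen_compl.mem_nhds hx] with y hy using hfix t y hy
    have hpow : ∀ k : ℕ, ∀ t : ℝ, |t| < ε →
        ContMDiff 𝓘(ℝ, E) 𝓘(ℝ, E) (n + 1 : ℕ) (B (k * t)) := by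
      intro k t ht
      induction k with
      | zero =>
        have : B ((0 : ℕ) * t) = fun x => x := by
          funext x
          simp [B, hγ0]
        rw [this]
        exact contMDiff_id
      | succ k ih =>
        have : B ((k + 1 : ℕ) * t) = fun x => B t (B (k * t) x) := by
          funext x
          rw [← hadd]
          congr 1
          push_cast
          ring
        rw [this]
        exact (hsmall t ht).comp ih
    have hall : ∀ t, ContMDiff 𝓘(ℝ, E) 𝓘(ℝ, E) (n + 1 : ℕ) (B t) := by
      intro t
      obtain ⟨k, hk⟩ := exists_nat_gt (|t| / ε)
      have hk0 : (0 : ℝ) < k := (div_nonneg (abs_nonneg t) hε.le).trans_lt hk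
      have h1 := hpow k (t / k) (by
        rw [abs_div, Nat.abs_cast, div_lt_iff₀ hk0, mul_comm]
        exact (div_lt_iff₀ hε).1 hk)
      rwa [mul_div_cancel₀ _ hk0.ne'] at h1
    rintro ⟨t₀, x₀⟩
    have h2 : (fun p : ℝ × M => B p.1 p.2) = fun p => B (p.1 - t₀) (B t₀ p.2) := by
      funext p
      rw [← hadd, sub_add_cancel]
    rw [h2]
    have h3 : ContMDiff (𝓘(ℝ, ℝ).prod 𝓘(ℝ, E)) (𝓘(ℝ, ℝ).prod 𝓘(ℝ, E)) (n + 1 : ℕ)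
        (fun p : ℝ × M => (p.1 - t₀, B t₀ p.2)) :=
      (contMDiff_fst.sub contMDiff_const).prodMk ((hall t₀).comp contMDiff_snd)
    refine ContMDiffAt.comp (t₀, x₀) (I' := 𝓘(ℝ, ℝ).prod 𝓘(ℝ, E))
      (f := fun p : ℝ × M => (p.1 - t₀, B t₀ p.2)) (g := fun p : ℝ × M => B p.1 p.2) ?_ (h3 _)
    simp only [sub_self]
    exact hloc _
  have hB : ContMDiff (𝓘(ℝ, ℝ).prod 𝓘(ℝ, E)) 𝓘(ℝ, E) ∞ (fun p : ℝ × M => B p.1 p.2) :=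
    contMDiff_infty.2 fun n => (hsmooth n).of_le (by exact_mod_cast n.le_succ)
  have hBt : ∀ t, ContMDiff 𝓘(ℝ, E) 𝓘(ℝ, E) ∞ (B t) := fun t =>
    hB.comp (contMDiff_const.prodMk contMDiff_id)
  refine ⟨fun t => ⟨⟨B t, B (-t), fun x => ?_, fun x => ?_⟩, hBt t, hBt
      (-t)⟩, hS, hB, hfix, hγ0, hadd,
    fun _ _ => rfl, hγ⟩
  · rw [← hadd, neg_add_cancel]
    exact hγ0 x
  · rw [← hadd, add_neg_cancel]
    exact hγ0 x

end SmoothFlow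



/-! ### Closed `1`-forms -/

section ClosedForms

variable {E : Type*} [NormedAddCommGroup E] [NormedSpace ℝ E]
  {M : Type*} [MetricSpace M] [ChartedSpace E M] [IsManifold 𝓘(ℝ, E) ∞ M]

lemma IsSymplecticForm.isSmoothForm_contract {Ω : DiffForm E M 2} (hΩ : IsSymplecticForm Ω)
    {X : VField E M} (hX : IsSmoothField X) : IsSmoothForm (contract X Ω) := by
  intro x₀
  let W : M → E := X
  have h1 : ContDiffOn ℝ ∞ (fun y => (ContinuousAlternatingMap.curryLeftLI (𝕜 := ℝ) (E := E)
      (F := ℝ) (n := 1)).toContinuousLinearMap (chartRep Ω x₀ y))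
      (extChartAt 𝓘(ℝ, E) x₀).target :=
    (ContinuousLinearMap.contDiff _).comp_contDiffOn (hΩ.smooth x₀)
  have h2 := h1.clm_apply (hX.contDiffOn_chart x₀)
  refine h2.congr fun y hy => form1_ext fun v => ?_
  have h3 := tderiv_chart_symm_chart ((extChartAt 𝓘(ℝ, E) x₀).map_target hy)
    (W ((extChartAt 𝓘(ℝ, E) x₀).symm y))
  rw [(extChartAt 𝓘(ℝ, E) x₀).right_inv hy] at h3
  rw [chartRep_one_apply]
  change ev2 Ω _ (W _) _ = chartRep Ω x₀ y ![tderiv E E (extChartAt 𝓘(ℝ, E) x₀)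
    ((extChartAt 𝓘(ℝ, E) x₀).symm y) (W ((extChartAt 𝓘(ℝ, E) x₀).symm y)), v]
  rw [chartRep_two_apply, h3]

/-- The exterior derivative of a closed form vanishes in every chart. -/
lemma extDeriv_chartRep_eq_zero {α : DiffForm E M 1} (hα : IsSmoothForm α) (hd : dForm α = 0)
    {p : M} {y : E} (hy : y ∈ (extChartAt 𝓘(ℝ, E) p).target) :
    extDeriv (chartRep α p) y = 0 := by
  set x := (extChartAt 𝓘(ℝ, E) p).symm y with hx
  have hxs := mem_extChartAt_source (I := 𝓘(ℝ, E)) x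
  let T : E → E := fun z => extChartAt 𝓘(ℝ, E) x ((extChartAt 𝓘(ℝ, E) p).symm z)
  have hT : ContDiffAt ℝ ∞ T y :=
    (ContMDiffAt.comp y (contMDiffAt_chart hxs) (contMDiffAt_chart_symm hy)).contDiffAt
  have hev : chartRep α p =ᶠ[𝓝 y] fun z =>
      (chartRep α x (T z)).compContinuousLinearMap (fderiv ℝ T z) := by
    filter_upwards [(isOpen_extChartAt_target p).mem_nhds hy,
      (continuousAt_extChartAt_symm'' hy).eventually (chart_source_mem_nhds hxs)] with z hz hz'
    refine form1_ext fun v => ?_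
    have e := tderiv_comp (mdifferentiableAt_chart hz') (mdifferentiableAt_chart_symm hz)
    rw [tderiv_eq_fderiv] at e
    have e1 : ((chartRep α x (T z)).compContinuousLinearMap (fderiv ℝ T z)) ![v] =
        chartRep α x (T z) ![fderiv ℝ T z v] := by
      rw [ContinuousAlternatingMap.compContinuousLinearMap_apply]
      congr 1
      ext i; fin_cases i; rfl
    rw [e1, chartRep_one_apply, chartRep_one_apply, e, ContinuousLinearMap.comp_apply,
      tderiv_chart_symm_chart hz', (extChartAt 𝓘(ℝ, E) x).left_inv hz']
  have hω : DifferentiableAt ℝ (chartRep α x) (T y) := hα.differentiableAt x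
  rw [hev.extDeriv_eq, extDeriv_pullback hω hT (by simp [two_le_infty])]
  have h0 := extDeriv_chartRep_eq (β := 0) (congrFun hd x)
  change (extDeriv (chartRep α x) (extChartAt 𝓘(ℝ, E) x x)).compContinuousLinearMap _ = 0
  rw [h0]
  rfl

/-- The Poincaré lemma for `1`-forms. -/
theorem isExactNear_of_closed {α : DiffForm E M 1} (hα : IsSmoothForm α) (hd : dForm α = 0)
    (p : M) : IsExactNear α p := by
  set ψ := extChartAt 𝓘(ℝ, E) p with hψ
  have ht : ψ.target ∈ 𝓝 (ψ p) := extChartAt_target_mem_nhds (I := 𝓘(ℝ, E)) p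
  obtain ⟨r, hr, hrt⟩ := Metric.nhds_basis_ball.mem_iff.1 ht
  let L := (ContinuousAlternatingMap.ofSubsingletonLIE (𝕜 := ℝ) (E := E) (F := ℝ) (0 : Fin 1)).symm
  let β : E → E →L[ℝ] ℝ := fun y => L (chartRep α p y)
  have hβa : ∀ y v, β y v = chartRep α p y ![v] := fun y v => by
    change chartRep α p y (fun _ => v) = _
    congr 1
    ext i; fin_cases i; rfl
  have hβ : ContDiffOn ℝ ∞ β (Metric.ball (ψ p) r) := L.contDiff.comp_contDiffOn ((hα p).mono hrt)
  have hβd : DifferentiableOn ℝ β (Metric.ball (ψ p) r) := hβ.differentiableOn (by simp)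
  have hsymm : ∀ a ∈ Metric.ball (ψ p) r, ∀ v w, fderiv ℝ β a v w = fderiv ℝ β a w v := by
    intro a ha v w
    have h1 : DifferentiableAt ℝ (chartRep α p) a :=
      ((hα p).contDiffAt ((isOpen_extChartAt_target p).mem_nhds (hrt ha))).differentiableAt (by simp)
    have h2 := extDeriv_one_form_apply h1 v w
    rw [extDeriv_chartRep_eq_zero hα hd (hrt ha)] at h2
    have h3 : ∀ v w, fderiv ℝ (fun q => chartRep α p q ![w]) a v = fderiv ℝ β a v w := by
      intro v w
      have h4 : (fun q => chartRep α p q ![w]) = fun q => β q w := funext fun q => (hβa q w).symm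
      have h5 := (hβd.differentiableAt (Metric.isOpen_ball.mem_nhds ha)).hasFDerivAt.clm_apply
        (hasFDerivAt_const w a)
      rw [h4, h5.fderiv]
      simp
    rw [h3, h3] at h2
    have h6 : (0 : E [⋀^Fin 2]→L[ℝ] ℝ) ![v, w] = 0 := rfl
    linarith
  obtain ⟨f, hf⟩ := (convex_ball (ψ p) r).exists_forall_hasFDerivAt_of_fderiv_symmetric
    Metric.isOpen_ball hβd hsymm
  have hfs : ContDiffOn ℝ ∞ f (Metric.ball (ψ p) r) := by
    rw [contDiffOn_infty_iff_fderiv_of_isOpen Metric.isOpen_ball]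
    exact ⟨fun a ha => (hf a ha).differentiableAt.differentiableWithinAt,
      hβ.congr fun a ha => (hf a ha).fderiv⟩
  refine ⟨fun x => f (ψ x), ?_⟩
  filter_upwards [chart_source_mem_nhds (mem_extChartAt_source (I := 𝓘(ℝ, E)) p),
    (continuousAt_extChartAt (I := 𝓘(ℝ, E)) p).eventually (Metric.ball_mem_nhds _ hr)] with x hx hxb
  have h7 : ContMDiffAt 𝓘(ℝ, E) 𝓘(ℝ, ℝ) ∞ f (ψ x) :=
    (hfs.contDiffAt (Metric.isOpen_ball.mem_nhds hxb)).contMDiffAt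
  refine ⟨h7.comp x (contMDiffAt_chart hx), diffForm1_ext fun v => ?_⟩
  rw [ev1_dFun, tderiv_comp (h7.mdifferentiableAt (by simp)) (mdifferentiableAt_chart hx),
    tderiv_eq_fderiv, (hf _ hxb).fderiv]
  change _ = β (ψ x) (tderiv E E ψ x v)
  rw [hβa, chartRep_one_apply, tderiv_chart_symm_chart hx, (extChartAt 𝓘(ℝ, E) p).left_inv hx]

omit [IsManifold 𝓘(ℝ, E) ∞ M] in
lemma ev1_pullbackForm (g : M → M) (α : DiffForm E M 1) (x : M) (v : E) :
    ev1 (pullbackForm g α) x v = ev1 α (g x) (tderiv E E g x v) := by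
  change (α (g x) : E [⋀^Fin 1]→L[ℝ] ℝ) _ = (α (g x) : E [⋀^Fin 1]→L[ℝ] ℝ) _
  congr 1
  ext i; fin_cases i; rfl

omit [IsManifold 𝓘(ℝ, E) ∞ M] in
lemma IsExactNear.pullbackForm {α : DiffForm E M 1} {g : M → M}
    (hg : ContMDiff 𝓘(ℝ, E) 𝓘(ℝ, E) ∞ g) {p : M} (h : IsExactNear α (g p)) :
    IsExactNear (pullbackForm g α) p := by
  obtain ⟨f, hf⟩ := h
  refine ⟨fun x => f (g x), ?_⟩
  filter_upwards [hg.continuous.continuousAt.eventually hf] with x hx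
  refine ⟨hx.1.comp x (hg x), diffForm1_ext fun v => ?_⟩
  have e : ev1 α (g x) = ev1 (dFun f) (g x) := by
    unfold ev1
    rw [hx.2]
  rw [ev1_pullbackForm, e, ev1_dFun, ev1_dFun, tderiv_comp (hx.1.mdifferentiableAt (by simp))
      ((hg x).mdifferentiableAt (by simp))]
  rfl

omit [IsManifold 𝓘(ℝ, E) ∞ M] in
lemma ev1_sub (α β : DiffForm E M 1) (x : M) (v : E) :
    ev1 (α - β) x v = ev1 α x v - ev1 β x v := rfl

omit [IsManifold 𝓘(ℝ, E) ∞ M] in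
lemma dForm_sub {k : ℕ} {α β : DiffForm E M k} (hα : IsSmoothForm α) (hβ : IsSmoothForm β) :
    IsSmoothForm (α - β) ∧ dForm (α - β) = dForm α - dForm β := by
  have h1 : IsSmoothForm (-β) := fun x₀ => (hβ x₀).neg
  have h2 : dForm (-β) = - dForm β := by
    rw [← neg_one_smul ℝ β, dForm_smul]
    exact neg_one_smul ℝ (dForm β)
  refine ⟨fun x₀ => (hα x₀).sub (hβ x₀), ?_⟩
  rw [sub_eq_add_neg, dForm_add hα h1, h2, sub_eq_add_neg]

/-- If `H¹_c` vanishes, a closed form and its pullback by a compactly supported diffeomorphism differ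
by the differential of a function with compact support. -/
theorem exists_compact_primitive (hH : Subsingleton (H1c E M)) {α : DiffForm E M 1}
    (hα : IsSmoothForm α) (hd : dForm α = 0) {g : M → M} (hg : ContMDiff 𝓘(ℝ, E) 𝓘(ℝ, E) ∞ g)
    {S : Set M} (hS : IsCompact S) (hgS : ∀ x, x ∉ S → g x = x) :
    ∃ (P : M → ℝ) (L : Set M), ContMDiff 𝓘(ℝ, E) 𝓘(ℝ, ℝ) ∞ P ∧ IsCompact L ∧
      (∀ x, x ∉ L → P x = 0) ∧
      ∀ x u, tderiv E ℝ P x u = ev1 α x u - ev1 α (g x) (tderiv E E g x u) := by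
  have h1 : ∀ p, IsExactNear (pullbackForm g α) p := fun p =>
    (isExactNear_of_closed hα hd (g p)).pullbackForm hg
  have h2 : IsSmoothForm (pullbackForm g α) := isSmoothForm_of_isExactNear h1
  have h3 : dForm (pullbackForm g α) = 0 := funext fun p => dForm_eq_zero_of_isExactNear (h1 p)
  obtain ⟨h4, h5⟩ := dForm_sub hα h2
  have hmem : α - pullbackForm g α ∈ closedCompact1 E M := by
    refine ⟨h4, ⟨S, hS, fun x hx => diffForm1_ext (α := α - pullbackForm g α) (β := 0) fun v => ?_⟩,
      by rw [h5, hd, h3, sub_zero]⟩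
    have e : tderiv E E g x = ContinuousLinearMap.id ℝ E := by
      rw [← tderiv_id x]
      refine tderiv_congr ?_
      filter_upwards [hS.isClosed.isOpen_compl.mem_nhds hx] with y hy using hgS y hy
    change ev1 α x v - ev1 (pullbackForm g α) x v = 0
    rw [ev1_pullbackForm, e, hgS x hx]
    exact sub_self _
  have h6 : (QuotientAddGroup.mk ⟨_, hmem⟩ : H1c E M) = 0 := Subsingleton.elim _ _
  rw [QuotientAddGroup.eq_zero_iff, AddSubgroup.mem_addSubgroupOf] at h6
  obtain ⟨P, hP, ⟨L, hL, hPL⟩, hdP⟩ := h6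
  refine ⟨P, L, hP, hL, hPL, fun x u => ?_⟩
  have h7 : ev1 (α - pullbackForm g α) x u = ev1 (dFun P) x u :=
    congrArg (fun β : DiffForm E M 1 => ev1 β x u) hdP
  rw [← ev1_dFun, ← h7, ev1_sub, ev1_pullbackForm]

end ClosedForms

/-! ### Increments of local primitives -/

section NearDiagonal

variable {E : Type*} [NormedAddCommGroup E] [NormedSpace ℝ E]
  {M : Type*} [MetricSpace M] [ChartedSpace E M] {δ : ℝ}

/-- `b y z` is the increment from `y` to `z` of the local primitives of `α`, for `y` in `Q` and `z`
at distance less than `ρ`. -/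
def IsIncrement (α : DiffForm E M 1) (Q : Set M) (ρ : ℝ) (b : M → M → ℝ) : Prop :=
  ∀ y₀ ∈ Q, ∃ F : M → ℝ,
    (∀ z ∈ Metric.ball y₀ ρ, ContMDiffAt 𝓘(ℝ, E) 𝓘(ℝ, ℝ) ∞ F z ∧ α z = dFun F z) ∧
    ∀ y ∈ Metric.ball y₀ ρ ∩ Q, ∀ z ∈ Metric.ball y₀ ρ, b y z = F z - F y

variable [IsManifold 𝓘(ℝ, E) ∞ M]

/-- Two primitives of the same form on a preconnected open set have the same increments. -/
lemma sub_eq_sub_of_dFun_eq {F F' : M → ℝ} {W : Set M} (hW : IsOpen W) (hWc : IsPreconnected W)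
    (hF : ∀ z ∈ W, MDifferentiableAt 𝓘(ℝ, E) 𝓘(ℝ, ℝ) F z)
    (hF' : ∀ z ∈ W, MDifferentiableAt 𝓘(ℝ, E) 𝓘(ℝ, ℝ) F' z)
    (h : ∀ z ∈ W, dFun (E := E) F z = dFun F' z) {y z : M} (hy : y ∈ W) (hz : z ∈ W) :
    F z - F y = F' z - F' y := by
  have hloc : ∀ x ∈ W, ∀ᶠ z in 𝓝 x, F z - F' z = F x - F' x := by
    intro x hx
    set ψ := extChartAt 𝓘(ℝ, E) x with hψ
    have hxs := mem_extChartAt_source (I := 𝓘(ℝ, E)) x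
    have h1 : ψ.symm ⁻¹' W ∩ ψ.target ∈ 𝓝 (ψ x) := by
      refine inter_mem ?_ (extChartAt_target_mem_nhds x)
      refine (continuousAt_extChartAt_symm x).preimage_mem_nhds ?_
      rw [extChartAt_to_inv]
      exact hW.mem_nhds hx
    obtain ⟨r, hr, hrW⟩ := Metric.mem_nhds_iff.1 h1
    let G : E → ℝ := fun y => F (ψ.symm y) - F' (ψ.symm y)
    have hG : ∀ y ∈ Metric.ball (ψ x) r, HasFDerivAt G (0 : E →L[ℝ] ℝ) y := by
      intro y hy
      obtain ⟨hyW, hyt⟩ := hrW hy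
      have e1 := tderiv_comp (hF _ hyW) (mdifferentiableAt_chart_symm hyt)
      have e2 := tderiv_comp (hF' _ hyW) (mdifferentiableAt_chart_symm hyt)
      have d1 : DifferentiableAt ℝ (fun y => F (ψ.symm y)) y :=
        ((hF _ hyW).comp y (mdifferentiableAt_chart_symm hyt)).differentiableAt
      have d2 : DifferentiableAt ℝ (fun y => F' (ψ.symm y)) y :=
        ((hF' _ hyW).comp y (mdifferentiableAt_chart_symm hyt)).differentiableAt
      rw [tderiv_eq_fderiv] at e1 e2
      have e3 : tderiv E ℝ F (ψ.symm y) = tderiv E ℝ F' (ψ.symm y) := by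
        ext v
        have := congrArg (fun β : E [⋀^Fin 1]→L[ℝ] ℝ => β ![v]) (h _ hyW)
        exact this
      have e4 : HasFDerivAt G _ y := d1.hasFDerivAt.sub d2.hasFDerivAt
      rw [e1, e2, e3, sub_self] at e4
      exact e4
    filter_upwards [chart_source_mem_nhds hxs,
      (continuousAt_extChartAt (I := 𝓘(ℝ, E)) x).eventually (Metric.ball_mem_nhds _ hr)] with z
          hz hzb
    have h2 := (convex_ball (ψ x) r).norm_image_sub_le_of_norm_hasFDerivWithin_le (𝕜 := ℝ)
        (f := G) (f' := fun _ => 0) (C := 0)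
      (fun y hy => (hG y hy).hasFDerivWithinAt) (by simp) (Metric.mem_ball_self hr) hzb
    rw [zero_mul, norm_le_zero_iff, sub_eq_zero] at h2
    change F (ψ.symm (ψ z)) - F' (ψ.symm (ψ z)) = F (ψ.symm (ψ x)) - F' (ψ.symm (ψ x)) at h2
    rwa [ψ.left_inv hz, ψ.left_inv hxs] at h2
  -- a locally constant function on a preconnected set is constant
  have key : F y - F' y = F z - F' z := by
    let V : Set M := {x | x ∈ W ∧ F x - F' x = F y - F' y}
    let V' : Set M := {x | x ∈ W ∧ F x - F' x ≠ F y - F' y}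
    have hV : IsOpen V := isOpen_iff_mem_nhds.2 fun x hx => by
      filter_upwards [hW.mem_nhds hx.1, hloc x hx.1] with w hw hw'
      exact ⟨hw, hw'.trans hx.2⟩
    have hV' : IsOpen V' := isOpen_iff_mem_nhds.2 fun x hx => by
      filter_upwards [hW.mem_nhds hx.1, hloc x hx.1] with w hw hw'
      exact ⟨hw, by rw [hw']; exact hx.2⟩
    by_contra hne
    obtain ⟨w, -, hw1, hw2⟩ := hWc V V' hV hV' (fun x hx => by
      by_cases hx' : F x - F' x = F y - F' y
      · exact Or.inl ⟨hx, hx'⟩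
      · exact Or.inr ⟨hx, hx'⟩) ⟨y, hy, hy, rfl⟩ ⟨z, hz, hz, fun h => hne h.symm⟩
    exact hw2.2 hw1.2
  linarith

/-- Closed forms have increments near the diagonal of a compact set. Lebesgue numbers provide a
radius `ρ₁` at which every ball around a point of `Q` carries a primitive, and a smaller radius at which
balls are contained in connected sets of diameter less than `ρ₁`: the increments do not depend on
the primitive. -/
lemma exists_isIncrement {α : DiffForm E M 1} (hα : ∀ p, IsExactNear α p) {Q : Set M}
    (hQ : IsCompact Q) : ∃ (b : M → M → ℝ) (ρ : ℝ), 0 < ρ ∧ IsIncrement α Q ρ b := by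
  have : LocallyConnectedSpace M := ChartedSpace.locallyConnectedSpace E M
  have hα' : ∀ p, ∃ (V : Set M) (F : M → ℝ), IsOpen V ∧ p ∈ V ∧
      ∀ x ∈ V, ContMDiffAt 𝓘(ℝ, E) 𝓘(ℝ, ℝ) ∞ F x ∧ α x = dFun F x := by
    intro p
    obtain ⟨F, hF⟩ := hα p
    obtain ⟨V, hV, hVo, hpV⟩ := mem_nhds_iff.1 hF
    exact ⟨V, F, hVo, hpV, fun x hx => hV hx⟩
  choose V F hVo hpV hF using hα'
  obtain ⟨ρ₁, hρ₁, h1⟩ := lebesgue_number_lemma_of_metric hQ hVo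
    (fun x _ => mem_iUnion.2 ⟨x, hpV x⟩)
  have hW : ∀ p : M, ∃ W : Set M, IsOpen W ∧ p ∈ W ∧ IsPreconnected W ∧
      W ⊆ Metric.ball p (ρ₁ / 2) := by
    intro p
    obtain ⟨W, hWs, hWo, hpW, hWc⟩ := locallyConnectedSpace_iff_subsets_isOpen_isConnected.1 this p
      (Metric.ball p (ρ₁ / 2)) (Metric.ball_mem_nhds _ (half_pos hρ₁))
    exact ⟨W, hWo, hpW, hWc.isPreconnected, hWs⟩
  choose W hWo hpW hWc hWs using hW
  obtain ⟨ρ₂, hρ₂, h2⟩ := lebesgue_number_lemma_of_metric hQ hWo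
    (fun x _ => mem_iUnion.2 ⟨x, hpW x⟩)
  have h1' : ∀ y, ∃ p, y ∈ Q → Metric.ball y ρ₁ ⊆ V p := by
    intro y
    by_cases hy : y ∈ Q
    · obtain ⟨p, hp⟩ := h1 y hy
      exact ⟨p, fun _ => hp⟩
    · exact ⟨y, fun h => absurd h hy⟩
  choose c hc using h1'
  refine ⟨fun y z => F (c y) z - F (c y) y, min ρ₂ ρ₁, lt_min hρ₂ hρ₁, fun y₀ hy₀ => ?_⟩
  refine ⟨F (c y₀), fun z hz => hF _ _ (hc y₀ hy₀ (Metric.ball_subset_ball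
      (min_le_right _ _) hz)), ?_⟩
  rintro y ⟨hy, hyQ⟩ z hz
  obtain ⟨q, hq⟩ := h2 y₀ hy₀
  have hball : Metric.ball y₀ (min ρ₂ ρ₁) ⊆ W q :=
    (Metric.ball_subset_ball (min_le_left _ _)).trans hq
  -- the preconnected set `W q` is contained in the domains of both primitives
  have hsub : ∀ y' ∈ W q, W q ⊆ Metric.ball y' ρ₁ := by
    intro y' hy' x hx
    have a1 : dist y' q < ρ₁ / 2 := hWs q hy'
    have a2 : dist x q < ρ₁ / 2 := hWs q hx
    have a3 := dist_triangle_right x y' q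
    rw [Metric.mem_ball]
    linarith
  have hy₀W : y₀ ∈ W q := hball (Metric.mem_ball_self (lt_min hρ₂ hρ₁))
  have k1 : ∀ x ∈ W q, ContMDiffAt 𝓘(ℝ, E) 𝓘(ℝ, ℝ) ∞ (F (c y)) x ∧ α x = dFun (F (c y)) x :=
    fun x hx => hF _ _ (hc y hyQ (hsub y (hball hy) hx))
  have k2 : ∀ x ∈ W q, ContMDiffAt 𝓘(ℝ, E) 𝓘(ℝ, ℝ) ∞ (F (c y₀)) x ∧ α x = dFun (F (c y₀)) x :=
    fun x hx => hF _ _ (hc y₀ hy₀ (hsub y₀ hy₀W hx))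
  exact sub_eq_sub_of_dFun_eq (hWo q) (hWc q)
    (fun x hx => (k1 x hx).1.mdifferentiableAt (by simp))
    (fun x hx => (k2 x hx).1.mdifferentiableAt (by simp))
    (fun x hx => (k1 x hx).2.symm.trans (k2 x hx).2) (hball hy) (hball hz)

end NearDiagonal



section Increments

variable {E : Type*} [NormedAddCommGroup E] [NormedSpace ℝ E]
  {M : Type*} [MetricSpace M] [ChartedSpace E M] {δ ρ t : ℝ} {α : DiffForm E M 1} {Q : Set M}
  {b : M → M → ℝ} {p : ℝ → M → M} {g : M → M} {x₀ : M}

lemma IsIncrement.contMDiffWithinAt (hb : IsIncrement α Q ρ b)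
    (hg : ContMDiff 𝓘(ℝ, E) 𝓘(ℝ, E) ∞ g) (hp : SmoothFamily E E δ p) (ht : t ∈ Icc 0 δ)
    (hgQ : ∀ᶠ x in 𝓝 x₀, g x ∈ Q) (hd : dist (p t x₀) (g x₀) < ρ) :
    ContMDiffWithinAt (𝓘(ℝ, ℝ).prod 𝓘(ℝ, E)) 𝓘(ℝ, ℝ) ∞
      (fun q : ℝ × M => b (g q.2) (p q.1 q.2)) (Icc 0 δ ×ˢ univ) (t, x₀) := by
  obtain ⟨F, hF, hbF⟩ := hb _ hgQ.self_of_nhds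
  have hp' : ContMDiffWithinAt (𝓘(ℝ, ℝ).prod 𝓘(ℝ, E)) 𝓘(ℝ, E) ∞ (fun q : ℝ × M => p q.1 q.2)
    (Icc 0 δ ×ˢ univ) (t, x₀) := hp (t, x₀) ⟨ht, mem_univ _⟩
  have hg' : ContMDiffWithinAt (𝓘(ℝ, ℝ).prod 𝓘(ℝ, E)) 𝓘(ℝ, E) ∞ (fun q : ℝ × M => g q.2)
    (Icc 0 δ ×ˢ univ) (t, x₀) := ((hg.comp contMDiff_snd) _).contMDiffWithinAt
  have hρ : 0 < ρ := dist_nonneg.trans_lt hd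
  have h1 : ContMDiffWithinAt (𝓘(ℝ, ℝ).prod 𝓘(ℝ, E)) 𝓘(ℝ, ℝ) ∞
      (fun q : ℝ × M => F (p q.1 q.2) - F (g q.2)) (Icc 0 δ ×ˢ univ) (t, x₀) :=
    ((hF _ hd).1.comp_contMDiffWithinAt (t, x₀) hp').sub
      ((hF _ (Metric.mem_ball_self hρ)).1.comp_contMDiffWithinAt (t, x₀) hg')
  have hsnd : Tendsto (fun q : ℝ × M => q.2) (𝓝[Icc 0 δ ×ˢ univ] (t, x₀)) (𝓝 x₀) :=
    continuous_snd.continuousAt.mono_left nhdsWithin_le_nhds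
  refine h1.congr_of_eventuallyEq ?_
    (hbF _ ⟨Metric.mem_ball_self hρ, hgQ.self_of_nhds⟩ _ hd)
  filter_upwards [hsnd.eventually hgQ, hp'.continuousWithinAt (Metric.isOpen_ball.mem_nhds hd),
    hg'.continuousWithinAt (Metric.ball_mem_nhds _ hρ)] with q h2 h3 h4
  exact hbF _ ⟨h4, h2⟩ _ h3

/-- The differential of the increment of the primitives of `α` from `g` to `p` is `p^* α - g^* α`. -/
lemma IsIncrement.tderiv_eq (hb : IsIncrement α Q ρ b)
    (hg : ContMDiff 𝓘(ℝ, E) 𝓘(ℝ, E) ∞ g) {p : M → M} (hp : MDifferentiableAt 𝓘(ℝ, E) 𝓘(ℝ, E) p x₀)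
    (hgQ : ∀ᶠ x in 𝓝 x₀, g x ∈ Q) (hd : dist (p x₀) (g x₀) < ρ) :
    MDifferentiableAt 𝓘(ℝ, E) 𝓘(ℝ, ℝ) (fun x => b (g x) (p x)) x₀ ∧
    ∀ u, tderiv E ℝ (fun x => b (g x) (p x)) x₀ u =
      ev1 α (p x₀) (tderiv E E p x₀ u) - ev1 α (g x₀) (tderiv E E g x₀ u) := by
  obtain ⟨F, hF, hbF⟩ := hb _ hgQ.self_of_nhds
  have hρ : 0 < ρ := dist_nonneg.trans_lt hd
  have hg' : MDifferentiableAt 𝓘(ℝ, E) 𝓘(ℝ, E) g x₀ := (hg x₀).mdifferentiableAt (by simp)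
  obtain ⟨f1, f2⟩ := hF _ hd
  obtain ⟨f3, f4⟩ := hF _ (Metric.mem_ball_self hρ)
  have f1' : MDifferentiableAt 𝓘(ℝ, E) 𝓘(ℝ, ℝ) F (p x₀) := f1.mdifferentiableAt (by simp)
  have f3' : MDifferentiableAt 𝓘(ℝ, E) 𝓘(ℝ, ℝ) F (g x₀) := f3.mdifferentiableAt (by simp)
  have hev : (fun x => b (g x) (p x)) =ᶠ[𝓝 x₀] fun x => F (p x) - F (g x) := by
    filter_upwards [hgQ, hp.continuousAt (Metric.isOpen_ball.mem_nhds hd),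
      hg'.continuousAt (Metric.ball_mem_nhds _ hρ)] with q h2 h3 h4
    exact hbF _ ⟨h4, h2⟩ _ h3
  have d1 : MDifferentiableAt 𝓘(ℝ, E) 𝓘(ℝ, ℝ) (fun x => F (p x)) x₀ := f1'.comp x₀ hp
  have d2 : MDifferentiableAt 𝓘(ℝ, E) 𝓘(ℝ, ℝ) (fun x => F (g x)) x₀ := f3'.comp x₀ hg'
  refine ⟨(d1.sub d2).congr_of_eventuallyEq hev, fun u => ?_⟩
  have e1 : tderiv E ℝ (fun x => F (p x) - F (g x)) x₀ =
      tderiv E ℝ (fun x => F (p x)) x₀ - tderiv E ℝ (fun x => F (g x)) x₀ := mfderiv_sub d1 d2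
  have e2 : ∀ v, ev1 α (p x₀) v = tderiv E ℝ F (p x₀) v := fun v => by
    rw [← ev1_dFun]
    unfold ev1
    rw [f2]
  have e3 : ∀ v, ev1 α (g x₀) v = tderiv E ℝ F (g x₀) v := fun v => by
    rw [← ev1_dFun]
    unfold ev1
    rw [f4]
  rw [tderiv_congr hev, e1, tderiv_comp f1' hp, tderiv_comp f3' hg', e2, e3]
  rfl

lemma IsIncrement.continuousOn (hb : IsIncrement α Q ρ b) :
    ContinuousOn (fun q : M × M => b q.1 q.2) {q | q.1 ∈ Q ∧ dist q.2 q.1 < ρ} := by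
  rintro ⟨y₀, z₀⟩ ⟨hy, hd⟩
  obtain ⟨F, hF, hbF⟩ := hb _ hy
  have hρ : 0 < ρ := dist_nonneg.trans_lt hd
  have h1 : ContinuousAt (fun q : M × M => F q.2 - F q.1) (y₀, z₀) :=
    ((hF _ hd).1.continuousAt.comp continuousAt_snd).sub
      ((hF _ (Metric.mem_ball_self hρ)).1.continuousAt.comp continuousAt_fst)
  refine h1.continuousWithinAt.congr_of_eventuallyEq ?_
    (hbF _ ⟨Metric.mem_ball_self hρ, hy⟩ _ hd)
  filter_upwards [eventually_mem_nhdsWithin,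
    mem_nhdsWithin_of_mem_nhds (continuousAt_fst (Metric.ball_mem_nhds y₀ hρ)),
    mem_nhdsWithin_of_mem_nhds (continuousAt_snd.preimage_mem_nhds (x := (y₀, z₀))
      (Metric.isOpen_ball.mem_nhds hd))] with q h2 h3 h4
  exact hbF _ ⟨h3, h2.1⟩ _ h4

end Increments

/-! ### Flows of Liouville fields -/

section FlowGenerators

variable {E : Type*} [NormedAddCommGroup E] [NormedSpace ℝ E] [FiniteDimensional ℝ E]
  {M : Type*} [MetricSpace M] [ChartedSpace E M] [IsManifold 𝓘(ℝ, E) ∞ M] {X Y : VField E M}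
  {S U : Set M} {A : ℝ → Diffeomorph 𝓘(ℝ, E) 𝓘(ℝ, E) M M ∞} {δ t : ℝ} {Ω : DiffForm E M 2}

omit [FiniteDimensional ℝ E] [IsManifold 𝓘(ℝ, E) ∞ M] in
lemma IsGlobalFlow.smoothFamily (hA : IsGlobalFlow X S A) (δ : ℝ) :
    SmoothFamily E E δ fun t => (A t : M → M) := hA.smooth.contMDiffOn

omit [FiniteDimensional ℝ E] [IsManifold 𝓘(ℝ, E) ∞ M] in
lemma IsGlobalFlow.smoothFamily_neg (hA : IsGlobalFlow X S A) (δ : ℝ) :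
    SmoothFamily E E δ fun t => (A (-t) : M → M) :=
  (hA.smooth.comp (contMDiff_fst.neg.prodMk contMDiff_snd)).contMDiffOn

omit [FiniteDimensional ℝ E] [IsManifold 𝓘(ℝ, E) ∞ M] in
lemma IsGlobalFlow.neg_apply (hA : IsGlobalFlow X S A) (t : ℝ) (x : M) : A (-t) (A t x) = x := by
  rw [← hA.add, neg_add_cancel, hA.zero]

omit [FiniteDimensional ℝ E] [IsManifold 𝓘(ℝ, E) ∞ M] in
lemma IsGlobalFlow.apply_neg (hA : IsGlobalFlow X S A) (t : ℝ) (x : M) : A t (A (-t) x) = x := by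
  rw [← hA.add, add_neg_cancel, hA.zero]

omit [FiniteDimensional ℝ E] [IsManifold 𝓘(ℝ, E) ∞ M] in
lemma IsGlobalFlow.unifConv (hA : IsGlobalFlow X S A) (δ : ℝ) :
    UnifConv δ (fun _ t x => A t x) (fun t x => A t x) :=
  UnifConv.const (uniformContinuousOn_of_eq_off_compact (g := id) hA.smooth.continuous.continuousOn
    uniformContinuous_id hA.compact fun t _ x hx => hA.eq_self t x hx)

omit [FiniteDimensional ℝ E] [IsManifold 𝓘(ℝ, E) ∞ M] in
lemma IsGlobalFlow.unifConv_neg (hA : IsGlobalFlow X S A) (δ : ℝ) :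
    UnifConv δ (fun _ t x => A (-t) x) (fun t x => A (-t) x) :=
  UnifConv.const (uniformContinuousOn_of_eq_off_compact (g := id)
    (hA.smooth.continuous.comp (continuous_fst.neg.prodMk continuous_snd)).continuousOn
    uniformContinuous_id hA.compact fun t _ x hx => hA.eq_self (-t) x hx)

omit [FiniteDimensional ℝ E] [IsManifold 𝓘(ℝ, E) ∞ M] in
/-- The flow moves all points by little in small time. -/
lemma IsGlobalFlow.exists_dist_lt (hA : IsGlobalFlow X S A) {ε : ℝ} (hε : 0 < ε) :
    ∃ τ > 0, ∀ t, |t| ≤ τ → ∀ x, dist (A t x) x < ε := by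
  have h1 := hA.compact.eventually_forall_of_forall_eventually (x₀ := (0 : ℝ))
    (P := fun t x => dist (A t x) x < ε) fun x _ => by
      have : ContinuousAt (fun q : ℝ × M => dist (A q.1 q.2) q.2) (0, x) :=
        (hA.smooth.continuous.dist continuous_snd).continuousAt
      refine this.eventually_lt continuousAt_const ?_
      simpa only [hA.zero, dist_self] using hε
  obtain ⟨τ, hτ, h2⟩ := Metric.eventually_nhds_iff.1 h1
  refine ⟨τ / 2, half_pos hτ, fun t ht x => ?_⟩
  by_cases hx : x ∈ S
  · exact h2 (by rw [Real.dist_eq, sub_zero]; linarith) x hx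
  · rwa [hA.eq_self t x hx, dist_self]

omit [FiniteDimensional ℝ E] [IsManifold 𝓘(ℝ, E) ∞ M] in
/-- An orbit on which the two vector fields agree is a trajectory of both. -/
lemma IsGlobalFlow.isTrajectory (hA : IsGlobalFlow Y S A) (hU : ∀ y ∈ U, Y y = X y) {x : M}
    (h : ∀ s ∈ uIcc 0 t, A s x ∈ U) : IsTrajectory X t x (fun s => A s x) := by
  refine ⟨hA.zero x, fun s hs => ?_⟩
  have := (hA.integralCurve x s).hasMFDerivWithinAt (s := uIcc 0 t)
  rw [hU _ (h s hs)] at this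
  exact this

omit [FiniteDimensional ℝ E] [IsManifold 𝓘(ℝ, E) ∞ M] in
lemma IsGlobalFlow.velocity_eq (hA : IsGlobalFlow Y S A) (hδ : 0 < δ) (ht : t ∈ Icc 0 δ) (x : M) :
    velocity E δ (fun t => (A t : M → M)) t x = Y (A t x) :=
  HasVelocityWithin.unique (uniqueDiffOn_Icc hδ t ht) ((hA.smoothFamily δ).hasVelocityWithin ht x)
    (hA.integralCurve x t).hasMFDerivWithinAt

omit [FiniteDimensional ℝ E] [IsManifold 𝓘(ℝ, E) ∞ M] in
/-- A flow preserves its vector field. -/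
lemma IsGlobalFlow.tderiv_field (hA : IsGlobalFlow Y S A) (t : ℝ) (x : M) :
    tderiv E E (A t) x (Y x) = Y (A t x) := by
  let W : M → E := Y
  have h1 : HasVelocityWithin (fun s => A s x) univ 0 (W (A 0 x)) :=
    (hA.integralCurve x 0).hasMFDerivWithinAt
  have h2 := h1.comp_mdifferentiableAt (diffeo_mdifferentiableAt (A t) (A 0 x))
  have h3 : HasVelocityWithin (fun s => A s (A t x)) univ 0 (W (A 0 (A t x))) :=
    (hA.integralCurve (A t x) 0).hasMFDerivWithinAt
  have e : (fun s => A t (A s x)) = fun s => A s (A t x) := by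
    funext s
    rw [← hA.add, ← hA.add, add_comm]
  rw [e, hA.zero] at h2
  rw [hA.zero] at h3
  exact h2.unique uniqueDiffWithinAt_univ h3

omit [FiniteDimensional ℝ E] in
/-- The flow `μ_t` of a Liouville field multiplies `Ω` by `exp t`; its generating form is
`exp t • ι_X Ω`. The field `Y` generating the flow has to be equal to the Liouville field `X` along
the orbit only. -/
lemma IsGlobalFlow.hasGenerator (hΩ : IsSymplecticForm Ω) (hX : IsLiouvilleField Ω X)
    (hA : IsGlobalFlow Y S A) (hU : IsOpen U) (hXY : ∀ y ∈ U, Y y = X y) (hδ : 0 < δ)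
    (ht : t ∈ Icc 0 δ) {x : M} (hx : ∀ s ∈ Icc 0 t, A s x ∈ U) :
    HasGenerator Ω δ (fun t => A t) t x (fun u => Real.exp t * ev1 (contract X Ω) x u)
      (Real.exp t) := by
  have hconf : ∀ u w, ev2 Ω (A t x) (tderiv E E (A t) x u) (tderiv E E (A t) x w) =
      Real.exp t * ev2 Ω x u w := by
    intro u w
    have := ev2_pullback_eq_exp (hA.smoothFamily δ) hΩ.smooth hΩ.closed hA.zero ht x (c := 1)
      (u := u) (w := w) ?_
    · rwa [one_mul] at this
    · intro s hs
      have hs' : s ∈ Icc 0 δ := ⟨hs.1.le, hs.2.le.trans ht.2⟩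
      refine ⟨contract X Ω, hΩ.isSmoothForm_contract hX.smooth, ?_, ?_⟩
      · rw [one_smul, hX.d_contract]
      · have hcont : ContinuousAt (A s) x := (A s).continuous.continuousAt
        filter_upwards [hcont (hU.mem_nhds (hx s ⟨hs.1.le, hs.2.le⟩))] with y hy w
        rw [hA.velocity_eq hδ hs', hXY _ hy]
        rfl
  refine ⟨fun u => ?_, hconf⟩
  have h0 : Y x = X x := by
    have := hx 0 ⟨le_rfl, ht.1⟩
    rw [hA.zero] at this
    exact hXY x this
  rw [hA.velocity_eq hδ ht, ← hA.tderiv_field]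
  refine (hconf (Y x) u).trans ?_
  rw [h0]
  rfl

omit [FiniteDimensional ℝ E] in
/-- The generating form of the inverse `μ_t⁻¹` of a Liouville flow is `- (μ_t⁻¹)^* (ι_X Ω)`. -/
lemma IsGlobalFlow.hasGenerator_neg (hΩ : IsSymplecticForm Ω) (hX : IsLiouvilleField Ω X)
    (hA : IsGlobalFlow Y S A) (hU : IsOpen U) (hXY : ∀ y ∈ U, Y y = X y) (hδ : 0 < δ)
    (ht : t ∈ Icc 0 δ) {x : M} (hx : ∀ s ∈ Icc 0 t, A (-s) x ∈ U) :
    HasGenerator Ω δ (fun t => A (-t)) t x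
      (fun u => - ev1 (contract X Ω) (A (-t) x) (tderiv E E (A (-t)) x u)) (Real.exp t)⁻¹ := by
  have h1 : ∀ s ∈ Icc 0 t, A s (A (-t) x) ∈ U := by
    intro s hs
    rw [← hA.add, show s + -t = -(t - s) by ring]
    exact hx _ ⟨by linarith [hs.2], by linarith [hs.1]⟩
  refine ((hA.hasGenerator hΩ hX hU hXY hδ ht h1).inv (hA.smoothFamily δ) (hA.smoothFamily_neg δ)
    (fun t _ x => hA.apply_neg t x) hδ ht (Real.exp_ne_zero t)).congr_right (fun u => ?_) rfl
  rw [← mul_assoc, inv_mul_cancel₀ (Real.exp_ne_zero t), one_mul]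

end FlowGenerators

section FlowCommutator

variable {E : Type*} [NormedAddCommGroup E] [NormedSpace ℝ E] [FiniteDimensional ℝ E]
  {M : Type*} [MetricSpace M] [ChartedSpace E M] [IsManifold 𝓘(ℝ, E) ∞ M] {X Y : VField E M}
  {S U : Set M} {A : ℝ → Diffeomorph 𝓘(ℝ, E) 𝓘(ℝ, E) M M ∞} {t : ℝ}

/-- If the orbits of the support of `φ` up to time `t` stay in a set on which `X` and `Y` agree, then
`[μ_t, φ]` can be computed with the flow of `Y` instead of that of `X`. -/
lemma IsGlobalFlow.flowCommutator_eq (hX : IsSmoothField X) (hA : IsGlobalFlow Y S A)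
    (hXY : ∀ y ∈ U, Y y = X y) {φ : M ≃ₜ M}
    (h : ∀ x ∈ homeoSupport φ, ∀ s ∈ uIcc 0 t, A s x ∈ U) (x : M) :
    flowCommutator X φ t x = A t (φ (A (-t) (φ.symm x))) := by
  have hflow : ∀ z ∈ homeoSupport φ, flow X t z = A t z := fun z hz =>
    (hA.isTrajectory hXY (h z hz)).flow_eq hX
  unfold flowCommutator
  set y := φ.symm x
  by_cases hy : A (-t) y ∈ homeoSupport φ
  · have h1 : flow X t (A (-t) y) = y := by rw [hflow _ hy, hA.apply_neg]
    conv_lhs => rw [← h1]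
    rw [flowConj_flow hX ⟨_, hA.isTrajectory hXY (h _ hy)⟩,
      hflow _ (mapsTo_of_homeoSupport_subset φ Subset.rfl hy)]
  · rw [eq_self_of_notMem_homeoSupport hy, hA.apply_neg]
    refine if_neg ?_
    rintro ⟨z, hz, hzy⟩
    rw [hflow z hz] at hzy
    rw [← hzy, hA.neg_apply] at hy
    exact hy hz

/-- Smooth vector fields can be cut off: there is a smooth compactly supported one that is equal to
`X` on the compact set `K`; its flow is global. -/
lemma IsSmoothField.exists_cutoff_flow [SigmaCompactSpace M] (hX : IsSmoothField X) {K : Set M}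
    (hK : IsCompact K) :
    ∃ (Y : VField E M) (S : Set M) (A : ℝ → Diffeomorph 𝓘(ℝ, E) 𝓘(ℝ, E) M M ∞),
      IsGlobalFlow Y S A ∧ ∀ y ∈ K, Y y = X y := by
  have : LocallyCompactSpace M := Manifold.locallyCompact_of_finiteDimensional 𝓘(ℝ, E)
  obtain ⟨K', hK', hKK'⟩ := exists_compact_superset hK
  obtain ⟨χ, hχ0, hχ1, -⟩ := exists_contMDiffMap_zero_one_of_isClosed (n := (⊤ : ℕ∞)) 𝓘(ℝ, E)
    isOpen_interior.isClosed_compl hK.isClosed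
    (disjoint_compl_left_iff_subset.2 hKK')
  have hY : IsSmoothField (fun x => χ x • X x) := ContMDiff.smul_section χ.contMDiff hX
  obtain ⟨A, hA⟩ := hY.exists_isGlobalFlow hK' fun x hx => by
    have : χ x = 0 := hχ0 fun h => hx (interior_subset h)
    rw [this]
    exact zero_smul ℝ (X x)
  refine ⟨_, K', A, hA, fun y hy => ?_⟩
  have : χ y = 1 := hχ1 hy
  simp only [this]
  exact one_smul ℝ (X y)

end FlowCommutator



/-! ### Transition between two Liouville flows -/

section Transition

variable {E : Type*} [NormedAddCommGroup E] [NormedSpace ℝ E]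
  {M : Type*} [MetricSpace M] [ChartedSpace E M] [IsManifold 𝓘(ℝ, E) ∞ M] {X X' Y Y' : VField E M}
  {S S' U : Set M} {A A' : ℝ → Diffeomorph 𝓘(ℝ, E) 𝓘(ℝ, E) M M ∞} {δ t : ℝ} {Ω : DiffForm E M 2}

/-- The transition `μ'_t ∘ μ_t⁻¹` between the flows of two Liouville fields preserves `Ω`, and its
generating form is `exp t • (μ_t⁻¹)^* (ι_{X'} Ω - ι_X Ω)`. -/
lemma hasGenerator_transition (hΩ : IsSymplecticForm Ω) (hX : IsLiouvilleField Ω X)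
    (hX' : IsLiouvilleField Ω X') (hA : IsGlobalFlow Y S A) (hA' : IsGlobalFlow Y' S' A')
    (hU : IsOpen U) (hY : ∀ y ∈ U, Y y = X y) (hY' : ∀ y ∈ U, Y' y = X' y) (hδ : 0 < δ)
    (ht : t ∈ Icc 0 δ) {x : M} (h : ∀ s ∈ Icc 0 t, A (-s) x ∈ U)
    (h' : ∀ s ∈ Icc 0 t, A' s (A (-t) x) ∈ U) :
    HasGenerator Ω δ (fun t x => A' t (A (-t) x)) t x
      (fun u => Real.exp t * ev1 (contract X' Ω - contract X Ω) (A (-t) x)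
        (tderiv E E (A (-t)) x u)) 1 := by
  refine ((hA'.hasGenerator hΩ hX' hU hY' hδ ht h').comp (hA'.smoothFamily δ)
    (hA.smoothFamily_neg δ) hδ ht (hA.hasGenerator_neg hΩ hX hU hY hδ ht h)).congr_right
    (fun u => ?_) (mul_inv_cancel₀ (Real.exp_ne_zero t)).symm
  rw [ev1_sub]
  ring

/-- The map `f ∘ μ_t ∘ μ'_t⁻¹ ∘ f⁻¹`, where `μ` and `μ'` are the flows `A` and `A'`. -/
def conjTransition (A A' : ℝ → Diffeomorph 𝓘(ℝ, E) 𝓘(ℝ, E) M M ∞)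
    (f : Diffeomorph 𝓘(ℝ, E) 𝓘(ℝ, E) M M ∞) (t : ℝ) (x : M) : M :=
  f (A t (A' (-t) (f.symm x)))

variable {f : Diffeomorph 𝓘(ℝ, E) 𝓘(ℝ, E) M M ∞} {Φ : ℝ → Diffeomorph 𝓘(ℝ, E) 𝓘(ℝ, E) M M ∞}
  {K : ℝ → M → ℝ}

omit [IsManifold 𝓘(ℝ, E) ∞ M] in
lemma smoothFamily_conjTransition (hA : IsGlobalFlow Y S A) (hA' : IsGlobalFlow Y' S' A') (δ : ℝ) :
    SmoothFamily E E δ (conjTransition A A' f) :=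
  (SmoothFamily.of_contMDiff f.contMDiff).comp ((hA.smoothFamily δ).comp
    ((hA'.smoothFamily_neg δ).comp (SmoothFamily.of_contMDiff f.symm.contMDiff)))

/-- The generating form of `σ_t ∘ Φ_t ∘ f ∘ σ_t⁻¹ ∘ f⁻¹`, where `σ_t = μ'_t ∘ μ_t⁻¹`, is the
difference of the pullbacks of `exp t • (ι_{X'} Ω - ι_X Ω)` by `μ_t⁻¹ ∘ Φ_t ∘ f ∘ σ_t⁻¹ ∘ f⁻¹` and
`μ'_t⁻¹ ∘ f⁻¹`, up to the differential of a function. -/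
lemma hasGenerator_twist (hΩ : IsSymplecticForm Ω) (hX : IsLiouvilleField Ω X)
    (hX' : IsLiouvilleField Ω X') (hA : IsGlobalFlow Y S A) (hA' : IsGlobalFlow Y' S' A')
    (hU : IsOpen U) (hY : ∀ y ∈ U, Y y = X y) (hY' : ∀ y ∈ U, Y' y = X' y) (hδ : 0 < δ)
    (ht : t ∈ Icc 0 δ) (hf : IsSymplecticDiffeo Ω f) (hK : SmoothFamily E ℝ δ K)
    (hΦ : SmoothFamily E E δ fun t => (Φ t : M → M))
    (hgen : ∀ x, HasGenerator Ω δ (fun t => Φ t) t x (fun u => tderiv E ℝ (K t) x u) 1) {x : M}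
    (h₁ : ∀ s ∈ Icc 0 t, A' (-s) (f.symm x) ∈ U)
    (h₂ : ∀ s ∈ Icc 0 t, A s (A' (-t) (f.symm x)) ∈ U)
    (h₃ : ∀ s ∈ Icc 0 t, A (-s) (Φ t (conjTransition A A' f t x)) ∈ U)
    (h₄ : ∀ s ∈ Icc 0 t, A' s (A (-t) (Φ t (conjTransition A A' f t x))) ∈ U) :
    HasGenerator Ω δ (fun t x => A' t (A (-t) (Φ t (conjTransition A A' f t x)))) t x
      (fun u => Real.exp t * (ev1 (contract X' Ω - contract X Ω)
          (A (-t) (Φ t (conjTransition A A' f t x)))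
          (tderiv E E (fun y => A (-t) (Φ t (conjTransition A A' f t y))) x u) -
        ev1 (contract X' Ω - contract X Ω) (A' (-t) (f.symm x))
          (tderiv E E (fun y => A' (-t) (f.symm y)) x u)) +
        tderiv E ℝ (fun y => K t (conjTransition A A' f t y)) x u) 1 := by
  have sf : SmoothFamily E E δ fun _ => (f : M → M) := .of_contMDiff f.contMDiff
  have sf' : SmoothFamily E E δ fun _ => (f.symm : M → M) := .of_contMDiff f.symm.contMDiff
  have sσ := (hA'.smoothFamily δ).comp (hA.smoothFamily_neg δ)
  have sσ' := (hA.smoothFamily δ).comp (hA'.smoothFamily_neg δ)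
  have sr : SmoothFamily E E δ (conjTransition A A' f) := smoothFamily_conjTransition hA hA' δ
  have g1 := hasGenerator_const f.symm.contMDiff (fun x u w => hf.symm.ev2_eq x u w) hδ ht x
  have g2 := (hasGenerator_transition hΩ hX' hX hA' hA hU hY' hY hδ ht h₁ h₂).comp sσ' sf' hδ ht g1
  have g3 : HasGenerator Ω δ (conjTransition A A' f) t x _ _ :=
    (hasGenerator_const f.contMDiff (fun x u w => hf.ev2_eq x u w) hδ ht _).comp sf
      (sσ'.comp sf') hδ ht g2
  have g4 := (hgen _).comp hΦ sr hδ ht g3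
  have g5 := (hasGenerator_transition hΩ hX hX' hA hA' hU hY hY' hδ ht h₃ h₄).comp sσ
    (hΦ.comp sr) hδ ht g4
  refine g5.congr_right (fun u => ?_) (by norm_num)
  rw [tderiv_comp ((hA.smoothFamily_neg δ).mdifferentiableAt ht _)
      ((hΦ.comp sr).mdifferentiableAt ht x),
    tderiv_comp ((hA'.smoothFamily_neg δ).mdifferentiableAt ht _) (sf'.mdifferentiableAt ht x),
    tderiv_comp (hK.mdifferentiableAt ht _) (sr.mdifferentiableAt ht x)]
  simp only [ev1_sub, ContinuousLinearMap.comp_apply]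
  ring

end Transition

section Bounds

variable {E : Type*} [NormedAddCommGroup E] [NormedSpace ℝ E]
  {M : Type*} [MetricSpace M] [ChartedSpace E M] {X X' Y Y' : VField E M}
  {T T' S Q₁ Q₂ U : Set M} {A A' : ℝ → Diffeomorph 𝓘(ℝ, E) 𝓘(ℝ, E) M M ∞} {δ ε ρ t : ℝ}
  {Ω : DiffForm E M 2} {f g : Diffeomorph 𝓘(ℝ, E) 𝓘(ℝ, E) M M ∞}
  {Φ : ℝ → Diffeomorph 𝓘(ℝ, E) 𝓘(ℝ, E) M M ∞} {K : ℝ → M → ℝ}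

/-- Smallness conditions on `[0, δ]`, at the scale `ε`: the flows `A` and `A'` move points by little,
`f⁻¹` is close to `g`, and `Φ_t ∘ f ∘ μ_t ∘ μ'_t⁻¹ ∘ f⁻¹` to the identity; `f`, `g` and `Φ_t` are
supported in `S`, and the `ε`-neighbourhoods of `S` and `Q₂` are contained in `Q₁` and `U`. -/
structure TwistBounds (δ ε : ℝ) (S Q₁ Q₂ U : Set M)
    (A A' : ℝ → Diffeomorph 𝓘(ℝ, E) 𝓘(ℝ, E) M M ∞) (f g : Diffeomorph 𝓘(ℝ, E) 𝓘(ℝ, E) M M ∞)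
    (Φ : ℝ → Diffeomorph 𝓘(ℝ, E) 𝓘(ℝ, E) M M ∞) : Prop where
  dist_flow : ∀ s, |s| ≤ δ → ∀ x, dist (A s x) x < ε / 3
  dist_flow' : ∀ s, |s| ≤ δ → ∀ x, dist (A' s x) x < ε / 3
  dist_symm : ∀ x, dist (f.symm x) (g x) < ε / 3
  dist_conj : ∀ t ∈ Icc 0 δ, ∀ x, dist (Φ t (conjTransition A A' f t x)) x < ε / 3
  supp : ∀ x, x ∉ S → f x = x
  supp' : ∀ x, x ∉ S → g x = x
  supp_isotopy : ∀ t ∈ Icc 0 δ, ∀ x, x ∉ S → Φ t x = x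
  isCompact : IsCompact S
  thickening : ∀ x ∈ S, ∀ y, dist y x < ε → y ∈ Q₁
  thickening' : ∀ x ∈ Q₂, ∀ y, dist y x < ε → y ∈ U
  subset : S ⊆ Q₂

variable (h : TwistBounds δ ε S Q₁ Q₂ U A A' f g Φ)

lemma abs_le_of_mem_Icc {s t δ : ℝ} (ht : t ∈ Icc 0 δ) (hs : s ∈ Icc 0 t) :
    |s| ≤ δ ∧ |-s| ≤ δ := by
  rw [abs_neg, abs_of_nonneg hs.1]
  exact ⟨hs.2.trans ht.2, hs.2.trans ht.2⟩

include h

lemma TwistBounds.symm_mem {x : M} (hx : x ∈ Q₂) : f.symm x ∈ Q₂ :=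
  mapsTo_of_homeoSupport_subset f.symm.toHomeomorph ((homeoSupport_subset h.isCompact.isClosed
    fun y hy => Diffeomorph.symm_eq_self (h.supp y hy)).trans h.subset) hx

lemma TwistBounds.mem {x : M} (hx : x ∈ Q₂) : g x ∈ Q₂ :=
  mapsTo_of_homeoSupport_subset g.toHomeomorph ((homeoSupport_subset h.isCompact.isClosed
    h.supp').trans h.subset) hx

lemma TwistBounds.orbits_mem (ht : t ∈ Icc 0 δ) {x : M} (hx : x ∈ Q₂) {s : ℝ} (hs : s ∈ Icc 0 t) :
    A' (-s) (f.symm x) ∈ U ∧ A s (A' (-t) (f.symm x)) ∈ U ∧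
      A (-s) (Φ t (conjTransition A A' f t x)) ∈ U ∧
      A' s (A (-t) (Φ t (conjTransition A A' f t x))) ∈ U := by
  obtain ⟨s1, s2⟩ := abs_le_of_mem_Icc ht hs
  obtain ⟨-, t2⟩ := abs_le_of_mem_Icc ht (s := t) ⟨ht.1, le_rfl⟩
  have hc := h.dist_conj t ht x
  set z := Φ t (conjTransition A A' f t x)
  refine ⟨h.thickening' _ (h.symm_mem hx) _ ?_, h.thickening' _ (h.symm_mem hx) _ ?_,
    h.thickening' _ hx _ ?_, h.thickening' _ hx _ ?_⟩
  · linarith [h.dist_flow' _ s2 (f.symm x), dist_nonneg (x := A' (-s) (f.symm x)) (y := f.symm x)]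
  · linarith [h.dist_flow' _ t2 (f.symm x), h.dist_flow _ s1 (A' (-t) (f.symm x)),
      dist_triangle (A s (A' (-t) (f.symm x))) (A' (-t) (f.symm x)) (f.symm x),
      dist_nonneg (x := z) (y := x)]
  · linarith [h.dist_flow _ s2 z, dist_triangle (A (-s) z) z x, dist_nonneg (x := z) (y := x)]
  · linarith [h.dist_flow _ t2 z, h.dist_flow' _ s1 (A (-t) z), dist_triangle (A (-t) z) z x,
      dist_triangle (A' s (A (-t) z)) (A (-t) z) x]

lemma TwistBounds.dist_lt (ht : t ∈ Icc 0 δ) (x : M) :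
    dist (A (-t) (Φ t (conjTransition A A' f t x))) x < ε ∧
      dist (A' (-t) (f.symm x)) (g x) < ε := by
  obtain ⟨-, t2⟩ := abs_le_of_mem_Icc ht (s := t) ⟨ht.1, le_rfl⟩
  have hc := h.dist_conj t ht x
  set z := Φ t (conjTransition A A' f t x)
  constructor
  · linarith [h.dist_flow _ t2 z, dist_triangle (A (-t) z) z x, dist_nonneg (x := z) (y := x)]
  · linarith [h.dist_flow' _ t2 (f.symm x), dist_triangle (A' (-t) (f.symm x)) (f.symm x) (g x),
      h.dist_symm x, dist_nonneg (x := z) (y := x)]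

/-- Off `Q₁` the maps `f`, `g` and `Φ_t` have no effect. -/
lemma TwistBounds.eq_off (hA : IsGlobalFlow Y T A) (ht : t ∈ Icc 0 δ) {x : M} (hx : x ∉ Q₁) :
    f.symm x = x ∧ g x = x ∧ conjTransition A A' f t x ∉ S ∧
      A (-t) (Φ t (conjTransition A A' f t x)) = A' (-t) x := by
  obtain ⟨t1, t2⟩ := abs_le_of_mem_Icc ht (s := t) ⟨ht.1, le_rfl⟩
  have hε : 0 < ε := by
    linarith [h.dist_flow _ t1 x, dist_nonneg (x := A t x) (y := x)]
  have hxS : x ∉ S := fun hxS => hx (h.thickening x hxS x (by rwa [dist_self]))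
  have hf : f.symm x = x := Diffeomorph.symm_eq_self (h.supp x hxS)
  have hz : A t (A' (-t) x) ∉ S := fun hz => hx (h.thickening _ hz _ (by
    rw [dist_comm]
    linarith [h.dist_flow' _ t2 x, h.dist_flow _ t1 (A' (-t) x),
      dist_triangle (A t (A' (-t) x)) (A' (-t) x) x]))
  have hr : conjTransition A A' f t x = A t (A' (-t) x) := by
    unfold conjTransition
    rw [hf, h.supp _ hz]
  refine ⟨hf, h.supp' x hxS, by rwa [hr], ?_⟩
  rw [hr, h.supp_isotopy t ht _ hz, hA.neg_apply]

end Bounds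

/-! ### Uniform convergence of increments -/

section Convergence

variable {X : Type*} [MetricSpace X] {δ : ℝ}

/-- The limit is uniformly continuous, being continuous with compact support. -/
lemma UnifConv.of_compact_support {F : ℕ → ℝ → X → ℝ} {f : ℝ → X → ℝ} {Q : Set X}
    (hQ : IsCompact Q)
    (hF : ∀ n, ContinuousOn (fun p : ℝ × X => F n p.1 p.2) (Icc 0 δ ×ˢ univ))
    (hFQ : ∀ n, ∀ t ∈ Icc 0 δ, ∀ x, x ∉ Q → F n t x = 0)
    (h : TendstoUniformlyOn (fun n (p : ℝ × X) => F n p.1 p.2) (fun p => f p.1 p.2) atTop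
      (Icc 0 δ ×ˢ univ)) : UnifConv δ F f := by
  refine ⟨uniformContinuousOn_of_eq_off_compact (g := fun _ => 0)
    (h.continuousOn (Frequently.of_forall hF)) uniformContinuous_const hQ fun t ht x hx => ?_, h⟩
  have h1 := h.tendsto_at (x := (t, x)) ⟨ht, mem_univ _⟩
  simp only [hFQ _ t ht x hx] at h1
  exact tendsto_nhds_unique h1 tendsto_const_nhds

/-- If a sequence of families converges to one that starts at the identity, its terms with large
indices are close to the identity for small times. -/
lemma UnifConv.exists_dist_lt {F : ℕ → ℝ → X → X} {f : ℝ → X → X} (hδ : 0 < δ) (h : UnifConv δ F f)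
    (h0 : ∀ x, f 0 x = x) {ε : ℝ} (hε : 0 < ε) :
    ∃ τ > 0, ∃ N, ∀ n ≥ N, ∀ t ∈ Icc 0 δ, t ≤ τ → ∀ x, dist (F n t x) x < ε := by
  obtain ⟨η, hη, h1⟩ := Metric.uniformContinuousOn_iff.1 h.unifCont (ε / 2) (half_pos hε)
  obtain ⟨N, hN⟩ := eventually_atTop.1
    (Metric.tendstoUniformlyOn_iff.1 h.tendsto (ε / 2) (half_pos hε))
  refine ⟨η / 2, half_pos hη, N, fun n hn t ht htη x => ?_⟩
  have h2 := h1 (t, x) ⟨ht, mem_univ _⟩ (0, x) ⟨⟨le_rfl, hδ.le⟩, mem_univ _⟩ (by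
    rw [Prod.dist_eq, dist_self, Real.dist_eq, sub_zero, abs_of_nonneg ht.1]
    exact max_lt (by linarith) hη)
  have h3 := hN n hn (t, x) ⟨ht, mem_univ _⟩
  simp only [h0] at h2
  rw [dist_comm] at h3
  simp only at h3
  linarith [dist_triangle (F n t x) (f t x) x]

variable {E : Type*} [NormedAddCommGroup E] [NormedSpace ℝ E] [ChartedSpace E X] {ρ : ℝ}
  {α : DiffForm E X 1} {Q Q' R : Set X} {b : X → X → ℝ} {g : X → X}

lemma IsIncrement.tendstoUniformlyOn (hb : IsIncrement α Q ρ b) (hρ : 0 < ρ) (hQ : IsCompact Q)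
    (hQ' : IsCompact Q') {p : ℕ → ℝ → X → X} {p' : ℝ → X → X} (hp : UnifConv δ p p')
    (hg : ∀ x ∈ R, g x ∈ Q)
    (h : ∀ n, ∀ t ∈ Icc 0 δ, ∀ x ∈ R, p n t x ∈ Q' ∧ dist (p n t x) (g x) ≤ ρ / 2) :
    TendstoUniformlyOn (fun n (q : ℝ × X) => b (g q.2) (p n q.1 q.2))
      (fun q => b (g q.2) (p' q.1 q.2)) atTop (Icc 0 δ ×ˢ R) := by
  let D : Set (X × X) := (Q ×ˢ Q') ∩ {q | dist q.2 q.1 ≤ ρ / 2}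
  have hD : IsCompact D :=
    (hQ.prod hQ').inter_right (isClosed_le (continuous_snd.dist continuous_fst) continuous_const)
  have huc := hD.uniformContinuousOn_of_continuous (hb.continuousOn.mono (t := D) fun q hq =>
    ⟨hq.1.1, lt_of_le_of_lt hq.2 (by linarith)⟩)
  refine Metric.tendstoUniformlyOn_iff.2 fun ε hε => ?_
  obtain ⟨η, hη, h1⟩ := Metric.uniformContinuousOn_iff.1 huc ε hε
  filter_upwards [Metric.tendstoUniformlyOn_iff.1 hp.tendsto η hη] with n hn q hq
  have hmem : ∀ n, (g q.2, p n q.1 q.2) ∈ D := fun n =>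
    ⟨⟨hg _ hq.2, (h n _ hq.1 _ hq.2).1⟩, (h n _ hq.1 _ hq.2).2⟩
  have hlim : Tendsto (fun n => (g q.2, p n q.1 q.2)) atTop (𝓝 (g q.2, p' q.1 q.2)) :=
    tendsto_const_nhds.prodMk_nhds (hp.tendsto.tendsto_at ⟨hq.1, mem_univ _⟩)
  refine h1 (g q.2, p' q.1 q.2) (hD.isClosed.mem_of_tendsto hlim (Eventually.of_forall hmem))
    (g q.2, p n q.1 q.2) (hmem n) ?_
  rw [Prod.dist_eq, dist_self]
  exact max_lt hη (hn q ⟨hq.1, mem_univ _⟩)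

end Convergence



/-! ### Hamiltonian functions of the comparison isotopies -/

section TwistHamiltonian

variable {E : Type*} [NormedAddCommGroup E] [NormedSpace ℝ E]
  {M : Type*} [MetricSpace M] [ChartedSpace E M] [IsManifold 𝓘(ℝ, E) ∞ M] {X X' Y Y' : VField E M}
  {T T' S Q₁ Q₂ U L : Set M} {A A' : ℝ → Diffeomorph 𝓘(ℝ, E) 𝓘(ℝ, E) M M ∞} {δ ε ρ t : ℝ}
  {Ω : DiffForm E M 2} {α : DiffForm E M 1} {f g : Diffeomorph 𝓘(ℝ, E) 𝓘(ℝ, E) M M ∞}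
  {Φ : ℝ → Diffeomorph 𝓘(ℝ, E) 𝓘(ℝ, E) M M ∞} {K : ℝ → M → ℝ} {b : M → M → ℝ} {P : M → ℝ}

/-- The sum of the increments of the primitives of `α` from `x` to `μ_t⁻¹ (Φ_t (r x))`, where
`r = f ∘ μ_t ∘ μ'_t⁻¹ ∘ f⁻¹`, and from `μ'_t⁻¹ (f⁻¹ x)` to `g x`. -/
def incrementSum (b : M → M → ℝ) (A A' : ℝ → Diffeomorph 𝓘(ℝ, E) 𝓘(ℝ, E) M M ∞)
    (f g : Diffeomorph 𝓘(ℝ, E) 𝓘(ℝ, E) M M ∞) (Φ : ℝ → Diffeomorph 𝓘(ℝ, E) 𝓘(ℝ, E) M M ∞)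
    (t : ℝ) (x : M) : ℝ :=
  b x (A (-t) (Φ t (conjTransition A A' f t x))) - b (g x) (A' (-t) (f.symm x))

omit [IsManifold 𝓘(ℝ, E) ∞ M] in
lemma TwistBounds.incrementSum_eq_zero (h : TwistBounds δ ε S Q₁ Q₂ U A A' f g Φ)
    (hA : IsGlobalFlow Y T A) (ht : t ∈ Icc 0 δ) {x : M} (hx : x ∉ Q₁) :
    incrementSum b A A' f g Φ t x = 0 := by
  obtain ⟨h1, h2, -, h4⟩ := h.eq_off hA ht hx
  unfold incrementSum
  rw [h4, h2, h1, sub_self]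

omit [IsManifold 𝓘(ℝ, E) ∞ M] in
lemma TwistBounds.smoothFamily_incrementSum (h : TwistBounds δ ε S Q₁ Q₂ U A A' f g Φ)
    (hA : IsGlobalFlow Y T A) (hA' : IsGlobalFlow Y' T' A') (hb : IsIncrement α Q₂ ρ b)
    (hερ : ε ≤ ρ) (hQ₁ : IsClosed Q₁) (hQ : Q₁ ⊆ interior Q₂)
    (hΦ : SmoothFamily E E δ fun t => (Φ t : M → M)) :
    SmoothFamily E ℝ δ (incrementSum b A A' f g Φ) := by
  rintro ⟨t, x⟩ ⟨ht, -⟩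
  have ht : t ∈ Icc 0 δ := ht
  by_cases hx : x ∈ Q₁
  · have hx2 : Q₂ ∈ 𝓝 x := mem_interior_iff_mem_nhds.1 (hQ hx)
    have h1 := hb.contMDiffWithinAt (g := fun y => y) contMDiff_id ((hA.smoothFamily_neg δ).comp
      (hΦ.comp (smoothFamily_conjTransition (f := f) hA hA' δ))) ht hx2
      ((h.dist_lt ht x).1.trans_le hερ)
    have h2 := hb.contMDiffWithinAt g.contMDiff ((hA'.smoothFamily_neg δ).comp
      (SmoothFamily.of_contMDiff f.symm.contMDiff)) ht (by
        filter_upwards [hx2] with y hy using h.mem hy) ((h.dist_lt ht x).2.trans_le hερ)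
    exact h1.sub h2
  · refine contMDiffWithinAt_const (c := (0 : ℝ)) |>.congr_of_eventuallyEq ?_
      (h.incrementSum_eq_zero hA ht hx)
    have hsnd : Tendsto (fun q : ℝ × M => q.2) (𝓝[Icc 0 δ ×ˢ univ] (t, x)) (𝓝 x) :=
      continuous_snd.continuousAt.mono_left nhdsWithin_le_nhds
    filter_upwards [hsnd (hQ₁.isOpen_compl.mem_nhds hx), eventually_mem_nhdsWithin] with q h1 h2
    exact h.incrementSum_eq_zero hA h2.1 h1

/-- The isotopy `σ_t ∘ Φ_t ∘ f ∘ σ_t⁻¹ ∘ f⁻¹`, where `σ_t = μ'_t ∘ μ_t⁻¹`, is generated by an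
explicit function. Its terms are the increments of local primitives of `α = ι_{X'} Ω - ι_X Ω`, a primitive `P`
of `α - g^* α`, and the function `K` of `Φ`. -/
lemma TwistBounds.hasGenerator (h : TwistBounds δ ε S Q₁ Q₂ U A A' f g Φ)
    (hΩ : IsSymplecticForm Ω) (hX : IsLiouvilleField Ω X) (hX' : IsLiouvilleField Ω X')
    (hA : IsGlobalFlow Y T A) (hA' : IsGlobalFlow Y' T' A') (hU : IsOpen U)
    (hY : ∀ y ∈ U, Y y = X y) (hY' : ∀ y ∈ U, Y' y = X' y)
    (hb : IsIncrement (contract X' Ω - contract X Ω) Q₂ ρ b)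
    (hερ : ε ≤ ρ) (hQ₁ : IsClosed Q₁) (hQ : Q₁ ⊆ interior Q₂) (hδ : 0 < δ)
    (hP : ContMDiff 𝓘(ℝ, E) 𝓘(ℝ, ℝ) ∞ P)
    (hdP : ∀ x u, tderiv E ℝ P x u = ev1 (contract X' Ω - contract X Ω) x u -
      ev1 (contract X' Ω - contract X Ω) (g x) (tderiv E E g x u))
    (hf : IsSymplecticDiffeo Ω f) (hK : SmoothFamily E ℝ δ K)
    (hKS : ∀ t ∈ Icc 0 δ, ∀ x, x ∉ S → K t x = 0)
    (hΦ : SmoothFamily E E δ fun t => (Φ t : M → M))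
    (hgen : ∀ t ∈ Icc 0 δ, ∀ x,
      HasGenerator Ω δ (fun t => Φ t) t x (fun u => tderiv E ℝ (K t) x u) 1)
    (ht : t ∈ Icc 0 δ) (x : M) :
    HasGenerator Ω δ (fun t x => A' t (A (-t) (Φ t (conjTransition A A' f t x)))) t x
      (fun u => tderiv E ℝ (fun y => Real.exp t * (P y + incrementSum b A A' f g Φ t y) +
        K t (conjTransition A A' f t y)) x u) 1 := by
  have sr : SmoothFamily E E δ (conjTransition A A' f) := smoothFamily_conjTransition hA hA' δ
  have dP : MDifferentiableAt 𝓘(ℝ, E) 𝓘(ℝ, ℝ) P x := (hP x).mdifferentiableAt (by simp)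
  -- near `Q₁` all orbits stay in `U` and all increments are defined; off `Q₁` the isotopy is the
  -- identity, and `dP = α - g^* α` vanishes
  by_cases hx : x ∈ Q₁
  · have hx2 : Q₂ ∈ 𝓝 x := mem_interior_iff_mem_nhds.1 (hQ hx)
    have hxQ : x ∈ Q₂ := mem_of_mem_nhds hx2
    refine (hasGenerator_twist hΩ hX hX' hA hA' hU hY hY' hδ ht hf hK hΦ (hgen t ht)
      (fun s hs => (h.orbits_mem ht hxQ hs).1) (fun s hs => (h.orbits_mem ht hxQ hs).2.1)
      (fun s hs => (h.orbits_mem ht hxQ hs).2.2.1)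
      (fun s hs => (h.orbits_mem ht hxQ hs).2.2.2)).congr_right (fun u => ?_) rfl
    have dp := ((hA.smoothFamily_neg δ).comp (hΦ.comp sr)).mdifferentiableAt ht x
    have dq := ((hA'.smoothFamily_neg δ).comp
      (SmoothFamily.of_contMDiff f.symm.contMDiff)).mdifferentiableAt ht x
    obtain ⟨i1, i2⟩ := hb.tderiv_eq (g := fun y => y) contMDiff_id dp hx2
      ((h.dist_lt ht x).1.trans_le hερ)
    obtain ⟨j1, j2⟩ := hb.tderiv_eq g.contMDiff dq (by
      filter_upwards [hx2] with y hy using h.mem hy) ((h.dist_lt ht x).2.trans_le hερ)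
    have dK : MDifferentiableAt 𝓘(ℝ, E) 𝓘(ℝ, ℝ) (fun y => K t (conjTransition A A' f t y)) x :=
      (hK.mdifferentiableAt ht _).comp x (sr.mdifferentiableAt ht x)
    have e : tderiv E ℝ (fun y => Real.exp t * (P y + incrementSum b A A' f g Φ t y) +
        K t (conjTransition A A' f t y)) x = Real.exp t • (tderiv E ℝ P x +
          (tderiv E ℝ (fun y => b y (A (-t) (Φ t (conjTransition A A' f t y)))) x -
            tderiv E ℝ (fun y => b (g y) (A' (-t) (f.symm y))) x)) +
          tderiv E ℝ (fun y => K t (conjTransition A A' f t y)) x :=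
      (((dP.hasMFDerivAt.add (i1.hasMFDerivAt.sub j1.hasMFDerivAt)).const_smul
        (Real.exp t)).add dK.hasMFDerivAt).mfderiv
    rw [e]
    have i3 := i2 u
    have j3 := j2 u
    have p3 := hdP x u
    rw [tderiv_id] at i3
    simp only [add_apply, smul_apply, sub_apply,
      smul_eq_mul]
    rw [i3, j3, p3, ContinuousLinearMap.id_apply]
    ring
  · have hx' : ∀ᶠ y in 𝓝 x, y ∉ Q₁ := hQ₁.isOpen_compl.mem_nhds hx
    have s1 : SmoothFamily E E δ fun (_ : ℝ) (x : M) => x := .of_contMDiff contMDiff_id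
    have hid : ∀ x u w, ev2 Ω x (tderiv E E (fun y : M => y) x u)
        (tderiv E E (fun y : M => y) x w) = ev2 Ω x u w := fun x u w => by
      rw [tderiv_id]; rfl
    refine ((hasGenerator_const (f := fun y : M => y) contMDiff_id hid hδ ht x).congr s1 hδ ht
      fun s hs => ?_).congr_right (fun u => ?_) rfl
    · filter_upwards [hx'] with y hy
      rw [(h.eq_off hA hs hy).2.2.2, hA'.apply_neg]
    · have e1 : (fun y => Real.exp t * (P y + incrementSum b A A' f g Φ t y) +
          K t (conjTransition A A' f t y)) =ᶠ[𝓝 x] fun y => Real.exp t * P y := by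
        filter_upwards [hx'] with y hy
        rw [h.incrementSum_eq_zero hA ht hy, hKS t ht _ (h.eq_off hA ht hy).2.2.1, add_zero,
          add_zero]
      have e2 : (g : M → M) =ᶠ[𝓝 x] fun y => y := by
        filter_upwards [hx'] with y hy using (h.eq_off hA ht hy).2.1
      have e3 : tderiv E ℝ (fun y => Real.exp t * P y) x = Real.exp t • tderiv E ℝ P x :=
        (dP.hasMFDerivAt.const_smul (Real.exp t)).mfderiv
      have p3 := hdP x u
      rw [tderiv_congr e2, tderiv_id, e2.eq_of_nhds] at p3
      rw [tderiv_congr e1, e3]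
      change Real.exp t * tderiv E ℝ P x u = 0
      rw [p3]
      exact mul_eq_zero_of_right _ (sub_self _)

end TwistHamiltonian

section Shift

variable {E : Type*} [NormedAddCommGroup E] [NormedSpace ℝ E]
  {M : Type*} [MetricSpace M] [ChartedSpace E M] {δ : ℝ} {Ω : DiffForm E M 2}

lemma SymplecticApprox.shift {φ : M ≃ₜ M} {S : Set M}
    {f : ℕ → Diffeomorph 𝓘(ℝ, E) 𝓘(ℝ, E) M M ∞} (h : SymplecticApprox Ω φ S f) (N : ℕ) :
    SymplecticApprox Ω φ S (fun n => f (n + N)) :=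
  ⟨h.compact, fun _ => h.symplectic _, fun _ => h.supp _, fun δ => (h.conv δ).subseq N,
    fun δ => (h.conv_symm δ).subseq N⟩

lemma HamiltonianApprox.shift {φ ψ : ℝ → M → M} {S : Set M} {K : ℕ → ℝ → M → ℝ}
    {Φ : ℕ → ℝ → Diffeomorph 𝓘(ℝ, E) 𝓘(ℝ, E) M M ∞} {k : ℝ → M → ℝ}
    (h : HamiltonianApprox Ω δ φ ψ S K Φ k) (N : ℕ) :
    HamiltonianApprox Ω δ φ ψ S (fun n => K (n + N)) (fun n => Φ (n + N)) k :=
  ⟨h.compact, fun _ => h.smooth_fun _, fun _ => h.supp_fun _, fun _ => h.smooth _,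
    fun _ => h.smooth_symm _, fun _ => h.init _, fun _ => h.supp _, fun _ => h.generator _,
    h.conv_fun.subseq N, h.conv.subseq N, h.conv_symm.subseq N, h.right_inv, h.left_inv⟩

end Shift



/-! ### Limits of the comparison isotopies -/

section TwistLimit

variable {E : Type*} [NormedAddCommGroup E] [NormedSpace ℝ E]
  {M : Type*} [MetricSpace M] [ChartedSpace E M] [IsManifold 𝓘(ℝ, E) ∞ M] {X X' Y Y' : VField E M}
  {T T' S S₁ S₂ Q₁ Q₂ Q₃ U L : Set M} {A A' : ℝ → Diffeomorph 𝓘(ℝ, E) 𝓘(ℝ, E) M M ∞}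
  {δ ε ρ t : ℝ} {Ω : DiffForm E M 2} {α : DiffForm E M 1}
  {g : Diffeomorph 𝓘(ℝ, E) 𝓘(ℝ, E) M M ∞} {b : M → M → ℝ} {P : M → ℝ}
  {φ : M ≃ₜ M} {f : ℕ → Diffeomorph 𝓘(ℝ, E) 𝓘(ℝ, E) M M ∞} {ξ ψ : ℝ → M → M}
  {K : ℕ → ℝ → M → ℝ} {Φ : ℕ → ℝ → Diffeomorph 𝓘(ℝ, E) 𝓘(ℝ, E) M M ∞} {k : ℝ → M → ℝ}

omit [IsManifold 𝓘(ℝ, E) ∞ M] in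
/-- The functions `exp t * (P + incrementSum)` converge uniformly. -/
lemma unifConv_incrementSum (h : ∀ n, TwistBounds δ ε S Q₁ Q₂ U A A' (f n) g (Φ n))
    (hf : SymplecticApprox Ω φ S₁ f) (hΦ : HamiltonianApprox Ω δ ξ ψ S₂ K Φ k)
    (hA : IsGlobalFlow Y T A) (hA' : IsGlobalFlow Y' T' A') (hb : IsIncrement α Q₂ ρ b)
    (hερ : ε ≤ ρ / 2) (hρ : 0 < ρ) (hQ₁ : IsCompact Q₁) (hQ₂ : IsCompact Q₂) (hQ₃ : IsCompact Q₃)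
    (hQ : Q₁ ⊆ interior Q₂) (hUQ : U ⊆ Q₃) (hP : ContMDiff 𝓘(ℝ, E) 𝓘(ℝ, ℝ) ∞ P)
    (hL : IsCompact L) (hPL : ∀ x, x ∉ L → P x = 0) :
    UnifConv δ (fun n t x => Real.exp t * (P x + incrementSum b A A' (f n) g (Φ n) t x))
      (fun t x => Real.exp t * (P x +
        (b x (A (-t) (ξ t (φ (A t (A' (-t) (φ.symm x)))))) - b (g x) (A' (-t) (φ.symm x))))) := by
  have cq : UnifConv δ (fun n t x => A' (-t) ((f n).symm x)) (fun t x => A' (-t) (φ.symm x)) :=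
    (hA'.unifConv_neg δ).comp (hf.conv_symm δ)
  have cr : UnifConv δ (fun n t x => conjTransition A A' (f n) t x)
      (fun t x => φ (A t (A' (-t) (φ.symm x)))) := (hf.conv δ).comp ((hA.unifConv δ).comp cq)
  have cp := (hA.unifConv_neg δ).comp (hΦ.conv.comp cr)
  have hQ₁₂ : Q₁ ⊆ Q₂ := hQ.trans interior_subset
  refine UnifConv.of_compact_support (hQ₁.union hL) (fun n => ?_) (fun n t ht x hx => ?_) ?_
  · have h1 := ((h n).smoothFamily_incrementSum hA hA' hb (by linarith) hQ₁.isClosed hQ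
      (hΦ.smooth n)).continuousOn
    exact ((Real.continuous_exp.comp continuous_fst).continuousOn).mul
      ((hP.continuous.comp continuous_snd).continuousOn.add h1)
  · rw [mem_union, not_or] at hx
    rw [hPL x hx.2, (h n).incrementSum_eq_zero hA ht hx.1, add_zero, mul_zero]
  · have u1 := hb.tendstoUniformlyOn (R := Q₁) (g := fun x => x) hρ hQ₂ hQ₃ cp
      (fun x hx => hQ₁₂ hx) fun n t ht x hx => by
        have h1 := ((h n).orbits_mem ht (hQ₁₂ hx) ⟨le_rfl, ht.1⟩).2.2.2
        rw [hA'.zero] at h1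
        exact ⟨hUQ h1, ((h n).dist_lt ht x).1.le.trans hερ⟩
    have u2 := hb.tendstoUniformlyOn (R := Q₁) (g := g) hρ hQ₂ hQ₃ cq
      (fun x hx => (h 0).mem (hQ₁₂ hx)) fun n t ht x hx => by
        have h1 := ((h n).orbits_mem ht (hQ₁₂ hx) ⟨le_rfl, ht.1⟩).2.1
        rw [hA.zero] at h1
        exact ⟨hUQ h1, ((h n).dist_lt ht x).2.le.trans hερ⟩
    refine Metric.tendstoUniformlyOn_iff.2 fun η hη => ?_
    have hη' : 0 < η / Real.exp δ := div_pos hη (Real.exp_pos δ)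
    filter_upwards [Metric.tendstoUniformlyOn_iff.1 (u1.sub u2) _ hη'] with n hn q hq
    obtain ⟨t, x⟩ := q
    have ht : t ∈ Icc 0 δ := hq.1
    by_cases hx : x ∈ Q₁
    · have h1 := hn (t, x) ⟨ht, hx⟩
      rw [Real.dist_eq] at h1 ⊢
      change |Real.exp t * (P x + (_ - _)) - Real.exp t * (P x + (_ - _))| < η
      rw [← mul_sub, add_sub_add_left_eq_sub, abs_mul, abs_of_pos (Real.exp_pos t)]
      calc _ ≤ Real.exp δ * _ :=
            mul_le_mul_of_nonneg_right (Real.exp_le_exp.2 ht.2) (abs_nonneg _)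
        _ < Real.exp δ * (η / Real.exp δ) := mul_lt_mul_of_pos_left h1 (Real.exp_pos δ)
        _ = η := mul_div_cancel₀ _ (Real.exp_ne_zero δ)
    · have e1 := cp.eq_of_forall_eq ht fun n => ((h n).eq_off hA ht hx).2.2.2
      have e2 := cq.eq_of_forall_eq (y := A' (-t) x) ht fun n => by
        rw [((h n).eq_off hA ht hx).1]
      simp only [(h n).incrementSum_eq_zero hA ht hx]
      rw [e1, e2, ((h n).eq_off hA ht hx).2.1, sub_self, dist_self]
      exact hη

/-- The limit of the isotopies `σ_t ∘ Φ_t ∘ f ∘ σ_t⁻¹ ∘ f⁻¹`, where `σ_t = μ'_t ∘ μ_t⁻¹`. -/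
theorem exists_hamiltonianApprox_twist
    (h : ∀ n, TwistBounds δ ε S Q₁ Q₂ U A A' (f n) g (Φ n))
    (hf : SymplecticApprox Ω φ S₁ f) (hΦ : HamiltonianApprox Ω δ ξ ψ S₂ K Φ k) (hS : S₂ ⊆ S)
    (hΩ : IsSymplecticForm Ω) (hX : IsLiouvilleField Ω X) (hX' : IsLiouvilleField Ω X')
    (hA : IsGlobalFlow Y T A) (hA' : IsGlobalFlow Y' T' A') (hU : IsOpen U)
    (hY : ∀ y ∈ U, Y y = X y) (hY' : ∀ y ∈ U, Y' y = X' y)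
    (hb : IsIncrement (contract X' Ω - contract X Ω) Q₂ ρ b)
    (hερ : ε ≤ ρ / 2) (hρ : 0 < ρ) (hQ₁ : IsCompact Q₁) (hQ₂ : IsCompact Q₂) (hQ₃ : IsCompact Q₃)
    (hQ : Q₁ ⊆ interior Q₂) (hUQ : U ⊆ Q₃) (hδ : 0 < δ)
    (hP : ContMDiff 𝓘(ℝ, E) 𝓘(ℝ, ℝ) ∞ P) (hL : IsCompact L) (hPL : ∀ x, x ∉ L → P x = 0)
    (hdP : ∀ x u, tderiv E ℝ P x u = ev1 (contract X' Ω - contract X Ω) x u -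
      ev1 (contract X' Ω - contract X Ω) (g x) (tderiv E E g x u)) :
    ∃ ψ' S' K' Φ' k', HamiltonianApprox Ω δ
      (fun t x => A' t (A (-t) (ξ t (φ (A t (A' (-t) (φ.symm x))))))) ψ' S' K' Φ' k' := by
  have cf := hf.conv δ
  have cf' := hf.conv_symm δ
  have cr : UnifConv δ (fun n t x => conjTransition A A' (f n) t x)
      (fun t x => φ (A t (A' (-t) (φ.symm x)))) :=
    cf.comp ((hA.unifConv δ).comp ((hA'.unifConv_neg δ).comp cf'))
  have sr : ∀ n, SmoothFamily E E δ (conjTransition A A' (f n)) := fun n =>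
    smoothFamily_conjTransition hA hA' δ
  let Ξ : ℕ → ℝ → Diffeomorph 𝓘(ℝ, E) 𝓘(ℝ, E) M M ∞ := fun n t =>
    ((((f n).symm.trans (A' (-t))).trans (A t)).trans (f n)).trans
      ((Φ n t).trans ((A (-t)).trans (A' t)))
  have hΞ : ∀ n t x, Ξ n t x = A' t (A (-t) (Φ n t (conjTransition A A' (f n) t x))) :=
    fun _ _ _ => rfl
  have hΞ' : ∀ n t x, (Ξ n t).symm x =
      f n (A' t (A (-t) ((f n).symm ((Φ n t).symm (A t (A' (-t) x)))))) := by
    intro n t x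
    change f n ((A' (-t)).symm ((A t).symm ((f n).symm ((Φ n t).symm
      ((A (-t)).symm ((A' t).symm x)))))) = _
    rw [hA.symm, hA.symm, hA'.symm, hA'.symm, neg_neg]
  refine ⟨fun t x => φ (A' t (A (-t) (φ.symm (ψ t (A t (A' (-t) x)))))), Q₁ ∪ L,
    fun n t x => Real.exp t * (P x + incrementSum b A A' (f n) g (Φ n) t x) +
      K n t (conjTransition A A' (f n) t x), Ξ, _,
    hQ₁.union hL, fun n => ?_, fun n t ht x hx => ?_, fun n => ?_, fun n => ?_, fun n x => ?_,
    fun n t ht x hx => ?_, fun n t ht x => ?_,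
    (unifConv_incrementSum h hf hΦ hA hA' hb hερ hρ hQ₁ hQ₂ hQ₃ hQ hUQ hP hL hPL).add
      (hΦ.conv_fun.comp cr), ?_, ?_, fun t ht x => ?_, fun t ht x => ?_⟩
  · have h1 := (h n).smoothFamily_incrementSum hA hA' hb (by linarith) hQ₁.isClosed hQ (hΦ.smooth n)
    have h2 : ContMDiff (𝓘(ℝ, ℝ).prod 𝓘(ℝ, E)) 𝓘(ℝ, ℝ) ∞ fun q : ℝ × M => Real.exp q.1 :=
      Real.contDiff_exp.contMDiff.comp contMDiff_fst
    have h3 : ContMDiff (𝓘(ℝ, ℝ).prod 𝓘(ℝ, E)) 𝓘(ℝ, ℝ) ∞ fun q : ℝ × M => P q.2 :=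
      hP.comp contMDiff_snd
    exact ContMDiffOn.add (ContMDiffOn.mul h2.contMDiffOn (h3.contMDiffOn.add h1))
      ((hΦ.smooth_fun n).comp (sr n))
  · rw [mem_union, not_or] at hx
    rw [hPL x hx.2, (h n).incrementSum_eq_zero hA ht hx.1,
      hΦ.supp_fun n t ht _ fun h' => ((h n).eq_off hA ht hx.1).2.2.1 (hS h')]
    simp
  · exact (hA'.smoothFamily δ).comp ((hA.smoothFamily_neg δ).comp ((hΦ.smooth n).comp (sr n)))
  · have s1 := (SmoothFamily.of_contMDiff (δ := δ) (f n).contMDiff).comp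
      ((hA'.smoothFamily δ).comp ((hA.smoothFamily_neg δ).comp
      ((SmoothFamily.of_contMDiff (f n).symm.contMDiff).comp
      ((hΦ.smooth_symm n).comp ((hA.smoothFamily δ).comp (hA'.smoothFamily_neg δ))))))
    have e : (fun t => ((Ξ n t).symm : M → M)) = _ := funext fun t => funext (hΞ' n t)
    rw [e]
    exact s1
  · rw [hΞ]
    unfold conjTransition
    simp only [neg_zero, hA.zero, hA'.zero, Diffeomorph.apply_symm_apply, hΦ.init]
  · rw [mem_union, not_or] at hx
    rw [hΞ, ((h n).eq_off hA ht hx.1).2.2.2, hA'.apply_neg]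
  · exact (h n).hasGenerator hΩ hX hX' hA hA' hU hY hY' hb (by linarith) hQ₁.isClosed hQ hδ hP hdP
      (hf.symplectic n) (hΦ.smooth_fun n)
      (fun t ht x hx => hΦ.supp_fun n t ht x fun h' => hx (hS h')) (hΦ.smooth n) (hΦ.generator n)
      ht x
  · exact (hA'.unifConv δ).comp ((hA.unifConv_neg δ).comp (hΦ.conv.comp cr))
  · have c1 := cf.comp ((hA'.unifConv δ).comp ((hA.unifConv_neg δ).comp (cf'.comp
      (hΦ.conv_symm.comp ((hA.unifConv δ).comp (hA'.unifConv_neg δ))))))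
    simpa only [hΞ'] using c1
  · simp only [Homeomorph.symm_apply_apply, hA'.neg_apply, hA.apply_neg, Homeomorph.apply_symm_apply,
      hΦ.right_inv t ht, hA.neg_apply, hA'.apply_neg]
  · simp only [Homeomorph.symm_apply_apply, hA'.neg_apply, hA.apply_neg, Homeomorph.apply_symm_apply,
      hΦ.left_inv t ht, hA.neg_apply, hA'.apply_neg]

end TwistLimit

/-! ### Independence of the Liouville field -/

section Comparison

variable {E : Type*} [NormedAddCommGroup E] [NormedSpace ℝ E] [FiniteDimensional ℝ E]
  {M : Type*} [MetricSpace M] [SigmaCompactSpace M] [ChartedSpace E M] [IsManifold 𝓘(ℝ, E) ∞ M]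
  {X X' : VField E M} {Ω : DiffForm E M 2}

/-- Let `φ` be in the set `G₃` of `X`, and let `f n → φ`, `Φ n → [μ_t, φ]` be smooth approximations.
Then `[μ'_t, φ] = σ_t ∘ [μ_t, φ] ∘ φ ∘ σ_t⁻¹ ∘ φ⁻¹`, where `σ_t = μ'_t ∘ μ_t⁻¹`, is the limit of the
isotopies obtained by replacing `[μ_t, φ]` by `Φ n` and `φ` by `f n`. -/
theorem G3_subset_G3 (hΩ : IsSymplecticForm Ω) (hH : Subsingleton (H1c E M))
    (hX : IsLiouvilleField Ω X) (hX' : IsLiouvilleField Ω X') : G3 Ω X ⊆ G3 Ω X' := by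
  rintro φ ⟨hφs, hφc, δ₀, hδ₀, -, hiso⟩
  obtain ⟨S₁, f, hf⟩ := hφs.exists_approx
  obtain ⟨ψ, S₂, K, Φ, k, hΦ⟩ := hiso.exists_approx hΩ hδ₀
  have : LocallyCompactSpace M := Manifold.locallyCompact_of_finiteDimensional 𝓘(ℝ, E)
  have hS : IsCompact (S₁ ∪ S₂) := hf.compact.union hΦ.compact
  have hφS : homeoSupport φ ⊆ S₁ := homeoSupport_subset hf.compact.isClosed fun x hx =>
    hf.apply_eq_self hx
  obtain ⟨Q₁, hQ₁, hSQ₁⟩ := exists_compact_superset hS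
  obtain ⟨Q₂, hQ₂, hQ₁₂⟩ := exists_compact_superset hQ₁
  obtain ⟨Q₃, hQ₃, hQ₂₃⟩ := exists_compact_superset hQ₂
  obtain ⟨Y, T, A, hA, hY⟩ := IsSmoothField.exists_cutoff_flow hX.smooth hQ₃
  obtain ⟨Y', T', A', hA', hY'⟩ := IsSmoothField.exists_cutoff_flow hX'.smooth hQ₃
  -- the difference of the two Liouville forms is closed
  obtain ⟨hα, hdα⟩ := dForm_sub (hΩ.isSmoothForm_contract hX'.smooth)
    (hΩ.isSmoothForm_contract hX.smooth)
  rw [hX.d_contract, hX'.d_contract, sub_self] at hdα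
  obtain ⟨b, ρ, hρ, hb⟩ := exists_isIncrement (isExactNear_of_closed hα hdα) hQ₂
  obtain ⟨ε₁, hε₁, hSε⟩ := hS.exists_thickening_subset_open isOpen_interior hSQ₁
  obtain ⟨ε₂, hε₂, hQε⟩ := hQ₂.exists_thickening_subset_open isOpen_interior hQ₂₃
  set ε := min (ρ / 2) (min ε₁ ε₂)
  have hε : 0 < ε := lt_min (half_pos hρ) (lt_min hε₁ hε₂)
  have hle₁ : ε ≤ ε₁ := (min_le_right _ _).trans (min_le_left _ _)
  have hle₂ : ε ≤ ε₂ := (min_le_right _ _).trans (min_le_right _ _)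
  obtain ⟨τ, hτ, hτA⟩ := hA.exists_dist_lt (show 0 < ε / 3 by linarith)
  obtain ⟨τ', hτ', hτA'⟩ := hA'.exists_dist_lt (show 0 < ε / 3 by linarith)
  have cr : UnifConv δ₀ (fun n t x => Φ n t (conjTransition A A' (f n) t x)) _ :=
    hΦ.conv.comp ((hf.conv δ₀).comp ((hA.unifConv δ₀).comp
      ((hA'.unifConv_neg δ₀).comp (hf.conv_symm δ₀))))
  obtain ⟨τ₁, hτ₁, N₁, hN₁⟩ := cr.exists_dist_lt hδ₀ (fun x => by
    rw [neg_zero, hA.zero, hA'.zero, φ.apply_symm_apply]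
    exact hΦ.conv.eq_of_forall_eq ⟨le_rfl, hδ₀.le⟩ fun n => hΦ.init n x)
    (show 0 < ε / 3 by linarith)
  obtain ⟨N₂, hN₂⟩ := eventually_atTop.1
    (Metric.tendstoUniformlyOn_iff.1 (hf.conv_symm 0).tendsto (ε / 6) (by linarith))
  have hN₂' : ∀ n ≥ N₂, ∀ x, dist (φ.symm x) ((f n).symm x) < ε / 6 := fun n hn x =>
    hN₂ n hn ((0 : ℝ), x) ⟨by simp, mem_univ _⟩
  set N := max N₁ N₂
  set δ := min δ₀ (min τ (min τ' τ₁))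
  have hδ : 0 < δ := lt_min hδ₀ (lt_min hτ (lt_min hτ' hτ₁))
  have hδ₀' : δ ≤ δ₀ := min_le_left _ _
  have hδτ : δ ≤ τ := (min_le_right _ _).trans (min_le_left _ _)
  have hδτ' : δ ≤ τ' := (min_le_right _ _).trans ((min_le_right _ _).trans (min_le_left _ _))
  have hδτ₁ : δ ≤ τ₁ := (min_le_right _ _).trans ((min_le_right _ _).trans (min_le_right _ _))
  -- the inverse of a single term `f N` serves as the smooth reference map close to all the later
  -- `(f n)⁻¹`, whence the bound `ε / 6` above
  obtain ⟨P, L, hP, hL, hPL, hdP⟩ := exists_compact_primitive hH hα hdα (f N).symm.contMDiff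
    hf.compact fun x hx => Diffeomorph.symm_eq_self (hf.supp N x hx)
  have hbounds : ∀ n, TwistBounds δ ε (S₁ ∪ S₂) Q₁ Q₂ (interior Q₃) A A' (f (n + N)) (f N).symm
      (Φ (n + N)) := by
    intro n
    have hn₁ : N₁ ≤ n + N := (le_max_left _ _).trans (Nat.le_add_left _ _)
    have hn₂ : N₂ ≤ n + N := (le_max_right _ _).trans (Nat.le_add_left _ _)
    refine ⟨fun s hs => hτA s (hs.trans hδτ), fun s hs => hτA' s (hs.trans hδτ'), fun x => ?_,
      fun t ht => hN₁ _ hn₁ t ⟨ht.1, ht.2.trans hδ₀'⟩ (ht.2.trans hδτ₁), fun x hx => ?_,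
      fun x hx => ?_, fun t ht x hx => ?_, hS, fun x hx y hxy => ?_, fun x hx y hxy => ?_, ?_⟩
    · linarith [dist_triangle_left ((f (n + N)).symm x) ((f N).symm x) (φ.symm x),
        hN₂' _ hn₂ x, hN₂' N (le_max_right _ _) x]
    · exact hf.supp _ x fun h => hx (Or.inl h)
    · exact Diffeomorph.symm_eq_self (hf.supp _ x fun h => hx (Or.inl h))
    · exact hΦ.supp _ t ⟨ht.1, ht.2.trans hδ₀'⟩ x fun h => hx (Or.inr h)
    · exact interior_subset (hSε (Metric.mem_thickening_iff.2 ⟨x, hx, hxy.trans_le hle₁⟩))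
    · exact hQε (Metric.mem_thickening_iff.2 ⟨x, hx, hxy.trans_le hle₂⟩)
    · exact (hSQ₁.trans interior_subset).trans (hQ₁₂.trans interior_subset)
  have hφQ₂ : homeoSupport φ ⊆ Q₂ :=
    hφS.trans (subset_union_left.trans ((hbounds 0).subset))
  have horb : ∀ t ∈ Icc 0 δ, ∀ x ∈ homeoSupport φ, ∀ s ∈ uIcc 0 t,
      A s x ∈ interior Q₃ ∧ A' s x ∈ interior Q₃ := by
    intro t ht x hx s hs
    rw [uIcc_of_le ht.1] at hs
    obtain ⟨h1, -⟩ := abs_le_of_mem_Icc ht hs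
    exact ⟨(hbounds 0).thickening' x (hφQ₂ hx) _ (((hbounds 0).dist_flow s h1 x).trans
        (by linarith)),
      (hbounds 0).thickening' x (hφQ₂ hx) _ (((hbounds 0).dist_flow' s h1 x).trans (by linarith))⟩
  have hYU : ∀ y ∈ interior Q₃, Y y = X y := fun y hy => hY y (interior_subset hy)
  have hYU' : ∀ y ∈ interior Q₃, Y' y = X' y := fun y hy => hY' y (interior_subset hy)
  obtain ⟨ψ', S', K', Φ', k', h⟩ := exists_hamiltonianApprox_twist hbounds (hf.shift N)
    ((hΦ.mono hδ hδ₀').shift N) subset_union_right hΩ hX hX' hA hA' isOpen_interior hYU hYU' hb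
    (min_le_left _ _) hρ hQ₁ hQ₂ hQ₃ hQ₁₂ interior_subset hδ hP hL hPL hdP
  refine ⟨hφs, hφc, δ, hδ,
    fun t ht x hx => ⟨_, hA'.isTrajectory hYU' fun s hs => (horb t ht x hx s hs).2⟩,
    (h.congr_limit fun t ht x => ?_).isC0HamiltonianIsotopy⟩
  rw [hA.flowCommutator_eq hX.smooth hYU fun x hx s hs => (horb t ht x hx s hs).1,
    hA'.flowCommutator_eq hX'.smooth hYU' fun x hx s hs => (horb t ht x hx s hs).2,
    φ.symm_apply_apply, hA.neg_apply, hA.neg_apply]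

end Comparison

end CalabiGroups

end

theorem proposition2p3p5
    {E : Type*} [NormedAddCommGroup E] [NormedSpace ℝ E] [FiniteDimensional ℝ E]
    {M : Type*} [MetricSpace M] [SigmaCompactSpace M] [ChartedSpace E M]
    [IsManifold 𝓘(ℝ, E) ∞ M]
    (Ω : CalabiGroups.DiffForm E M 2) (hΩ : CalabiGroups.IsSymplecticForm Ω) :
    (∀ X : CalabiGroups.VField E M, CalabiGroups.IsLiouvilleField Ω X →
      ∃ G : Subgroup (M ≃ₜ M), (G : Set (M ≃ₜ M)) = CalabiGroups.G3 Ω X) ∧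
    (Subsingleton (CalabiGroups.H1c E M) →
      ∀ X X' : CalabiGroups.VField E M,
        CalabiGroups.IsLiouvilleField Ω X → CalabiGroups.IsLiouvilleField Ω X' →
          CalabiGroups.G3 Ω X = CalabiGroups.G3 Ω X') := by
  refine ⟨fun X hX => ⟨CalabiGroups.subgroupG3 hΩ hX.smooth, rfl⟩, fun hH X X' hX hX' => ?_⟩
  exact Set.Subset.antisymm (CalabiGroups.G3_subset_G3 hΩ hH hX hX')
    (CalabiGroups.G3_subset_G3 hΩ hH hX' hX)
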